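/- Let $K$ be a field of characteristic zero. Let $M$ be a $\mathbb Z$-graded Lie algebra over $K$, with a degree-preserving linear projection $P:M\to M$, $P^2=P$, such that $L=\ker P$ and $A=\operatorname{Im}P$ are graded Lie subalgebras; put $P^\bot=\mathrm{id}-P$. Let $\operatorname{Der}(M/L)=\bigoplus_i\operatorname{Der}^i(M/L)$ be the graded Lie algebra of graded derivations $D$ of $M$ with $D(L)\subset L$. Write $s^{-1}V=V[1]$, let $B_j$ be the Bernoulli numbers with $\sum_j B_jt^j/j!=t/(e^t-1)$, put $B_j(1)=(-1)^jB_j$, and let $\varepsilon(\sigma)$ be the Koszul sign. An $L_\infty[1]$ structure on a graded space $V$ is a degree one coderivation $Q$ of the reduced symmetric coalgebra $\overline S(V)$ with $Q^2=0$; equivalently, its sequence $(q_1,q_2,\dots)$ of Taylor coefficients $q_i:V^{\odot i}\to V$. For homogeneous $a_1,\dots,a_i\in A$ put $$\Phi(m)_i(a_1\odot\cdots\odot a_i)=\sum_{\sigma\in S_i}\varepsilon(\sigma)\sum_{k=0}^{i}\frac{B_{i-k}}{k!(i-k)!}[\cdots[P([\cdots[m,a_{\sigma(1)}]\cdots,a_{\sigma(k)}]),a_{\sigma(k+1)}]\cdots,a_{\sigma(i)}]\quad(m\in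 M),$$ $$\Phi(D)_i(a_1\odot\cdots\odot a_i)=\sum_{\sigma\in S_i}\varepsilon(\sigma)\sum_{k=1}^{i}\frac{B_{i-k}}{k!(i-k)!}[\cdots[P([\cdots[Da_{\sigma(1)},a_{\sigma(2)}]\cdots,a_{\sigma(k)}]),a_{\sigma(k+1)}]\cdots,a_{\sigma(i)}]\quad(D\in\operatorname{Der}(M/L)).$$ (1) There is an $L_\infty[1]$ structure $R$ on $s^{-1}\operatorname{Der}(M/L)\times s^{-1}M\times A$ with Taylor coefficients, on homogeneous elements, $$r_1(s^{-1}D,s^{-1}m,a)=(0,0,Pm),\qquad r_2(s^{-1}m_1\odot s^{-1}m_2)=(-1)^{|m_1|}s^{-1}[m_1,m_2],$$ $$r_2(s^{-1}D_1\odot s^{-1}D_2)=(-1)^{|D_1|}s^{-1}[D_1,D_2],\qquad r_2(s^{-1}D\otimes s^{-1}m)=(-1)^{|D|}s^{-1}Dm,$$ $$r_{i+1}(s^{-1}D\otimes a_1\odot\cdots\odot a_i)=\Phi(D)_i(a_1\odot\cdots\odot a_i),\qquad r_{i+1}(s^{-1}m\otimes a_1\odot\cdots\odot a_i)=\Phi(m)_i(a_1\odot\cdots\odot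 a_i)\qquad(i\ge1),$$ and zero on all other types of arguments. (2) There is an $L_\infty[1]$ structure $Q$ on $s^{-1}\operatorname{Der}(M/L)\times(s^{-1}M\times s^{-1}L\times M)$, extending that of the desuspended mapping cocylinder of the inclusion $L\to M$ (with zero differentials) by $\operatorname{Der}(M/L)$, with Taylor coefficients, for $n_j\in M$ (the last factor), $$q_1(s^{-1}D,s^{-1}m,s^{-1}l,n)=(0,0,0,m-l),$$ $$q_2(s^{-1}x_1\odot s^{-1}x_2)=(-1)^{|x_1|}s^{-1}[x_1,x_2]\ \text{ for } x_1,x_2 \text{ both in } M,\text{ both in }L,\text{ or both in }\operatorname{Der}(M/L),$$ $$q_2(s^{-1}D\otimes s^{-1}m)=(-1)^{|D|}s^{-1}Dm,\quad q_2(s^{-1}D\otimes s^{-1}l)=(-1)^{|D|}s^{-1}Dl,\quad q_2(s^{-1}D\otimes n)=Dn,$$ $$q_{i+1}(s^{-1}m\otimes n_1\odot\cdots\odot n_i)=\frac{B_i(1)}{i!}\sum_{\sigma\in S_i}\varepsilon(\sigma)[\cdots[m,n_{\sigma(1)}]\cdots,n_{\sigma(i)}],$$ $$q_{i+1}(s^{-1}l\otimes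 n_1\odot\cdots\odot n_i)=-\frac{B_i}{i!}\sum_{\sigma\in S_i}\varepsilon(\sigma)[\cdots[l,n_{\sigma(1)}]\cdots,n_{\sigma(i)}]\qquad(i\ge1),$$ and zero on all other types of arguments. (3) The maps $\pi(s^{-1}D,s^{-1}m,s^{-1}l,n)=(s^{-1}D,s^{-1}m,Pn)$, $f_1(s^{-1}D,s^{-1}m,a)=(s^{-1}D,s^{-1}m,s^{-1}P^\bot m,a)$ and $h(s^{-1}D,s^{-1}m,s^{-1}l,n)=(0,0,s^{-1}P^\bot n,0)$ are homotopy retraction data ($\pi$, $f_1$ are morphisms of complexes for $q_1$, $r_1$; $h$ has degree $-1$; $\pi f_1=\mathrm{id}$; $hq_1+q_1h=f_1\pi-\mathrm{id}$), and $R$ is obtained from $Q$ by homotopy transfer along them: if $F$ is the morphism of reduced symmetric coalgebras with corestriction $pF=f_1+hq_+F$, where $q_+=pQ-q_1$, then $pR=r_1+\pi q_+F$. -/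

import Mathlib

/-! Graded spaces are `K`-modules `V` together with a family `𝒱 : ℤ → Submodule K V` such that
`V` is the internal direct sum of the `𝒱 i`.  The desuspension `s⁻¹V = V[1]` has the same
underlying module as `V`, and `(s⁻¹V)^i = V^(i+1)`. -/

noncomputable section

/-- A graded Lie algebra on the graded space `(M, ℳ)`. -/
structure GradedLieStructure {K M : Type*} [Field K] [AddCommGroup M] [Module K M]
    (ℳ : ℤ → Submodule K M) where
  isInternal : DirectSum.IsInternal ℳ
  bracket : M →ₗ[K] M →ₗ[K] M
  bracket_mem : ∀ {i j : ℤ} {x y : M}, x ∈ ℳ i → y ∈ ℳ j → bracket x y ∈ ℳ (i + j)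
  bracket_skew : ∀ {i j : ℤ} {x y : M}, x ∈ ℳ i → y ∈ ℳ j →
    bracket x y = -((i * j).negOnePow • bracket y x)
  jacobi : ∀ {i j k : ℤ} {x y z : M}, x ∈ ℳ i → y ∈ ℳ j → z ∈ ℳ k →
    bracket x (bracket y z) =
      bracket (bracket x y) z + (i * j).negOnePow • bracket y (bracket x z)

/-- `P` is a projection of the graded space `M` such that `L = Ker P` and `A = Im P` are
graded Lie subalgebras. -/
structure IsLieProjection {K M : Type*} [Field K] [AddCommGroup M] [Module K M]
    {ℳ : ℤ → Submodule K M} (g : GradedLieStructure ℳ) (P : M →ₗ[K] M) : Prop where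
  idem : ∀ x, P (P x) = P x
  map_mem : ∀ {i : ℤ} {x : M}, x ∈ ℳ i → P x ∈ ℳ i
  ker_closed : ∀ x ∈ LinearMap.ker P, ∀ y ∈ LinearMap.ker P, g.bracket x y ∈ LinearMap.ker P
  range_closed : ∀ x ∈ LinearMap.range P, ∀ y ∈ LinearMap.range P,
    g.bracket x y ∈ LinearMap.range P

/-- The Koszul sign `ε(σ; v₁, …, vₙ)`, where `d i` is the degree of `vᵢ`, i.e.
`v₁ ⊙ ⋯ ⊙ vₙ = ε(σ) v_σ(1) ⊙ ⋯ ⊙ v_σ(n)`. -/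
def koszulSign {n : ℕ} (d : Fin n → ℤ) (σ : Equiv.Perm (Fin n)) : ℤˣ :=
  ∏ p ∈ Finset.univ.filter (fun p : Fin n × Fin n => p.1 < p.2 ∧ σ p.2 < σ p.1),
    (d (σ p.1) * d (σ p.2)).negOnePow

/-- The `(k, n - k)`-unshuffles: permutations of `Fin n` which are increasing on the first `k`
and on the last `n - k` indices. -/
def unshuffles (n k : ℕ) : Finset (Equiv.Perm (Fin n)) :=
  Finset.univ.filter (fun σ => ∀ i j : Fin n, i < j → (j.val < k ∨ k ≤ i.val) → σ i < σ j)

section LInfinity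

variable {K V W : Type*} [Field K] [AddCommGroup V] [Module K V] [AddCommGroup W] [Module K W]

/-- The family `q` consists of graded symmetric maps of degree `e` for the gradings `𝒱`, `𝒲`,
i.e. of the Taylor coefficients of an element of `Hom^e(SV, W) = ∏ₙ Hom^e(V^{⊙n}, W)`. -/
structure IsGradedSymmetric (𝒱 : ℤ → Submodule K V) (𝒲 : ℤ → Submodule K W) (e : ℤ)
    (q : ∀ n : ℕ, MultilinearMap K (fun _ : Fin n => V) W) : Prop where
  map_mem : ∀ (n : ℕ) (d : Fin n → ℤ) (v : Fin n → V), (∀ i, v i ∈ 𝒱 (d i)) →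
    q n v ∈ 𝒲 ((∑ i, d i) + e)
  symm : ∀ (n : ℕ) (d : Fin n → ℤ) (v : Fin n → V), (∀ i, v i ∈ 𝒱 (d i)) →
    ∀ σ : Equiv.Perm (Fin n), q n (fun i => v (σ i)) = koszulSign d σ • q n v

/-- The `n`-th Taylor coefficient of `Q • Q` for `pQ = (q₁, q₂, …)`, evaluated on homogeneous
vectors `v` of degrees `d`:
`∑_{k=1}^n ∑_{σ ∈ S(k,n-k)} ε(σ) q_{n-k+1}(q_k(v_σ(1),…,v_σ(k)), v_σ(k+1),…,v_σ(n))`. -/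
def nijenhuisRichardsonSquare (q : ∀ n : ℕ, MultilinearMap K (fun _ : Fin n => V) V)
    (n : ℕ) (d : Fin n → ℤ) (v : Fin n → V) : V :=
  ∑ k : Fin n, ∑ σ ∈ unshuffles n (k.val + 1),
    koszulSign d σ •
      q (n - (k.val + 1) + 1)
        (Fin.cons (α := fun _ => V)
          (q (k.val + 1) (fun i => v (σ ⟨i.val, by omega⟩)))
          (fun i => v (σ ⟨k.val + 1 + i.val, by omega⟩)))

/-- An `L∞[1]` structure on the graded space `(V, 𝒱)`, i.e. a coderivation `Q` of degree one of
the reduced symmetric coalgebra of `V` with `Q² = 0`, through its Taylor coefficients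
`q₁, q₂, …`; there is no `q₀`, so we put `q₀ = 0`. -/
structure LInfinityOne (𝒱 : ℤ → Submodule K V) where
  isInternal : DirectSum.IsInternal 𝒱
  q : ∀ n : ℕ, MultilinearMap K (fun _ : Fin n => V) V
  q_zero : q 0 = 0
  gradedSymmetric : IsGradedSymmetric 𝒱 𝒱 1 q
  square_zero : ∀ (n : ℕ) (d : Fin n → ℤ) (v : Fin n → V), (∀ i, v i ∈ 𝒱 (d i)) →
    nijenhuisRichardsonSquare q n d v = 0

/-- The linear part `q₁` of an `L∞[1]` structure. -/
def LInfinityOne.linear {𝒱 : ℤ → Submodule K V} (Q : LInfinityOne 𝒱) (v : V) : V :=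
  Q.q 1 (fun _ => v)

/-- Homotopy retraction data from `(V, q₁)` to `(W, r₁)`, where `q₁` and `r₁` are the linear
parts of `Q` and `R`. -/
structure IsHomotopyRetraction {𝒱 : ℤ → Submodule K V} {𝒲 : ℤ → Submodule K W}
    (Q : LInfinityOne 𝒱) (R : LInfinityOne 𝒲)
    (π : V →ₗ[K] W) (f₁ : W →ₗ[K] V) (h : V →ₗ[K] V) : Prop where
  π_mem : ∀ {i : ℤ} {v : V}, v ∈ 𝒱 i → π v ∈ 𝒲 i
  f₁_mem : ∀ {i : ℤ} {w : W}, w ∈ 𝒲 i → f₁ w ∈ 𝒱 i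
  h_mem : ∀ {i : ℤ} {v : V}, v ∈ 𝒱 i → h v ∈ 𝒱 (i - 1)
  π_comm : ∀ v, π (Q.linear v) = R.linear (π v)
  f₁_comm : ∀ w, f₁ (R.linear w) = Q.linear (f₁ w)
  π_f₁ : ∀ w, π (f₁ w) = w
  homotopy : ∀ v, h (Q.linear v) + Q.linear (h v) = f₁ (π v) - v

/-- The multi-unshuffles `S(k₁, …, k_j)` of a composition `n = k₁ + ⋯ + k_j`: permutations
which are increasing on each block. -/
def multiUnshuffles {n : ℕ} (c : Composition n) : Finset (Equiv.Perm (Fin n)) :=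
  Finset.univ.filter (fun σ => ∀ (i : Fin c.length) (a b : Fin (c.blocksFun i)), a < b →
    σ (c.embedding i a) < σ (c.embedding i b))

/-- The value of `q₊ F = ∑_{j ≥ 2} q_j F^j` on homogeneous vectors `w` of degrees `d`, where `F`
is the morphism of symmetric coalgebras with Taylor coefficients `f`:
`∑_{j ≥ 2} 1/j! ∑_{k₁+⋯+k_j=n} ∑_{σ ∈ S(k₁,…,k_j)} ε(σ) q_j(f_{k₁}(w_σ(1),…),…,f_{k_j}(…,w_σ(n)))`. -/
def plusComp (q : ∀ n : ℕ, MultilinearMap K (fun _ : Fin n => V) V)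
    (f : ∀ n : ℕ, MultilinearMap K (fun _ : Fin n => W) V)
    (n : ℕ) (d : Fin n → ℤ) (w : Fin n → W) : V :=
  ∑ c ∈ (Finset.univ : Finset (Composition n)).filter (fun c => 2 ≤ c.length),
    ((Nat.factorial c.length : K)⁻¹) •
      ∑ σ ∈ multiUnshuffles c,
        koszulSign d σ •
          q c.length (fun i => f (c.blocksFun i) (fun a => w (σ (c.embedding i a))))

/-- `R` is induced from `Q` by homotopy transfer along `π, f₁, h`: if `F` is the morphism of
coalgebras determined by `pF = f₁ + h q₊ F`, then `pR = r₁ + π q₊ F`. -/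
def IsHomotopyTransfer {𝒱 : ℤ → Submodule K V} {𝒲 : ℤ → Submodule K W}
    (Q : LInfinityOne 𝒱) (R : LInfinityOne 𝒲)
    (π : V →ₗ[K] W) (f₁ : W →ₗ[K] V) (h : V →ₗ[K] V) : Prop :=
  IsHomotopyRetraction Q R π f₁ h ∧
  ∃ f : ∀ n : ℕ, MultilinearMap K (fun _ : Fin n => W) V,
    f 0 = 0 ∧ IsGradedSymmetric 𝒲 𝒱 0 f ∧
    (∀ w, f 1 w = f₁ (w 0)) ∧
    (∀ n, 2 ≤ n → ∀ (d : Fin n → ℤ) (w : Fin n → W), (∀ i, w i ∈ 𝒲 (d i)) →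
      f n w = h (plusComp Q.q f n d w)) ∧
    (∀ n, 2 ≤ n → ∀ (d : Fin n → ℤ) (w : Fin n → W), (∀ i, w i ∈ 𝒲 (d i)) →
      R.q n w = π (plusComp Q.q f n d w))

end LInfinity

section HDB

variable {K M : Type*} [Field K] [AddCommGroup M] [Module K M] {ℳ : ℤ → Submodule K M}

/-- `[⋯[[x, a₁], a₂]⋯, a_k]` for the list `a₁, …, a_k`. -/
def GradedLieStructure.nested (g : GradedLieStructure ℳ) (x : M) (l : List M) : M :=
  l.foldl (fun y a => g.bracket y a) x

/-- `[⋯[D a₁, a₂]⋯, a_k]` for the nonempty list `a₁, …, a_k`. -/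
def GradedLieStructure.nestedDer (g : GradedLieStructure ℳ) (D : M →ₗ[K] M) : List M → M
  | [] => 0
  | a :: l => g.nested (D a) l

/-- `Σ_σ ε(σ) [⋯[x, n_σ(1)]⋯, n_σ(i)]` for homogeneous `n₁, …, n_i` of degrees `d`. -/
def GradedLieStructure.symNested (g : GradedLieStructure ℳ) (x : M) {i : ℕ} (d : Fin i → ℤ)
    (n : Fin i → M) : M :=
  ∑ σ : Equiv.Perm (Fin i), koszulSign d σ • g.nested x (List.ofFn (fun j => n (σ j)))

/-- The higher derived bracket `Φ(m)_i(a₁ ⊙ ⋯ ⊙ a_i)`, for homogeneous `a₁, …, a_i` of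
degrees `d`. -/
def higherDerivedBracket (g : GradedLieStructure ℳ) (P : M →ₗ[K] M) (m : M) {i : ℕ}
    (d : Fin i → ℤ) (a : Fin i → M) : M :=
  ∑ σ : Equiv.Perm (Fin i), koszulSign d σ •
    ∑ k ∈ Finset.Icc 0 i,
      ((bernoulli (i - k) / (Nat.factorial k * Nat.factorial (i - k)) : ℚ) : K) •
        g.nested (P (g.nested m ((List.ofFn (fun j => a (σ j))).take k)))
          ((List.ofFn (fun j => a (σ j))).drop k)

/-- The higher derived bracket `Φ(D)_i(a₁ ⊙ ⋯ ⊙ a_i)`, for homogeneous `a₁, …, a_i` of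
degrees `d`. -/
def higherDerivedBracketDer (g : GradedLieStructure ℳ) (P : M →ₗ[K] M) (D : M →ₗ[K] M) {i : ℕ}
    (d : Fin i → ℤ) (a : Fin i → M) : M :=
  ∑ σ : Equiv.Perm (Fin i), koszulSign d σ •
    ∑ k ∈ Finset.Icc 1 i,
      ((bernoulli (i - k) / (Nat.factorial k * Nat.factorial (i - k)) : ℚ) : K) •
        g.nested (P (g.nestedDer D ((List.ofFn (fun j => a (σ j))).take k)))
          ((List.ofFn (fun j => a (σ j))).drop k)

/-- The derivations of degree `i` of `M` which map `L = Ker P` to itself. -/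
def relDerDeg (g : GradedLieStructure ℳ) (P : M →ₗ[K] M) (i : ℤ) : Submodule K (M →ₗ[K] M) where
  carrier := {D | (∀ j, ∀ x ∈ ℳ j, D x ∈ ℳ (j + i)) ∧
    (∀ j, ∀ x ∈ ℳ j, ∀ y, D (g.bracket x y) =
      g.bracket (D x) y + (i * j).negOnePow • g.bracket x (D y)) ∧
    ∀ x ∈ LinearMap.ker P, D x ∈ LinearMap.ker P}
  zero_mem' := by
    refine ⟨fun j x _ => by simp, fun j x _ y => by simp, fun x _ => by simp⟩
  add_mem' := by
    rintro D E ⟨h1, h2, h3⟩ ⟨k1, k2, k3⟩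
    refine ⟨fun j x hx => add_mem (h1 j x hx) (k1 j x hx), fun j x hx y => ?_,
      fun x hx => add_mem (h3 x hx) (k3 x hx)⟩
    simp only [LinearMap.add_apply, map_add, smul_add, h2 j x hx y, k2 j x hx y]
    abel
  smul_mem' := by
    rintro c D ⟨h1, h2, h3⟩
    refine ⟨fun j x hx => Submodule.smul_mem _ c (h1 j x hx), fun j x hx y => ?_,
      fun x hx => Submodule.smul_mem _ c (h3 x hx)⟩
    simp only [LinearMap.smul_apply, map_smul, smul_add, h2 j x hx y]
    rw [smul_comm c]

/-- The graded space `Der(M/L) = ⊕ᵢ Derⁱ(M/L)`, as a submodule of `End(M)`. -/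
def relDer (g : GradedLieStructure ℳ) (P : M →ₗ[K] M) : Submodule K (M →ₗ[K] M) :=
  ⨆ i, relDerDeg g P i

/-- The underlying module of `s⁻¹Der(M/L) × s⁻¹M × A`, where `A = Im P`. -/
abbrev HDBSpace (g : GradedLieStructure ℳ) (P : M →ₗ[K] M) : Type _ :=
  relDer g P × M × LinearMap.range P

/-- The underlying module of `s⁻¹Der(M/L) × (s⁻¹M × s⁻¹L × M)`, where `L = Ker P`. -/
abbrev CocylSpace (g : GradedLieStructure ℳ) (P : M →ₗ[K] M) : Type _ :=
  relDer g P × M × LinearMap.ker P × M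

/-- The grading of `s⁻¹Der(M/L) × s⁻¹M × A`. -/
def hdbGrading (g : GradedLieStructure ℳ) (P : M →ₗ[K] M) (i : ℤ) : Submodule K (HDBSpace g P) :=
  ((relDerDeg g P (i + 1)).comap (relDer g P).subtype).prod
    ((ℳ (i + 1)).prod ((ℳ i).comap (LinearMap.range P).subtype))

/-- The grading of `s⁻¹Der(M/L) × (s⁻¹M × s⁻¹L × M)`. -/
def cocylGrading (g : GradedLieStructure ℳ) (P : M →ₗ[K] M) (i : ℤ) :
    Submodule K (CocylSpace g P) :=
  ((relDerDeg g P (i + 1)).comap (relDer g P).subtype).prod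
    ((ℳ (i + 1)).prod (((ℳ (i + 1)).comap (LinearMap.ker P).subtype).prod (ℳ i)))

/-- `R` is given by the higher derived brackets: its Taylor coefficients on
`s⁻¹Der(M/L) × s⁻¹M × A` are as listed on all types of arguments. -/
structure IsHDBStructure (g : GradedLieStructure ℳ) (P : M →ₗ[K] M)
    (R : LInfinityOne (hdbGrading g P)) : Prop where
  /-- `r₁(s⁻¹D, s⁻¹m, a) = (0, 0, Pm)` -/
  linear : ∀ (D : relDer g P) (m : M) (a : LinearMap.range P),
    R.linear (D, m, a) = (0, 0, P.rangeRestrict m)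
  /-- `r₂(s⁻¹m₁ ⊙ s⁻¹m₂) = (-1)^|m₁| s⁻¹[m₁, m₂]` -/
  binary_m_m : ∀ (i j : ℤ), ∀ m₁ ∈ ℳ i, ∀ m₂ ∈ ℳ j,
    R.q 2 ![(0, m₁, 0), (0, m₂, 0)] = (0, i.negOnePow • g.bracket m₁ m₂, 0)
  /-- `r₂(s⁻¹D₁ ⊙ s⁻¹D₂) = (-1)^|D₁| s⁻¹[D₁, D₂]`, with the graded commutator -/
  binary_D_D : ∀ (i j : ℤ) (D₁ D₂ : relDer g P),
    (D₁ : M →ₗ[K] M) ∈ relDerDeg g P i → (D₂ : M →ₗ[K] M) ∈ relDerDeg g P j →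
    ∃ E : relDer g P,
      (E : M →ₗ[K] M) = D₁.val ∘ₗ D₂.val - (i * j).negOnePow • (D₂.val ∘ₗ D₁.val) ∧
      R.q 2 ![(D₁, 0, 0), (D₂, 0, 0)] = (i.negOnePow • E, 0, 0)
  /-- `r₂(s⁻¹D ⊗ s⁻¹m) = (-1)^|D| s⁻¹(Dm)` -/
  binary_D_m : ∀ (i j : ℤ) (D : relDer g P), (D : M →ₗ[K] M) ∈ relDerDeg g P i → ∀ m ∈ ℳ j,
    R.q 2 ![(D, 0, 0), (0, m, 0)] = (0, i.negOnePow • D.val m, 0)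
  /-- `r_{i+1}(s⁻¹D ⊗ a₁ ⊙ ⋯ ⊙ a_i) = Φ(D)_i(a₁ ⊙ ⋯ ⊙ a_i)` for `i ≥ 1` -/
  mixed_D : ∀ (i : ℕ), 1 ≤ i → ∀ (e : ℤ) (D : relDer g P),
    (D : M →ₗ[K] M) ∈ relDerDeg g P e →
    ∀ (d : Fin i → ℤ) (a : Fin i → LinearMap.range P), (∀ j, (a j : M) ∈ ℳ (d j)) →
    ∃ b : LinearMap.range P,
      (b : M) = higherDerivedBracketDer g P D.val d (fun j => (a j : M)) ∧
      R.q (i + 1) (Fin.cons (α := fun _ => HDBSpace g P) (D, 0, 0) (fun j => (0, 0, a j))) =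
        (0, 0, b)
  /-- `r_{i+1}(s⁻¹m ⊗ a₁ ⊙ ⋯ ⊙ a_i) = Φ(m)_i(a₁ ⊙ ⋯ ⊙ a_i)` for `i ≥ 1` -/
  mixed_m : ∀ (i : ℕ), 1 ≤ i → ∀ (e : ℤ), ∀ m ∈ ℳ e,
    ∀ (d : Fin i → ℤ) (a : Fin i → LinearMap.range P), (∀ j, (a j : M) ∈ ℳ (d j)) →
    ∃ b : LinearMap.range P,
      (b : M) = higherDerivedBracket g P m d (fun j => (a j : M)) ∧
      R.q (i + 1) (Fin.cons (α := fun _ => HDBSpace g P) (0, m, 0) (fun j => (0, 0, a j))) =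
        (0, 0, b)
  /-- All coefficients with `α` arguments in `s⁻¹Der(M/L)`, `β` in `s⁻¹M` and `γ` in `A` that are
  not listed above vanish. -/
  otherwise : ∀ (α β γ : ℕ), ¬ (α + β = 1 ∨ (α + β = 2 ∧ γ = 0)) →
    ∀ (D : Fin α → relDer g P) (m : Fin β → M) (a : Fin γ → LinearMap.range P),
      R.q (α + β + γ)
        (Fin.append (Fin.append (fun j => ((D j, 0, 0) : HDBSpace g P)) (fun j => (0, m j, 0)))
          (fun j => (0, 0, a j))) = 0

/-- `Q` is the `L∞[1]` structure on `s⁻¹Der(M/L) × (s⁻¹M × s⁻¹L × M)` extending the `L∞[1]`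
structure of the desuspended mapping cocylinder of the inclusion `L → M` (zero differentials) by
the action `(s⁻¹m, s⁻¹l, n) ↦ ((-1)^|D| s⁻¹Dm, (-1)^|D| s⁻¹Dl, Dn)` of `Der(M/L)`.
Here `bernoulli` and `bernoulli'` are the Bernoulli numbers `B_i(0)` and `B_i(1)`. -/
structure IsCocylExtension (g : GradedLieStructure ℳ) (P : M →ₗ[K] M)
    (Q : LInfinityOne (cocylGrading g P)) : Prop where
  /-- `q₁(s⁻¹D, s⁻¹m, s⁻¹l, n) = (0, 0, 0, m - l)` -/
  linear : ∀ (D : relDer g P) (m : M) (l : LinearMap.ker P) (n : M),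
    Q.linear (D, m, l, n) = (0, 0, 0, m - l)
  /-- `q₂(s⁻¹m₁ ⊙ s⁻¹m₂) = (-1)^|m₁| s⁻¹[m₁, m₂]` -/
  binary_m_m : ∀ (i j : ℤ), ∀ m₁ ∈ ℳ i, ∀ m₂ ∈ ℳ j,
    Q.q 2 ![(0, m₁, 0, 0), (0, m₂, 0, 0)] = (0, i.negOnePow • g.bracket m₁ m₂, 0, 0)
  /-- `q₂(s⁻¹l₁ ⊙ s⁻¹l₂) = (-1)^|l₁| s⁻¹[l₁, l₂]` -/
  binary_l_l : ∀ (i j : ℤ) (l₁ l₂ : LinearMap.ker P), (l₁ : M) ∈ ℳ i → (l₂ : M) ∈ ℳ j →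
    ∃ b : LinearMap.ker P, (b : M) = g.bracket l₁ l₂ ∧
      Q.q 2 ![(0, 0, l₁, 0), (0, 0, l₂, 0)] = (0, 0, i.negOnePow • b, 0)
  /-- `q₂(s⁻¹D₁ ⊙ s⁻¹D₂) = (-1)^|D₁| s⁻¹[D₁, D₂]`, with the graded commutator -/
  binary_D_D : ∀ (i j : ℤ) (D₁ D₂ : relDer g P),
    (D₁ : M →ₗ[K] M) ∈ relDerDeg g P i → (D₂ : M →ₗ[K] M) ∈ relDerDeg g P j →
    ∃ E : relDer g P,
      (E : M →ₗ[K] M) = D₁.val ∘ₗ D₂.val - (i * j).negOnePow • (D₂.val ∘ₗ D₁.val) ∧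
      Q.q 2 ![(D₁, 0, 0, 0), (D₂, 0, 0, 0)] = (i.negOnePow • E, 0, 0, 0)
  /-- `q₂(s⁻¹D ⊗ s⁻¹m) = (-1)^|D| s⁻¹(Dm)` -/
  binary_D_m : ∀ (i j : ℤ) (D : relDer g P), (D : M →ₗ[K] M) ∈ relDerDeg g P i → ∀ m ∈ ℳ j,
    Q.q 2 ![(D, 0, 0, 0), (0, m, 0, 0)] = (0, i.negOnePow • D.val m, 0, 0)
  /-- `q₂(s⁻¹D ⊗ s⁻¹l) = (-1)^|D| s⁻¹(Dl)` -/
  binary_D_l : ∀ (i j : ℤ) (D : relDer g P) (l : LinearMap.ker P),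
    (D : M →ₗ[K] M) ∈ relDerDeg g P i → (l : M) ∈ ℳ j →
    ∃ b : LinearMap.ker P, (b : M) = D.val l ∧
      Q.q 2 ![(D, 0, 0, 0), (0, 0, l, 0)] = (0, 0, i.negOnePow • b, 0)
  /-- `q₂(s⁻¹D ⊗ n) = Dn` -/
  binary_D_n : ∀ (i j : ℤ) (D : relDer g P), (D : M →ₗ[K] M) ∈ relDerDeg g P i → ∀ n ∈ ℳ j,
    Q.q 2 ![(D, 0, 0, 0), (0, 0, 0, n)] = (0, 0, 0, D.val n)
  /-- `q_{i+1}(s⁻¹m ⊗ n₁ ⊙ ⋯ ⊙ n_i) = (B_i(1)/i!) Σ_σ ε(σ) [⋯[m, n_σ(1)]⋯, n_σ(i)]` for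
  `i ≥ 1` -/
  mixed_m : ∀ (i : ℕ), 1 ≤ i → ∀ (e : ℤ), ∀ m ∈ ℳ e,
    ∀ (d : Fin i → ℤ) (n : Fin i → M), (∀ j, n j ∈ ℳ (d j)) →
      Q.q (i + 1) (Fin.cons (α := fun _ => CocylSpace g P) (0, m, 0, 0)
          (fun j => (0, 0, 0, n j))) =
        (0, 0, 0, ((bernoulli' i / Nat.factorial i : ℚ) : K) • g.symNested m d n)
  /-- `q_{i+1}(s⁻¹l ⊗ n₁ ⊙ ⋯ ⊙ n_i) = -(B_i(0)/i!) Σ_σ ε(σ) [⋯[l, n_σ(1)]⋯, n_σ(i)]` for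
  `i ≥ 1` -/
  mixed_l : ∀ (i : ℕ), 1 ≤ i → ∀ (e : ℤ) (l : LinearMap.ker P), (l : M) ∈ ℳ e →
    ∀ (d : Fin i → ℤ) (n : Fin i → M), (∀ j, n j ∈ ℳ (d j)) →
      Q.q (i + 1) (Fin.cons (α := fun _ => CocylSpace g P) (0, 0, l, 0)
          (fun j => (0, 0, 0, n j))) =
        (0, 0, 0, -(((bernoulli i / Nat.factorial i : ℚ) : K) • g.symNested (l : M) d n))
  /-- All coefficients with `α` arguments in `s⁻¹Der(M/L)`, `β` in `s⁻¹M`, `γ` in `s⁻¹L` and `δ`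
  in `M` that are not listed above vanish. -/
  otherwise : ∀ (α β γ δ : ℕ),
    ¬ (α + β + γ + δ = 1 ∨ (α + β + γ = 2 ∧ δ = 0 ∧ ¬ (β = 1 ∧ γ = 1)) ∨
      (α = 1 ∧ β = 0 ∧ γ = 0 ∧ δ = 1) ∨ (α = 0 ∧ β + γ = 1)) →
    ∀ (D : Fin α → relDer g P) (m : Fin β → M) (l : Fin γ → LinearMap.ker P) (n : Fin δ → M),
      Q.q (α + β + γ + δ)
        (Fin.append (Fin.append (Fin.append (fun j => ((D j, 0, 0, 0) : CocylSpace g P))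
          (fun j => (0, m j, 0, 0))) (fun j => (0, 0, l j, 0))) (fun j => (0, 0, 0, n j))) = 0

/-- `P^⊥ = id - P`, as a map from `M` to `L = Ker P`. -/
def projCompl {g : GradedLieStructure ℳ} {P : M →ₗ[K] M} (hP : IsLieProjection g P) :
    M →ₗ[K] LinearMap.ker P :=
  (LinearMap.id - P).codRestrict (LinearMap.ker P) (fun x => by simp [hP.idem])

/-- `π(s⁻¹D, (s⁻¹m, s⁻¹l, n)) = (s⁻¹D, s⁻¹m, Pn)`. -/
def retrProj (g : GradedLieStructure ℳ) (P : M →ₗ[K] M) : CocylSpace g P →ₗ[K] HDBSpace g P where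
  toFun x := (x.1, x.2.1, P.rangeRestrict x.2.2.2)
  map_add' x y := by simp
  map_smul' c x := by simp

/-- `f₁(s⁻¹D, s⁻¹m, a) = (s⁻¹D, (s⁻¹m, s⁻¹P^⊥m, a))`. -/
def retrIncl {g : GradedLieStructure ℳ} {P : M →ₗ[K] M} (hP : IsLieProjection g P) :
    HDBSpace g P →ₗ[K] CocylSpace g P where
  toFun x := (x.1, x.2.1, projCompl hP x.2.1, (x.2.2 : M))
  map_add' x y := by simp
  map_smul' c x := by simp

/-- `h(s⁻¹D, (s⁻¹m, s⁻¹l, n)) = (0, (0, s⁻¹P^⊥n, 0))`. -/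
def retrHomotopy {g : GradedLieStructure ℳ} {P : M →ₗ[K] M} (hP : IsLieProjection g P) :
    CocylSpace g P →ₗ[K] CocylSpace g P where
  toFun x := (0, 0, projCompl hP x.2.2.2, 0)
  map_add' x y := by simp
  map_smul' c x := by simp

end HDB

end

/-!
The square-zero conditions and the homotopy transfer are reduced to power series identities in one
nilpotent operator.

*Absorbing the derivations.*  A triple `(s⁻¹D, s⁻¹m, a)` is read off from the two elements
`κ = (D, m)` and `α = (0, a)` of the graded Lie algebra `Der(M/L) ⋉ M` (`semidirect`), and
`(s⁻¹D, s⁻¹m, s⁻¹l, n)` from `κ = (D, m)`, `κ' = (D, l)` and `ν = (0, n)`.  In these terms the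
derivations need no separate treatment: the coefficients with values in `M` are
`B_j(1)/j! [⋯[κ, ν]⋯, ν] - B_j/j! [⋯[κ', ν]⋯, ν]` (`cocylMul`; the derivation components of the two
terms cancel), the coefficients with values in `A` are
`Σ_k B_{m-k}/(k! (m-k)!) [⋯[P [⋯[κ, α]⋯, α], α]⋯, α]` (`hdbMul`), and the remaining ones are
the brackets `½ [ςκ, κ]`, where `ς` is the parity sign.  The structures are the graded
symmetrizations (`gradedSymm`) of these multilinear maps.

*Families.*  Evaluating everything on `X = Σ_i t_i v_i`, with graded commuting parameters `t_i` of
square zero, replaces graded symmetric maps by power series.  An element of the extended space is a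
function `Finset ι → V` (`IsFamily`), and `conv` and `convBilin` extend multilinear maps to it.
`nijenhuisRichardsonSquare_gradedSymm` and `plusComp_gradedSymm` say that the sums over unshuffles
in the definitions become, respectively, the derivative of the vector field in its own direction
and the composition of maps.

*Power series.*  Let `z = [·, ν X]`, `φ(t) = t/(1 - e^{-t})`, `ψ(t) = t/(e^t - 1)`,
`J(t) = (e^t - 1)/t`.  The vector fields are `y = φ(z) κ - ψ(z) κ'` and `y = ψ(z) P e^z κ`, and
differentiating along them amounts to replacing `z` by `z + ε [·, y]` (`dualEnd`).  Since `Jψ = 1`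
and `Jφ = exp`, applying `J` turns the squares into combinations of `[g, g]`, `[g, h]` and `[h, h]`
with `g = e^z κ` that cancel; the second one collapses to `P [P^⊥ g, P^⊥ g] = 0`
(`cocylinder_square_zero`, `derivedBrackets_square_zero`).

*Transfer.*  The morphism `F` has `κ' F = P^⊥ e^z κ`.  Substituted into `φ(z) κ - ψ(z) κ'`, this
gives `ψ(z) e^z κ - ψ(z) P^⊥ e^z κ = ψ(z) P e^z κ`, which is the vector field of higher derived
brackets and lies in `A` (`cocylPath_plusComp`).
-/

/-! ### Koszul signs -/

/-- Permuting a product over increasing pairs: if `s a b` and `s b a` differ by the factor `c a b`,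
then each inversion of `ρ` contributes one such factor. -/
theorem prod_increasing_pairs_perm {α : Type*} [CommMonoid α] {k : ℕ} (s c : Fin k → Fin k → α)
    (hs : ∀ a b, a ≠ b → s a b = c a b * s b a) (ρ : Equiv.Perm (Fin k)) :
    ∏ p ∈ Finset.univ.filter (fun p : Fin k × Fin k => p.1 < p.2), s (ρ p.1) (ρ p.2) =
      (∏ p ∈ Finset.univ.filter (fun p : Fin k × Fin k => p.1 < p.2 ∧ ρ p.2 < ρ p.1),
        c (ρ p.1) (ρ p.2)) *
      ∏ p ∈ Finset.univ.filter (fun p : Fin k × Fin k => p.1 < p.2), s p.1 p.2 := by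
  have h1 : ∀ p ∈ Finset.univ.filter (fun p : Fin k × Fin k => p.1 < p.2),
      s (ρ p.1) (ρ p.2) = (if ρ p.2 < ρ p.1 then c (ρ p.1) (ρ p.2) else 1) *
        s (min (ρ p.1) (ρ p.2)) (max (ρ p.1) (ρ p.2)) := by
    intro p hp
    split_ifs with h
    · rw [min_eq_right h.le, max_eq_left h.le]
      exact hs _ _ (ne_of_gt h)
    · rw [not_lt] at h
      rw [min_eq_left h, max_eq_right h, one_mul]
  rw [Finset.prod_congr rfl h1, Finset.prod_mul_distrib, ← Finset.prod_filter,
    Finset.filter_filter]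
  congr 1
  refine Finset.prod_bij
    (fun p _ => (min (ρ p.1) (ρ p.2), max (ρ p.1) (ρ p.2))) ?_ ?_ ?_ ?_
  · intro p hp
    have hp' : p.1 < p.2 := by simpa using hp
    have : ρ p.1 ≠ ρ p.2 := fun h => hp'.ne (ρ.injective h)
    simpa [eq_comm] using this
  · rintro ⟨a, b⟩ hp ⟨a', b'⟩ hp' h
    have hp : a < b := by simpa using hp
    have hp' : a' < b' := by simpa using hp'
    have h1 : min (ρ a) (ρ b) = min (ρ a') (ρ b') := congrArg Prod.fst h
    have h2 : max (ρ a) (ρ b) = max (ρ a') (ρ b') := congrArg Prod.snd h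
    have key : (ρ a = ρ a' ∧ ρ b = ρ b') ∨ (ρ a = ρ b' ∧ ρ b = ρ a') := by
      rcases le_total (ρ a) (ρ b) with u | u <;> rcases le_total (ρ a') (ρ b') with w | w <;>
        simp [u, w] at h1 h2 <;> simp [h1, h2]
    rcases key with ⟨u, w⟩ | ⟨u, w⟩
    · rw [ρ.injective u, ρ.injective w]
    · have e1 := ρ.injective u
      have e2 := ρ.injective w
      omega
  · rintro ⟨a, b⟩ hp
    have hp : a < b := by simpa using hp
    rcases lt_or_ge (ρ.symm a) (ρ.symm b) with h | h
    · exact ⟨(ρ.symm a, ρ.symm b), by simpa using h, by simp [hp.le]⟩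
    · have h' : ρ.symm b < ρ.symm a := lt_of_le_of_ne h (fun e => hp.ne (ρ.symm.injective e).symm)
      exact ⟨(ρ.symm b, ρ.symm a), by simpa using h', by simp [hp.le]⟩
  · intro p _
    rfl

theorem koszulSign_eq_prod_pairs {n : ℕ} (d : Fin n → ℤ) (σ : Equiv.Perm (Fin n)) :
    koszulSign d σ = ∏ p ∈ Finset.univ.filter (fun p : Fin n × Fin n => p.1 < p.2),
      (if σ p.2 < σ p.1 then (d (σ p.1) * d (σ p.2)).negOnePow else 1) := by
  rw [koszulSign, ← Finset.prod_filter, Finset.filter_filter]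

theorem koszulSign_mul {n : ℕ} (d : Fin n → ℤ) (σ τ : Equiv.Perm (Fin n)) :
    koszulSign d (σ * τ) = koszulSign d σ * koszulSign (fun i => d (σ i)) τ := by
  rw [koszulSign_eq_prod_pairs d (σ * τ), koszulSign_eq_prod_pairs d σ, mul_comm]
  refine prod_increasing_pairs_perm
    (fun a b => if σ b < σ a then (d (σ a) * d (σ b)).negOnePow else 1)
    (fun a b => (d (σ a) * d (σ b)).negOnePow) ?_ τ
  intro a b hab
  rcases lt_or_gt_of_ne (fun h => hab (σ.injective h) : σ a ≠ σ b) with h | h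
  · simp only [h, not_lt_of_gt h, if_true, if_false, mul_comm (d (σ b))]
    exact (Int.units_mul_self _).symm
  · simp [h, not_lt_of_gt h]

theorem koszulSign_congr {n : ℕ} {d d' : Fin n → ℤ}
    (h : ∀ i j, (d i * d j).negOnePow = (d' i * d' j).negOnePow) (σ : Equiv.Perm (Fin n)) :
    koszulSign d σ = koszulSign d' σ :=
  Finset.prod_congr rfl fun _ _ => h _ _

theorem koszulSign_eq_one {n : ℕ} {d : Fin n → ℤ} (h : ∀ i j, i ≠ j → d i * d j = 0)
    (σ : Equiv.Perm (Fin n)) : koszulSign d σ = 1 := by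
  refine Finset.prod_eq_one fun p hp => ?_
  rw [h _ _ fun e => ?_, Int.negOnePow_zero]
  have := (Finset.mem_filter.1 hp).2.1
  exact this.ne (σ.injective e)

@[simp]
theorem koszulSign_one {n : ℕ} (d : Fin n → ℤ) : koszulSign d 1 = 1 := by
  refine Finset.prod_eq_one fun p hp => ?_
  have := (Finset.mem_filter.1 hp).2
  exact absurd this.1 (not_lt_of_gt this.2)

/-- A permutation fixing `0` has the Koszul sign of its restriction to the other indices. -/
theorem koszulSign_decomposeFin {n : ℕ} (d : Fin (n + 1) → ℤ) (τ : Equiv.Perm (Fin n)) :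
    koszulSign d (Equiv.Perm.decomposeFin.symm (0, τ)) = koszulSign (fun i => d i.succ) τ := by
  simp only [koszulSign, Finset.prod_filter, Fintype.prod_prod_type, Fin.prod_univ_succ]
  simp

/-! ### Parity in a graded space -/

section Parity

variable {K V W : Type*} [Field K] [AddCommGroup V] [Module K V] [AddCommGroup W] [Module K W]

/-- The projection of a graded space onto its odd part. -/
noncomputable def oddPart {𝒱 : ℤ → Submodule K V} (h𝒱 : DirectSum.IsInternal 𝒱) : V →ₗ[K] V :=
  open Classical in
  DirectSum.toModule K ℤ V (fun i => if Odd i then (𝒱 i).subtype else 0) ∘ₗ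
    (LinearEquiv.ofBijective (DirectSum.coeLinearMap 𝒱)
      (show Function.Bijective (DirectSum.coeLinearMap 𝒱) from h𝒱)).symm.toLinearMap

variable {𝒱 : ℤ → Submodule K V} (h𝒱 : DirectSum.IsInternal 𝒱)

theorem oddPart_of_mem {i : ℤ} {v : V} (hv : v ∈ 𝒱 i) :
    oddPart h𝒱 v = open Classical in if Odd i then v else 0 := by
  classical
  have h : (LinearEquiv.ofBijective (DirectSum.coeLinearMap 𝒱)
      (show Function.Bijective (DirectSum.coeLinearMap 𝒱) from h𝒱)).symm v =
      DirectSum.lof K ℤ (fun i => 𝒱 i) i ⟨v, hv⟩ := by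
    rw [LinearEquiv.symm_apply_eq]
    simp
  simp only [oddPart, LinearMap.comp_apply, LinearEquiv.coe_coe, h, DirectSum.toModule_lof]
  split_ifs <;> simp

theorem oddPart_of_even {i : ℤ} {v : V} (hv : v ∈ 𝒱 i) (hi : Even i) : oddPart h𝒱 v = 0 := by
  rw [oddPart_of_mem h𝒱 hv, if_neg (Int.not_odd_iff_even.2 hi)]

theorem oddPart_of_odd {i : ℤ} {v : V} (hv : v ∈ 𝒱 i) (hi : Odd i) : oddPart h𝒱 v = v := by
  rw [oddPart_of_mem h𝒱 hv, if_pos hi]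

include h𝒱 in
/-- Linear maps out of a graded space are determined by their values on homogeneous vectors. -/
theorem linearMap_ext_of_homogeneous {f f' : V →ₗ[K] W}
    (h : ∀ i, ∀ v ∈ 𝒱 i, f v = f' v) : f = f' := by
  refine LinearMap.ext fun v => ?_
  have hv : v ∈ ⨆ i, 𝒱 i := by
    rw [h𝒱.submodule_iSup_eq_top]; trivial
  induction hv using Submodule.iSup_induction' with
  | mem i x hx => exact h i x hx
  | zero => simp
  | add x y _ _ hx hy => simp [hx, hy]

/-- The parity operator `v ↦ (-1)^|v| v`. -/
noncomputable def paritySign : V →ₗ[K] V := LinearMap.id - (2 : K) • oddPart h𝒱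

theorem paritySign_of_mem {i : ℤ} {v : V} (hv : v ∈ 𝒱 i) :
    paritySign h𝒱 v = i.negOnePow • v := by
  rcases Int.even_or_odd i with hi | hi
  · simp [paritySign, oddPart_of_even h𝒱 hv hi, Int.negOnePow_even _ hi]
  · rw [paritySign, LinearMap.sub_apply, LinearMap.id_apply, LinearMap.smul_apply,
      oddPart_of_odd h𝒱 hv hi, Int.negOnePow_odd _ hi, Units.neg_smul, one_smul, two_smul]
    abel

/-- A linear map of even degree `0` commutes with the projections onto the odd parts. -/
theorem map_oddPart {𝒲 : ℤ → Submodule K W} (h𝒲 : DirectSum.IsInternal 𝒲) (T : V →ₗ[K] W)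
    (hT : ∀ i, ∀ v ∈ 𝒱 i, T v ∈ 𝒲 i) (v : V) : T (oddPart h𝒱 v) = oddPart h𝒲 (T v) := by
  have : T ∘ₗ oddPart h𝒱 = oddPart h𝒲 ∘ₗ T := by
    refine linearMap_ext_of_homogeneous h𝒱 fun i v hv => ?_
    simp only [LinearMap.comp_apply, oddPart_of_mem h𝒱 hv, oddPart_of_mem h𝒲 (hT i v hv)]
    split_ifs <;> simp
  exact LinearMap.congr_fun this v

/-- The kernel of a homogeneous linear map is stable under the projection onto the odd part. -/
theorem map_oddPart_eq_zero {𝒲 : ℤ → Submodule K W} (h𝒲 : DirectSum.IsInternal 𝒲)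
    (T : V →ₗ[K] W) (e : ℤ) (hT : ∀ i, ∀ v ∈ 𝒱 i, T v ∈ 𝒲 (i + e)) {v : V} (hv : T v = 0) :
    T (oddPart h𝒱 v) = 0 := by
  rcases Int.even_or_odd e with he | he
  · have : T ∘ₗ oddPart h𝒱 = oddPart h𝒲 ∘ₗ T := by
      refine linearMap_ext_of_homogeneous h𝒱 fun i v hv => ?_
      simp only [LinearMap.comp_apply, oddPart_of_mem h𝒱 hv, oddPart_of_mem h𝒲 (hT i v hv),
        Int.odd_add, he, iff_true]
      split_ifs <;> simp
    have := LinearMap.congr_fun this v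
    simpa [hv] using this
  · have : T ∘ₗ oddPart h𝒱 = T - oddPart h𝒲 ∘ₗ T := by
      refine linearMap_ext_of_homogeneous h𝒱 fun i v hv => ?_
      simp only [LinearMap.comp_apply, LinearMap.sub_apply, oddPart_of_mem h𝒱 hv,
        oddPart_of_mem h𝒲 (hT i v hv), Int.odd_add, Int.not_even_iff_odd.2 he, iff_false,
        Int.not_odd_iff_even]
      rcases Int.even_or_odd i with hi | hi
      · simp [hi, Int.not_odd_iff_even.2 hi]
      · simp [hi, Int.not_even_iff_odd.2 hi]
    have := LinearMap.congr_fun this v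
    simpa [hv] using this

/-- The projection onto the odd part (`true`) or onto the even part (`false`). -/
noncomputable def parityPart (c : Bool) : V →ₗ[K] V :=
  if c then oddPart h𝒱 else LinearMap.id - oddPart h𝒱

theorem parityPart_of_mem {i : ℤ} {v : V} (hv : v ∈ 𝒱 i) (c : Bool) :
    parityPart h𝒱 c v = open Classical in if c = decide (Odd i) then v else 0 := by
  classical
  by_cases hi : Odd i
  · cases c <;> simp [parityPart, oddPart_of_mem h𝒱 hv, hi]
  · cases c <;> simp [parityPart, oddPart_of_mem h𝒱 hv, hi]

theorem map_parityPart_eq_zero {𝒲 : ℤ → Submodule K W} (h𝒲 : DirectSum.IsInternal 𝒲)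
    (T : V →ₗ[K] W) (e : ℤ) (hT : ∀ i, ∀ v ∈ 𝒱 i, T v ∈ 𝒲 (i + e)) {v : V} (hv : T v = 0)
    (c : Bool) : T (parityPart h𝒱 c v) = 0 := by
  have := map_oddPart_eq_zero h𝒱 h𝒲 T e hT hv
  cases c <;> simp [parityPart, this, hv]

/-! ### Graded symmetrization -/

/-- The graded symmetrization `v ↦ Σ_σ ε(σ; v) f(v_σ(1), …, v_σ(n))` of a multilinear map; the
outer sum splits the arguments into their even and odd parts. -/
noncomputable def gradedSymm {n : ℕ} (f : MultilinearMap K (fun _ : Fin n => V) W) :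
    MultilinearMap K (fun _ : Fin n => V) W :=
  ∑ p : Fin n → Bool, ∑ σ : Equiv.Perm (Fin n),
    (koszulSign (fun i => if p i then 1 else 0) σ) •
      (f.domDomCongr σ).compLinearMap (fun i => parityPart h𝒱 (p i))

theorem gradedSymm_apply {n : ℕ} (f : MultilinearMap K (fun _ : Fin n => V) W) (v : Fin n → V) :
    gradedSymm h𝒱 f v = ∑ p : Fin n → Bool, ∑ σ : Equiv.Perm (Fin n),
      (koszulSign (fun i => if p i then 1 else 0) σ) •
        f (fun i => parityPart h𝒱 (p (σ i)) (v (σ i))) := by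
  simp [gradedSymm]

theorem gradedSymm_of_mem {n : ℕ} (f : MultilinearMap K (fun _ : Fin n => V) W) {d : Fin n → ℤ}
    {v : Fin n → V} (hv : ∀ i, v i ∈ 𝒱 (d i)) :
    gradedSymm h𝒱 f v =
      ∑ σ : Equiv.Perm (Fin n), koszulSign d σ • f (fun i => v (σ i)) := by
  classical
  rw [gradedSymm_apply, Finset.sum_eq_single (fun i => decide (Odd (d i)))]
  · refine Finset.sum_congr rfl fun σ _ => ?_
    congr 1
    · refine koszulSign_congr (fun i j => ?_) σ
      rcases Int.even_or_odd (d i) with hi | hi <;> rcases Int.even_or_odd (d j) with hj | hj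
      · simp [Int.not_odd_iff_even.2 hi, Int.negOnePow_even _ (hi.mul_right (d j))]
      · simp [Int.not_odd_iff_even.2 hi, Int.negOnePow_even _ (hi.mul_right (d j))]
      · simp [Int.not_odd_iff_even.2 hj, Int.negOnePow_even _ (hj.mul_left (d i))]
      · simp [hi, hj, Int.negOnePow_odd _ (hi.mul hj)]
    · congr 1
      funext i
      simp [parityPart_of_mem h𝒱 (hv (σ i))]
  · intro p _ hp
    obtain ⟨i, hi⟩ := Function.ne_iff.1 hp
    refine Finset.sum_eq_zero fun σ _ => ?_
    rw [f.map_coord_zero (σ.symm i), smul_zero]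
    simp [parityPart_of_mem h𝒱 (hv i), hi]
  · simp

theorem gradedSymm_comp_perm {n : ℕ} (f : MultilinearMap K (fun _ : Fin n => V) W)
    {d : Fin n → ℤ} {v : Fin n → V} (hv : ∀ i, v i ∈ 𝒱 (d i)) (σ : Equiv.Perm (Fin n)) :
    gradedSymm h𝒱 f (fun i => v (σ i)) = koszulSign d σ • gradedSymm h𝒱 f v := by
  rw [gradedSymm_of_mem h𝒱 f hv, gradedSymm_of_mem h𝒱 f (fun i => hv (σ i)), Finset.smul_sum]
  refine Fintype.sum_equiv (Equiv.mulLeft σ) _ _ fun ρ => ?_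
  rw [Equiv.coe_mulLeft, koszulSign_mul, smul_smul, ← mul_assoc, Int.units_mul_self, one_mul]
  rfl

/-- The graded symmetrizations of maps of degree `e` form a graded symmetric family. -/
theorem isGradedSymmetric_gradedSymm {𝒲 : ℤ → Submodule K W} {e : ℤ}
    (f : ∀ n : ℕ, MultilinearMap K (fun _ : Fin n => V) W)
    (hf : ∀ (n : ℕ) (d : Fin n → ℤ) (v : Fin n → V), (∀ i, v i ∈ 𝒱 (d i)) →
      f n v ∈ 𝒲 ((∑ i, d i) + e)) :
    IsGradedSymmetric 𝒱 𝒲 e (fun n => gradedSymm h𝒱 (f n)) where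
  map_mem n d v hv := by
    rw [gradedSymm_of_mem h𝒱 _ hv]
    refine Submodule.sum_mem _ fun σ _ => ?_
    rw [Units.smul_def]
    refine zsmul_mem ?_ _
    have := hf n (fun i => d (σ i)) _ (fun i => hv (σ i))
    rwa [Equiv.sum_comp σ d] at this
  symm n d v hv σ := gradedSymm_comp_perm h𝒱 (f n) hv σ

theorem gradedSymm_one (f : MultilinearMap K (fun _ : Fin 1 => V) W) (v : V) :
    gradedSymm h𝒱 f (fun _ => v) = f (fun _ => v) := by
  set L : V →ₗ[K] W := (MultilinearMap.ofSubsingleton K V W (0 : Fin 1)).symm f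
  have hL : ∀ x, f (fun _ => x) = L x := fun x => rfl
  rw [gradedSymm_apply, Fintype.sum_equiv (Equiv.funUnique (Fin 1) Bool) _
    (fun c => L (parityPart h𝒱 c v))]
  · simp [hL, parityPart]
  · intro p
    rw [Fintype.sum_unique, Equiv.Perm.default_eq, koszulSign_one, one_smul, ← hL]
    congr 1
    funext i
    simp [Subsingleton.elim i 0]

end Parity

/-! ### Signs of ordered set partitions -/

section Families

variable {ι : Type*}

/-- The degree `∑_{i ∈ S} dᵢ` of the index set `S`. -/
def degOn (d : ι → ℤ) (S : Finset ι) : ℤ := ∑ i ∈ S, d i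

@[simp]
theorem degOn_singleton (d : ι → ℤ) (i : ι) : degOn d {i} = d i := by simp [degOn]

variable [LinearOrder ι]

/-- The Koszul sign of moving the indices in `S` in front of those in `T`, i.e. the sign in
`t_S t_T = ± t_{S ∪ T}` for graded commuting variables `tᵢ` of degree `dᵢ`. -/
def koszulPair (d : ι → ℤ) (S T : Finset ι) : ℤˣ :=
  ∏ p ∈ (S ×ˢ T).filter (fun p => p.2 < p.1), (d p.1 * d p.2).negOnePow

theorem degOn_union (d : ι → ℤ) {S T : Finset ι} (h : Disjoint S T) :
    degOn d (S ∪ T) = degOn d S + degOn d T := Finset.sum_union h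

theorem koszulPair_union_left (d : ι → ℤ) {S S' : Finset ι} (T : Finset ι) (h : Disjoint S S') :
    koszulPair d (S ∪ S') T = koszulPair d S T * koszulPair d S' T := by
  rw [koszulPair, Finset.union_product, Finset.filter_union, Finset.prod_union]
  · rfl
  · exact Finset.disjoint_filter_filter (Finset.disjoint_product.2 (Or.inl h))

theorem koszulPair_union_right (d : ι → ℤ) (S : Finset ι) {T T' : Finset ι} (h : Disjoint T T') :
    koszulPair d S (T ∪ T') = koszulPair d S T * koszulPair d S T' := by
  rw [koszulPair, Finset.product_union, Finset.filter_union, Finset.prod_union]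
  · rfl
  · exact Finset.disjoint_filter_filter (Finset.disjoint_product.2 (Or.inr h))

@[simp]
theorem koszulPair_empty_left (d : ι → ℤ) (T : Finset ι) : koszulPair d ∅ T = 1 := by
  simp [koszulPair]

@[simp]
theorem koszulPair_empty_right (d : ι → ℤ) (S : Finset ι) : koszulPair d S ∅ = 1 := by
  simp [koszulPair]

theorem koszulPair_singleton (d : ι → ℤ) (a b : ι) :
    koszulPair d {a} {b} = if b < a then (d a * d b).negOnePow else 1 := by
  rw [koszulPair, Finset.singleton_product_singleton, Finset.filter_singleton]
  split_ifs <;> simp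

theorem negOnePow_sum {α : Type*} (s : Finset α) (f : α → ℤ) :
    (∑ i ∈ s, f i).negOnePow = ∏ i ∈ s, (f i).negOnePow := by
  classical
  induction s using Finset.induction_on with
  | empty => simp
  | insert a s ha ih => rw [Finset.sum_insert ha, Finset.prod_insert ha, Int.negOnePow_add, ih]

/-- Graded commutativity of the variables `t_S`, `t_T`. -/
theorem koszulPair_comm (d : ι → ℤ) {S T : Finset ι} (h : Disjoint S T) :
    koszulPair d S T = (degOn d S * degOn d T).negOnePow * koszulPair d T S := by
  have h1 : koszulPair d T S =
      ∏ p ∈ (S ×ˢ T).filter (fun p => ¬ p.2 < p.1), (d p.1 * d p.2).negOnePow := by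
    refine Finset.prod_bij (fun p _ => (p.2, p.1)) ?_ ?_ ?_ ?_
    · rintro ⟨a, b⟩ hp
      simp only [Finset.mem_filter, Finset.mem_product] at hp ⊢
      exact ⟨⟨hp.1.2, hp.1.1⟩, not_lt_of_gt hp.2⟩
    · rintro ⟨a, b⟩ _ ⟨a', b'⟩ _ h
      simpa [and_comm] using h
    · rintro ⟨a, b⟩ hp
      simp only [Finset.mem_filter, Finset.mem_product, not_lt] at hp
      refine ⟨(b, a), ?_, rfl⟩
      simp only [Finset.mem_filter, Finset.mem_product]
      refine ⟨⟨hp.1.2, hp.1.1⟩, lt_of_le_of_ne hp.2 ?_⟩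
      rintro rfl
      exact Finset.disjoint_left.1 h hp.1.1 hp.1.2
    · rintro ⟨a, b⟩ _
      simp [mul_comm]
  have h2 : (degOn d S * degOn d T).negOnePow = koszulPair d S T * koszulPair d T S := by
    rw [h1, koszulPair, Finset.prod_filter_mul_prod_filter_not, degOn, degOn,
      Finset.sum_mul_sum, ← Finset.sum_product', negOnePow_sum]
  rw [h2, mul_assoc, Int.units_mul_self, mul_one]

theorem biUnion_fin_succ {k : ℕ} (P : Fin (k + 1) → Finset ι) :
    Finset.univ.biUnion P =
      Finset.univ.biUnion (fun i : Fin k => P i.castSucc) ∪ P (Fin.last k) := by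
  ext a
  simp [Fin.exists_fin_succ', or_comm]

theorem biUnion_fin_succ' {k : ℕ} (P : Fin (k + 1) → Finset ι) :
    Finset.univ.biUnion P = P 0 ∪ Finset.univ.biUnion (fun i : Fin k => P i.succ) := by
  ext a
  simp [Fin.exists_fin_succ]

variable [Fintype ι]

/-- The ordered decompositions of `U` into `k` disjoint, possibly empty, blocks. -/
def decomps (k : ℕ) (U : Finset ι) : Finset (Fin k → Finset ι) :=
  Finset.univ.filter (fun P => (∀ i j, i ≠ j → Disjoint (P i) (P j)) ∧ Finset.univ.biUnion P = U)

/-- The sign of a decomposition into blocks which are decorated with additional degrees `e`. -/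
def blockSign (d : ι → ℤ) {k : ℕ} (e : Fin k → ℤ) (P : Fin k → Finset ι) : ℤˣ :=
  ∏ p ∈ Finset.univ.filter (fun p : Fin k × Fin k => p.1 < p.2),
    koszulPair d (P p.1) (P p.2) * (e p.2 * degOn d (P p.1)).negOnePow

theorem mem_decomps {k : ℕ} {U : Finset ι} {P : Fin k → Finset ι} :
    P ∈ decomps k U ↔
      (∀ i j, i ≠ j → Disjoint (P i) (P j)) ∧ Finset.univ.biUnion P = U := by
  simp [decomps]

theorem comp_perm_mem_decomps {k : ℕ} {U : Finset ι} {P : Fin k → Finset ι}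
    (h : P ∈ decomps k U) (ρ : Equiv.Perm (Fin k)) : (fun i => P (ρ i)) ∈ decomps k U := by
  rw [mem_decomps] at h ⊢
  refine ⟨fun i j hij => h.1 _ _ (fun e => hij (ρ.injective e)), ?_⟩
  rw [← h.2]
  ext a
  simp only [Finset.mem_biUnion, Finset.mem_univ, true_and]
  exact ⟨fun ⟨i, hi⟩ => ⟨ρ i, hi⟩, fun ⟨i, hi⟩ => ⟨ρ.symm i, by simpa using hi⟩⟩

theorem blockSign_comp_perm (d : ι → ℤ) {k : ℕ} (e : Fin k → ℤ) {U : Finset ι}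
    {P : Fin k → Finset ι} (h : P ∈ decomps k U) (ρ : Equiv.Perm (Fin k)) :
    blockSign d (fun i => e (ρ i)) (fun i => P (ρ i)) * koszulSign e ρ =
      koszulSign (fun i => degOn d (P i) + e i) ρ * blockSign d e P := by
  have key := prod_increasing_pairs_perm
    (fun a b => koszulPair d (P a) (P b) * (e b * degOn d (P a)).negOnePow)
    (fun a b => ((degOn d (P a) + e a) * (degOn d (P b) + e b)).negOnePow *
      (e a * e b).negOnePow) ?_ ρ
  · rw [blockSign]
    refine (congrArg (· * koszulSign e ρ) key).trans ?_
    rw [Finset.prod_mul_distrib (f := fun p : Fin k × Fin k =>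
        ((degOn d (P (ρ p.1)) + e (ρ p.1)) * (degOn d (P (ρ p.2)) + e (ρ p.2))).negOnePow), blockSign, koszulSign, koszulSign, mul_right_comm]
    rw [mul_assoc (∏ p ∈ _, _) (∏ p ∈ _, _) (∏ p ∈ _, _), Int.units_mul_self, mul_one]
  · intro a b hab
    rw [koszulPair_comm d ((mem_decomps.1 h).1 a b hab)]
    have : ((degOn d (P a) + e a) * (degOn d (P b) + e b)).negOnePow =
        (degOn d (P a) * degOn d (P b)).negOnePow * (e b * degOn d (P a)).negOnePow *
        ((e a * degOn d (P b)).negOnePow * (e a * e b).negOnePow) := by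
      simp only [← Int.negOnePow_add]
      congr 1
      ring
    rw [this]
    have h1 := Int.units_mul_self (e a * e b).negOnePow
    have h2 := Int.units_mul_self (e a * degOn d (P b)).negOnePow
    calc _ = (degOn d (P a) * degOn d (P b)).negOnePow * (e b * degOn d (P a)).negOnePow *
          koszulPair d (P b) (P a) *
            ((e a * e b).negOnePow * (e a * e b).negOnePow) *
            ((e a * degOn d (P b)).negOnePow * (e a * degOn d (P b)).negOnePow) := by
          rw [h1, h2]; simp only [mul_one]; ac_rfl
      _ = _ := by ac_rfl

theorem degOn_biUnion (d : ι → ℤ) {k : ℕ} {U : Finset ι} {P : Fin k → Finset ι}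
    (h : P ∈ decomps k U) : degOn d U = ∑ i, degOn d (P i) := by
  rw [← (mem_decomps.1 h).2, degOn, Finset.sum_biUnion]
  · rfl
  · intro i _ j _ hij
    exact (mem_decomps.1 h).1 i j hij

theorem koszulPair_biUnion_left (d : ι → ℤ) {k : ℕ} {U : Finset ι} {P : Fin k → Finset ι}
    (h : P ∈ decomps k U) (T : Finset ι) :
    koszulPair d U T = ∏ i, koszulPair d (P i) T := by
  rw [← (mem_decomps.1 h).2]
  have : ∀ s : Finset (Fin k), koszulPair d (s.biUnion P) T = ∏ i ∈ s, koszulPair d (P i) T := by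
    intro s
    induction s using Finset.induction_on with
    | empty => simp
    | insert a s ha ih =>
      rw [Finset.biUnion_insert, koszulPair_union_left, ih, Finset.prod_insert ha]
      rw [Finset.disjoint_biUnion_right]
      intro j hj
      exact (mem_decomps.1 h).1 a j (fun e => ha (e ▸ hj))
  exact this _

theorem koszulPair_biUnion_right (d : ι → ℤ) {k : ℕ} {U : Finset ι} {P : Fin k → Finset ι}
    (h : P ∈ decomps k U) (T : Finset ι) :
    koszulPair d T U = ∏ i, koszulPair d T (P i) := by
  rw [← (mem_decomps.1 h).2]
  have : ∀ s : Finset (Fin k), koszulPair d T (s.biUnion P) = ∏ i ∈ s, koszulPair d T (P i) := by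
    intro s
    induction s using Finset.induction_on with
    | empty => simp
    | insert a s ha ih =>
      rw [Finset.biUnion_insert, koszulPair_union_right, ih, Finset.prod_insert ha]
      rw [Finset.disjoint_biUnion_right]
      intro j hj
      exact (mem_decomps.1 h).1 a j (fun e => ha (e ▸ hj))
  exact this _

theorem prod_increasing_pairs_castSucc {α : Type*} [CommMonoid α] {k : ℕ}
    (s : Fin (k + 1) → Fin (k + 1) → α) :
    ∏ p ∈ Finset.univ.filter (fun p : Fin (k + 1) × Fin (k + 1) => p.1 < p.2), s p.1 p.2 =
      (∏ p ∈ Finset.univ.filter (fun p : Fin k × Fin k => p.1 < p.2),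
        s p.1.castSucc p.2.castSucc) * ∏ i : Fin k, s i.castSucc (Fin.last k) := by
  simp only [Finset.prod_filter, Fintype.prod_prod_type, Fin.prod_univ_castSucc,
    Fin.castSucc_lt_castSucc_iff, Fin.castSucc_lt_last, if_true, lt_irrefl, if_false, mul_one,
    Finset.prod_mul_distrib]
  simp [not_lt_of_gt (Fin.castSucc_lt_last _)]

theorem prod_increasing_pairs_succ {α : Type*} [CommMonoid α] {k : ℕ}
    (s : Fin (k + 1) → Fin (k + 1) → α) :
    ∏ p ∈ Finset.univ.filter (fun p : Fin (k + 1) × Fin (k + 1) => p.1 < p.2), s p.1 p.2 =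
      (∏ i : Fin k, s 0 i.succ) * ∏ p ∈ Finset.univ.filter (fun p : Fin k × Fin k => p.1 < p.2),
        s p.1.succ p.2.succ := by
  simp only [Finset.prod_filter, Fintype.prod_prod_type, Fin.prod_univ_succ,
    Fin.succ_lt_succ_iff, Fin.succ_pos, if_true, if_false, one_mul, Fin.not_lt_zero]

/-- Splitting off the last block of a decomposition. -/
theorem sum_decomps_snoc {α : Type*} [AddCommMonoid α] {k : ℕ} (U : Finset ι)
    (F : (Fin (k + 1) → Finset ι) → α) :
    ∑ P ∈ decomps (k + 1) U, F P =
      ∑ T ∈ U.powerset, ∑ P ∈ decomps k (U \ T),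
        F (Fin.snoc (α := fun _ => Finset ι) P T) := by
  rw [Finset.sum_sigma']
  symm
  refine Finset.sum_bij' (fun x _ => Fin.snoc (α := fun _ => Finset ι) x.2 x.1)
    (fun P _ => ⟨P (Fin.last k), Fin.init P⟩) ?_ ?_ ?_ ?_ ?_
  · rintro ⟨T, P⟩ h
    simp only [Finset.mem_sigma, Finset.mem_powerset, mem_decomps] at h ⊢
    obtain ⟨h1, h2, h3⟩ := h
    have h4 : ∀ i, Disjoint (P i) T := fun i => by
      refine Finset.disjoint_of_subset_left ?_ (Finset.sdiff_disjoint : Disjoint (U \ T) T)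
      rw [← h3]
      exact Finset.subset_biUnion_of_mem P (Finset.mem_univ i)
    refine ⟨fun i j => ?_, ?_⟩
    · refine Fin.lastCases ?_ (fun i => ?_) i <;> refine Fin.lastCases ?_ (fun j => ?_) j
      · simp
      · intro _; simpa using (h4 j).symm
      · intro _; simpa using h4 i
      · intro hij; simpa using h2 i j (fun e => hij (by rw [e]))
    · rw [biUnion_fin_succ]
      simp [h3, Finset.sdiff_union_of_subset h1]
  · intro P h
    simp only [Finset.mem_sigma, Finset.mem_powerset, mem_decomps] at h ⊢
    obtain ⟨h1, h2⟩ := h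
    refine ⟨?_, fun i j hij => h1 _ _ (fun e => hij (Fin.castSucc_injective k e)), ?_⟩
    · rw [← h2]; exact Finset.subset_biUnion_of_mem P (Finset.mem_univ _)
    · rw [← h2, biUnion_fin_succ, Finset.union_sdiff_cancel_right]
      · rfl
      · rw [Finset.disjoint_biUnion_left]
        intro i _
        exact h1 _ _ (Fin.castSucc_lt_last i).ne
  · rintro ⟨T, P⟩ _
    simp
  · intro P _
    simp
  · rintro ⟨T, P⟩ _
    rfl

/-- Splitting off the first block of a decomposition. -/
theorem sum_decomps_cons {α : Type*} [AddCommMonoid α] {k : ℕ} (U : Finset ι)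
    (F : (Fin (k + 1) → Finset ι) → α) :
    ∑ P ∈ decomps (k + 1) U, F P =
      ∑ S ∈ U.powerset, ∑ P ∈ decomps k (U \ S),
        F (Fin.cons (α := fun _ => Finset ι) S P) := by
  rw [Finset.sum_sigma']
  symm
  refine Finset.sum_bij' (fun x _ => Fin.cons (α := fun _ => Finset ι) x.1 x.2)
    (fun P _ => ⟨P 0, Fin.tail P⟩) ?_ ?_ ?_ ?_ ?_
  · rintro ⟨T, P⟩ h
    simp only [Finset.mem_sigma, Finset.mem_powerset, mem_decomps] at h ⊢
    obtain ⟨h1, h2, h3⟩ := h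
    have h4 : ∀ i, Disjoint (P i) T := fun i => by
      refine Finset.disjoint_of_subset_left ?_ (Finset.sdiff_disjoint : Disjoint (U \ T) T)
      rw [← h3]
      exact Finset.subset_biUnion_of_mem P (Finset.mem_univ i)
    refine ⟨fun i j => ?_, ?_⟩
    · refine Fin.cases ?_ (fun i => ?_) i <;> refine Fin.cases ?_ (fun j => ?_) j
      · simp
      · intro _; simpa using (h4 j).symm
      · intro _; simpa using h4 i
      · intro hij; simpa using h2 i j (fun e => hij (by rw [e]))
    · rw [biUnion_fin_succ']
      simp [h3, Finset.union_sdiff_of_subset h1]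
  · intro P h
    simp only [Finset.mem_sigma, Finset.mem_powerset, mem_decomps] at h ⊢
    obtain ⟨h1, h2⟩ := h
    refine ⟨?_, fun i j hij => h1 _ _ (fun e => hij (Fin.succ_injective k e)), ?_⟩
    · rw [← h2]; exact Finset.subset_biUnion_of_mem P (Finset.mem_univ _)
    · rw [← h2, biUnion_fin_succ', Finset.union_sdiff_cancel_left]
      · rfl
      · rw [Finset.disjoint_biUnion_right]
        intro i _
        exact h1 _ _ (Fin.succ_ne_zero i).symm
  · rintro ⟨T, P⟩ _
    simp
  · intro P _
    simp
  · rintro ⟨T, P⟩ _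
    rfl

theorem blockSign_snoc (d : ι → ℤ) {k : ℕ} (e : Fin (k + 1) → ℤ) {U T : Finset ι}
    {P : Fin k → Finset ι} (h : P ∈ decomps k U) :
    blockSign d e (Fin.snoc (α := fun _ => Finset ι) P T) =
      (koszulPair d U T * (e (Fin.last k) * degOn d U).negOnePow) *
        blockSign d (fun i => e i.castSucc) P := by
  rw [blockSign, prod_increasing_pairs_castSucc (fun a b =>
    koszulPair d (Fin.snoc (α := fun _ => Finset ι) P T a) (Fin.snoc (α := fun _ => Finset ι) P T b)
      * (e b * degOn d (Fin.snoc (α := fun _ => Finset ι) P T a)).negOnePow), blockSign, mul_comm]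
  simp only [Fin.snoc_castSucc, Fin.snoc_last, Finset.prod_mul_distrib]
  rw [koszulPair_biUnion_left d h, degOn_biUnion d h, Finset.mul_sum, negOnePow_sum]

theorem blockSign_cons (d : ι → ℤ) {k : ℕ} (e : Fin (k + 1) → ℤ) (he : ∀ i : Fin k, e i.succ = 0)
    {U T : Finset ι} {P : Fin k → Finset ι} (h : P ∈ decomps k U) :
    blockSign d e (Fin.cons (α := fun _ => Finset ι) T P) =
      koszulPair d T U * blockSign d (fun _ => 0) P := by
  rw [blockSign, prod_increasing_pairs_succ (fun a b =>
    koszulPair d (Fin.cons (α := fun _ => Finset ι) T P a) (Fin.cons (α := fun _ => Finset ι) T P b)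
      * (e b * degOn d (Fin.cons (α := fun _ => Finset ι) T P a)).negOnePow), blockSign]
  simp [he, koszulPair_biUnion_right d h]

end Families

/-! ### Multilinear maps on families indexed by finite sets -/

section Conv

variable {K V W E F G : Type*} [Field K] [AddCommGroup V] [Module K V] [AddCommGroup W]
  [Module K W] [AddCommGroup E] [Module K E] [AddCommGroup F] [Module K F]
  [AddCommGroup G] [Module K G]
variable {ι : Type*} [LinearOrder ι]

/-- `X : Finset ι → V` stands for the element `∑_S t_S X(S)` of `Λ ⊗ V`, where `Λ` is spanned by
the monomials `t_S` in graded commuting variables `tᵢ` of degree `-dᵢ` with `tᵢ² = 0`.  This says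
that the element is homogeneous of degree `e`. -/
def IsFamily (d : ι → ℤ) (𝒱 : ℤ → Submodule K V) (e : ℤ) (X : Finset ι → V) : Prop :=
  ∀ S, X S ∈ 𝒱 (degOn d S + e)

/-- The extension of a bilinear map from graded spaces to families, where `e` is the degree of the
second family (the sign comes from moving variables past a family of degree `e`). -/
def convBilin (d : ι → ℤ) (e : ℤ) (B : E →ₗ[K] F →ₗ[K] G) :
    (Finset ι → E) →ₗ[K] (Finset ι → F) →ₗ[K] (Finset ι → G) :=
  LinearMap.mk₂ K
    (fun X Y U => ∑ T ∈ U.powerset,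
      (koszulPair d (U \ T) T * (e * degOn d (U \ T)).negOnePow) • B (X (U \ T)) (Y T))
    (fun X X' Y => by
      funext U; simp [Finset.sum_add_distrib])
    (fun c X Y => by
      funext U; simp only [Pi.smul_apply, map_smul, LinearMap.smul_apply, Finset.smul_sum]
      exact Finset.sum_congr rfl fun T _ => smul_comm _ _ _)
    (fun X Y Y' => by
      funext U; simp [Finset.sum_add_distrib])
    (fun c X Y => by
      funext U; simp only [Pi.smul_apply, map_smul, Finset.smul_sum]
      exact Finset.sum_congr rfl fun T _ => smul_comm _ _ _)

theorem convBilin_apply (d : ι → ℤ) (e : ℤ) (B : E →ₗ[K] F →ₗ[K] G) (X : Finset ι → E)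
    (Y : Finset ι → F) (U : Finset ι) :
    convBilin d e B X Y U = ∑ T ∈ U.powerset,
      (koszulPair d (U \ T) T * (e * degOn d (U \ T)).negOnePow) • B (X (U \ T)) (Y T) := rfl

/-- The family which is `v i` at the singleton `{i}` and zero otherwise, i.e. `∑ᵢ tᵢ vᵢ`. -/
def singles [Fintype ι] (v : ι → V) (S : Finset ι) : V := ∑ i, if S = {i} then v i else 0

variable [Fintype ι]

@[simp]
theorem singles_singleton (v : ι → V) (i : ι) : singles v {i} = v i := by
  simp [singles]

theorem singles_of_card_ne_one (v : ι → V) {S : Finset ι} (h : S.card ≠ 1) : singles v S = 0 := by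
  refine Finset.sum_eq_zero fun i _ => if_neg ?_
  rintro rfl
  exact h (Finset.card_singleton i)

theorem isFamily_singles {d : ι → ℤ} {𝒱 : ℤ → Submodule K V} {v : ι → V}
    (hv : ∀ i, v i ∈ 𝒱 (d i)) : IsFamily d 𝒱 0 (singles v) := by
  intro S
  refine Submodule.sum_mem _ fun i _ => ?_
  split_ifs with h
  · subst h; simpa using hv i
  · exact zero_mem _

/-- The value at `U` of the extension of the multilinear map `f` to families `Xᵢ` of degrees
`eᵢ`. -/
def conv (d : ι → ℤ) {k : ℕ} (e : Fin k → ℤ) (f : (Fin k → V) → W) (X : Fin k → Finset ι → V)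
    (U : Finset ι) : W :=
  ∑ P ∈ decomps k U, blockSign d e P • f (fun i => X i (P i))

theorem map_conv (d : ι → ℤ) {k : ℕ} (e : Fin k → ℤ) (f : (Fin k → V) → W) (T : W →ₗ[K] E)
    (X : Fin k → Finset ι → V) (U : Finset ι) :
    T (conv d e f X U) = conv d e (fun v => T (f v)) X U := by
  simp [conv, map_sum, Units.smul_def]

/-- The extension of a graded symmetrization is a graded symmetrization. -/
theorem conv_gradedSymm {𝒱 : ℤ → Submodule K V} (h𝒱 : DirectSum.IsInternal 𝒱) (d : ι → ℤ)
    {k : ℕ} (e : Fin k → ℤ) (f : MultilinearMap K (fun _ : Fin k => V) W)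
    {X : Fin k → Finset ι → V} (hX : ∀ i, IsFamily d 𝒱 (e i) (X i)) (U : Finset ι) :
    conv d e (gradedSymm h𝒱 f) X U = ∑ ρ : Equiv.Perm (Fin k),
      koszulSign e ρ • conv d (fun i => e (ρ i)) f (fun i => X (ρ i)) U := by
  simp only [conv, Finset.smul_sum]
  rw [Finset.sum_congr rfl fun P _ => by
    rw [gradedSymm_of_mem h𝒱 f (fun i => hX i (P i)), Finset.smul_sum], Finset.sum_comm]
  refine Finset.sum_congr rfl fun ρ _ => ?_
  refine Finset.sum_bij (fun P _ => fun i => P (ρ i)) (fun P hP => comp_perm_mem_decomps hP ρ)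
    ?_ ?_ ?_
  · intro P _ P' _ h
    funext i
    simpa using congrFun h (ρ.symm i)
  · intro P hP
    exact ⟨fun i => P (ρ.symm i), comp_perm_mem_decomps hP ρ.symm, by simp⟩
  · intro P hP
    rw [smul_smul, smul_smul, mul_comm (koszulSign e ρ), blockSign_comp_perm d e hP ρ, mul_comm]

/-- Splitting off the last argument. -/
theorem conv_snoc (d : ι → ℤ) {k : ℕ} (e : Fin (k + 1) → ℤ) (B : E →ₗ[K] V →ₗ[K] G)
    (f : (Fin k → V) → E) (X : Fin (k + 1) → Finset ι → V) (U : Finset ι) :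
    conv d e (fun v => B (f (Fin.init v)) (v (Fin.last k))) X U =
      convBilin d (e (Fin.last k)) B (conv d (fun i => e i.castSucc) f (fun i => X i.castSucc))
        (X (Fin.last k)) U := by
  rw [conv, sum_decomps_snoc, convBilin_apply]
  refine Finset.sum_congr rfl fun T _ => ?_
  simp only [conv, map_sum, LinearMap.sum_apply, Finset.smul_sum]
  refine Finset.sum_congr rfl fun P hP => ?_
  rw [blockSign_snoc d e hP, mul_smul _ (blockSign d _ P)]
  simp only [Units.smul_def, map_zsmul, LinearMap.smul_apply, Fin.snoc_last]
  simp [Fin.init_def]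

/-- Splitting off the first argument, when the others have degree zero. -/
theorem conv_cons (d : ι → ℤ) {k : ℕ} (e : Fin (k + 1) → ℤ) (he : ∀ i : Fin k, e i.succ = 0)
    (f : (Fin (k + 1) → V) → W) (X : Fin (k + 1) → Finset ι → V) (U : Finset ι) :
    conv d e f X U = ∑ S ∈ U.powerset, koszulPair d S (U \ S) •
      conv d (fun _ => 0) (fun v => f (Fin.cons (α := fun _ => V) (X 0 S) v))
        (fun i => X i.succ) (U \ S) := by
  rw [conv, sum_decomps_cons]
  refine Finset.sum_congr rfl fun S _ => ?_
  simp only [conv, Finset.smul_sum]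
  refine Finset.sum_congr rfl fun P hP => ?_
  rw [blockSign_cons d e he hP, mul_smul]
  congr 3
  funext i
  refine Fin.cases ?_ (fun i => ?_) i <;> simp

/-- The extension of a multilinear map to `∑ᵢ tᵢ vᵢ` is a sum over permutations. -/
theorem conv_singles (d : ι → ℤ) (T : Finset ι) (f : (Fin T.card → V) → W)
    (hf : ∀ u, ∀ i, u i = 0 → f u = 0) (v : ι → V) :
    conv d (fun _ => 0) f (fun _ => singles v) T = ∑ σ : Equiv.Perm (Fin T.card),
      koszulSign (fun i => d (T.orderEmbOfFin rfl i)) σ •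
        f (fun i => v (T.orderEmbOfFin rfl (σ i))) := by
  symm
  refine Finset.sum_of_injOn (fun σ i => {T.orderEmbOfFin rfl (σ i)}) ?_ ?_ ?_ ?_
  · intro σ _ τ _ h
    ext i
    have := congrFun h i
    simp only [Finset.singleton_inj] at this
    rw [(T.orderEmbOfFin rfl).injective this]
  · intro σ _
    refine mem_decomps.2 ⟨fun i j hij => ?_, ?_⟩
    · rw [Finset.disjoint_singleton]
      exact fun h => hij (σ.injective ((T.orderEmbOfFin rfl).injective h))
    · ext a
      simp only [Finset.mem_biUnion, Finset.mem_univ, true_and, Finset.mem_singleton]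
      constructor
      · rintro ⟨i, rfl⟩
        exact Finset.orderEmbOfFin_mem _ _ _
      · intro ha
        have : a ∈ Set.range (T.orderEmbOfFin rfl) := by
          rw [Finset.range_orderEmbOfFin]; exact ha
        obtain ⟨i, rfl⟩ := this
        exact ⟨σ.symm i, by simp⟩
  · intro P hP hP'
    by_cases hs : ∀ i, (P i).card = 1
    · exfalso
      refine hP' ?_
      choose a ha using fun i => Finset.card_eq_one.1 (hs i)
      have ha' : ∀ i, a i ∈ T := fun i => by
        rw [← (mem_decomps.1 hP).2]
        exact Finset.mem_biUnion.2 ⟨i, Finset.mem_univ _, by simp [ha i]⟩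
      choose s hs using fun i => (by
        have : a i ∈ Set.range (T.orderEmbOfFin rfl) := by
          rw [Finset.range_orderEmbOfFin]; exact ha' i
        exact this : ∃ j, T.orderEmbOfFin rfl j = a i)
      have hinj : Function.Injective s := by
        intro i j hij
        by_contra hne
        have := (mem_decomps.1 hP).1 i j hne
        rw [ha i, ha j, Finset.disjoint_singleton, ← hs i, ← hs j, hij] at this
        exact this rfl
      refine ⟨Equiv.ofBijective s (Finite.injective_iff_bijective.1 hinj), by simp, ?_⟩
      funext i
      simp [hs, ha]
    · push Not at hs
      obtain ⟨i, hi⟩ := hs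
      rw [hf _ i (singles_of_card_ne_one v hi), smul_zero]
  · intro σ _
    congr 1
    · rw [koszulSign_eq_prod_pairs, blockSign]
      refine Finset.prod_congr rfl fun p _ => ?_
      simp [koszulPair_singleton]
    · simp

theorem conv_singles_of_card_ne (d : ι → ℤ) {k : ℕ} {T : Finset ι} (hk : k ≠ T.card)
    (f : (Fin k → V) → W) (hf : ∀ u, ∀ i, u i = 0 → f u = 0) (v : ι → V) :
    conv d (fun _ => 0) f (fun _ => singles v) T = 0 := by
  refine Finset.sum_eq_zero fun P hP => ?_
  by_cases hs : ∀ i, (P i).card = 1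
  · exfalso
    apply hk
    rw [← (mem_decomps.1 hP).2, Finset.card_biUnion]
    · simp [hs]
    · intro i _ j _ hij
      exact (mem_decomps.1 hP).1 i j hij
  · push Not at hs
    obtain ⟨i, hi⟩ := hs
    rw [hf _ i (singles_of_card_ne_one v hi), smul_zero]

/-- The family `S ↦ q_{|S|}(v_s : s ∈ S)`, the elements of `S` being listed in increasing order. -/
def onBlock (q : ∀ n : ℕ, MultilinearMap K (fun _ : Fin n => V) W) (v : ι → V) (S : Finset ι) : W :=
  q S.card (fun i => v (S.orderEmbOfFin rfl i))

/-- For graded symmetrizations, `onBlock` is the extension evaluated at `∑ᵢ tᵢ vᵢ`. -/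
theorem onBlock_gradedSymm {𝒱 : ℤ → Submodule K V} (h𝒱 : DirectSum.IsInternal 𝒱)
    (f : ∀ n : ℕ, MultilinearMap K (fun _ : Fin n => V) W) {d : ι → ℤ} {v : ι → V}
    (hv : ∀ i, v i ∈ 𝒱 (d i)) (S : Finset ι) {N : ℕ} (hN : S.card < N) :
    onBlock (fun n => gradedSymm h𝒱 (f n)) v S =
      ∑ k ∈ Finset.range N, conv d (fun _ => 0) (f k) (fun _ => singles v) S := by
  rw [Finset.sum_eq_single_of_mem S.card (Finset.mem_range.2 hN)]
  · rw [conv_singles d S (f S.card) (fun u i h => (f _).map_coord_zero i h), onBlock,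
      gradedSymm_of_mem h𝒱 _ (fun i => hv _)]
  · intro k _ hk
    exact conv_singles_of_card_ne d hk _ (fun u i h => (f _).map_coord_zero i h) v

/-! ### Composition of coderivations -/

/-- The extension of `f` with one argument `X` replaced by the family `Y` of degree one, summed
over the position of that argument. -/
def convDeriv (d : ι → ℤ) {k : ℕ} (f : (Fin k → V) → W) (X Y : Finset ι → V) (U : Finset ι) : W :=
  ∑ i : Fin k, conv d (Pi.single i 1) f (Function.update (fun _ => X) i Y) U

theorem map_convDeriv (d : ι → ℤ) {k : ℕ} (f : (Fin k → V) → W) (T : W →ₗ[K] E)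
    (X Y : Finset ι → V) (U : Finset ι) :
    T (convDeriv d f X Y U) = convDeriv d (fun v => T (f v)) X Y U := by
  simp [convDeriv, map_sum, map_conv]

theorem convDeriv_snoc (d : ι → ℤ) {k : ℕ} (B : E →ₗ[K] V →ₗ[K] G) (f : (Fin k → V) → E)
    (X Y : Finset ι → V) (U : Finset ι) :
    convDeriv d (fun v : Fin (k + 1) → V => B (f (Fin.init v)) (v (Fin.last k))) X Y U =
      convBilin d 0 B (convDeriv d f X Y) X U +
        convBilin d 1 B (conv d (fun _ => 0) f (fun _ => X)) Y U := by
  rw [convDeriv, Fin.sum_univ_castSucc]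
  congr 1
  · have : convDeriv d f X Y =
        ∑ i : Fin k, conv d (Pi.single i 1) f (Function.update (fun _ => X) i Y) := by
      funext U; simp [convDeriv]
    rw [this, map_sum, LinearMap.sum_apply, Finset.sum_apply]
    refine Finset.sum_congr rfl fun i _ => ?_
    have h1 : (fun j : Fin k => (Pi.single i.castSucc 1 : Fin (k + 1) → ℤ) j.castSucc) =
        Pi.single i 1 := by
      funext j; simp [Pi.single_apply]
    have h2 : (fun j : Fin k => Function.update (fun _ => X) i.castSucc Y j.castSucc) =
        Function.update (fun _ => X) i Y := by
      funext j
      simp [Function.update_apply]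
    rw [conv_snoc, h1, h2, Function.update_of_ne (Fin.castSucc_lt_last i).ne',
      Pi.single_eq_of_ne (Fin.castSucc_lt_last i).ne']
  · have h1 : (fun j : Fin k => (Pi.single (Fin.last k) 1 : Fin (k + 1) → ℤ) j.castSucc) =
        fun _ => 0 := by
      funext j; simp [(Fin.castSucc_lt_last j).ne]
    have h2 : (fun j : Fin k => Function.update (fun _ => X) (Fin.last k) Y j.castSucc) =
        fun _ => X := by
      funext j
      simp [(Fin.castSucc_lt_last j).ne]
    rw [conv_snoc, h1, h2, Function.update_self, Pi.single_eq_same]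

/-- Graded symmetrization turns the sum over all positions of `Y` into `Y` at the first position,
and the factor `k!` counts the orderings of the remaining arguments. -/
theorem conv_cons_gradedSymm {𝒱 : ℤ → Submodule K V} (h𝒱 : DirectSum.IsInternal 𝒱) (d : ι → ℤ)
    {k : ℕ} (f : MultilinearMap K (fun _ : Fin (k + 1) => V) W) {X Y : Finset ι → V}
    (hX : IsFamily d 𝒱 0 X) (hY : IsFamily d 𝒱 1 Y) (U : Finset ι) :
    conv d (Pi.single 0 1) (gradedSymm h𝒱 f) (Function.update (fun _ => X) 0 Y) U =
      k.factorial • convDeriv d f X Y U := by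
  rw [conv_gradedSymm h𝒱]
  · have h1 : ∀ ρ : Equiv.Perm (Fin (k + 1)),
        koszulSign (Pi.single (M := fun _ => ℤ) 0 1) ρ • conv d
          (fun i => (Pi.single 0 1 : Fin (k + 1) → ℤ) (ρ i)) f
          (fun i => Function.update (fun _ => X) (0 : Fin (k + 1)) Y (ρ i)) U =
        conv d (Pi.single (ρ.symm 0) 1) f (Function.update (fun _ => X) (ρ.symm 0) Y) U := by
      intro ρ
      rw [koszulSign_eq_one, one_smul]
      · congr 1
        · funext i
          by_cases h : ρ i = 0
          · rw [h, ← h]; simp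
          · rw [Pi.single_eq_of_ne h, Pi.single_eq_of_ne]
            rintro rfl; simp at h
        · funext i
          by_cases h : ρ i = 0
          · rw [h, ← h]; simp
          · rw [Function.update_of_ne h, Function.update_of_ne]
            rintro rfl; simp at h
      · intro i j hij
        by_cases hi : i = 0
        · subst hi; simp [Pi.single_eq_of_ne (Ne.symm hij)]
        · simp [Pi.single_eq_of_ne hi]
    rw [Finset.sum_congr rfl fun ρ _ => h1 ρ]
    rw [Fintype.sum_equiv (Equiv.inv (Equiv.Perm (Fin (k + 1))))
      (fun ρ => conv d (Pi.single (ρ.symm 0) 1) f (Function.update (fun _ => X) (ρ.symm 0) Y) U)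
      (fun ρ => conv d (Pi.single (ρ 0) 1) f (Function.update (fun _ => X) (ρ 0) Y) U)
      (fun ρ => rfl)]
    rw [← Fintype.sum_equiv Equiv.Perm.decomposeFin.symm
      (fun x => conv d (Pi.single x.1 1) f (Function.update (fun _ => X) x.1 Y) U) _
      (fun x => by rw [← Prod.mk.eta (p := x), Equiv.Perm.decomposeFin_symm_apply_zero])]
    rw [Fintype.sum_prod_type]
    simp [convDeriv, Finset.smul_sum, Fintype.card_perm]
  · intro i
    by_cases hi : i = 0
    · subst hi; simpa using hY
    · simpa [Function.update_of_ne hi, Pi.single_eq_of_ne hi] using hX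

end Conv

section Blocks

variable {K V W : Type*} [Field K] [AddCommGroup V] [Module K V] [AddCommGroup W] [Module K W]

theorem sum_orderEmbOfFin {n : ℕ} (d : Fin n → ℤ) (S : Finset (Fin n)) :
    ∑ i, d (S.orderEmbOfFin rfl i) = degOn d S := by
  conv_rhs => rw [degOn, ← Finset.map_orderEmbOfFin_univ S rfl, Finset.sum_map]
  rfl

theorem isFamily_onBlock {n : ℕ} {𝒱 : ℤ → Submodule K V} {𝒲 : ℤ → Submodule K W} {e : ℤ}
    {q : ∀ n : ℕ, MultilinearMap K (fun _ : Fin n => V) W} (hq : IsGradedSymmetric 𝒱 𝒲 e q)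
    {d : Fin n → ℤ} {v : Fin n → V} (hv : ∀ i, v i ∈ 𝒱 (d i)) :
    IsFamily d 𝒲 e (onBlock q v) := by
  intro S
  have := hq.map_mem S.card (fun i => d (S.orderEmbOfFin rfl i)) _ (fun i => hv _)
  rwa [sum_orderEmbOfFin] at this

theorem onBlock_empty {n : ℕ} {q : ∀ n : ℕ, MultilinearMap K (fun _ : Fin n => V) W}
    (hq : q 0 = 0) (v : Fin n → V) : onBlock q v ∅ = 0 := by
  have : ∀ (m : ℕ) (_ : m = 0) (u : Fin m → V), q m u = 0 := by
    rintro m rfl u; simp [hq]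
  exact this _ Finset.card_empty _

/-- Evaluations of a family of maps at tuples of propositionally equal lengths. -/
theorem apply_eq_of_length_eq {X Y : Type*} (q : ∀ n : ℕ, (Fin n → X) → Y) {a b : ℕ} (h : a = b)
    {u : Fin a → X} {w : Fin b → X} (huw : ∀ i, u i = w (Fin.cast h i)) : q a u = q b w := by
  subst h
  congr 1
  funext i
  exact huw i

/-- The Koszul sign of a permutation which is increasing on consecutive blocks `β⁻¹(i)` is the sign
of the corresponding decomposition. -/
theorem koszulSign_eq_prod_koszulPair {n j : ℕ} (d : Fin n → ℤ) (σ : Equiv.Perm (Fin n))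
    (β : Fin n → Fin j) (h1 : ∀ p p', p < p' → σ p' < σ p → β p < β p')
    (h2 : ∀ p p', β p < β p' → p < p') :
    koszulSign d σ = ∏ x ∈ Finset.univ.filter (fun x : Fin j × Fin j => x.1 < x.2),
      koszulPair d ((Finset.univ.filter (fun p => β p = x.1)).map σ.toEmbedding)
        ((Finset.univ.filter (fun p => β p = x.2)).map σ.toEmbedding) := by
  rw [koszulSign, ← Finset.prod_fiberwise_of_maps_to
    (t := Finset.univ.filter (fun x : Fin j × Fin j => x.1 < x.2))
    (g := fun p : Fin n × Fin n => (β p.1, β p.2))]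
  · refine Finset.prod_congr rfl fun x hx => ?_
    have hx : x.1 < x.2 := by simpa using hx
    refine Finset.prod_bij (fun p _ => (σ p.1, σ p.2)) ?_ ?_ ?_ ?_
    · rintro ⟨a, b⟩ hp
      simp only [Finset.mem_filter, Finset.mem_univ, true_and, Prod.ext_iff] at hp
      simp [hp.1.2, hp.2.1, hp.2.2]
    · rintro ⟨a, b⟩ _ ⟨a', b'⟩ _ h
      simpa using h
    · rintro ⟨a, b⟩ hp
      simp only [Finset.mem_filter, Finset.mem_product, Finset.mem_map, Finset.mem_univ,
        true_and, Equiv.coe_toEmbedding] at hp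
      obtain ⟨⟨⟨p, hp1, rfl⟩, ⟨p', hp2, rfl⟩⟩, hp3⟩ := hp
      refine ⟨(p, p'), ?_, rfl⟩
      simp only [Finset.mem_filter, Finset.mem_univ, true_and, Prod.ext_iff]
      exact ⟨⟨h2 _ _ (by rw [hp1, hp2]; exact hx), hp3⟩, hp1, hp2⟩
    · rintro ⟨a, b⟩ _
      rfl
  · rintro ⟨a, b⟩ hp
    simp only [Finset.mem_filter, Finset.mem_univ, true_and] at hp ⊢
    exact h1 _ _ hp.1 hp.2

/-! ### Unshuffles and the square of a coderivation -/

/-- The set of the first `k` values of a permutation. -/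
def firstValues {n : ℕ} (k : ℕ) (σ : Equiv.Perm (Fin n)) : Finset (Fin n) :=
  (Finset.univ.filter (fun p : Fin n => p.val < k)).map σ.toEmbedding

theorem card_firstValues {n k : ℕ} (hk : k ≤ n) (σ : Equiv.Perm (Fin n)) :
    (firstValues k σ).card = k := by
  rw [firstValues, Finset.card_map, Fin.card_filter_val_lt, min_eq_right hk]

theorem compl_firstValues {n : ℕ} (k : ℕ) (σ : Equiv.Perm (Fin n)) :
    (firstValues k σ)ᶜ = (Finset.univ.filter (fun p : Fin n => ¬ p.val < k)).map σ.toEmbedding := by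
  ext a
  simp only [firstValues, Finset.mem_compl, Finset.mem_map_equiv, Finset.mem_filter,
    Finset.mem_univ, true_and]

theorem card_compl_firstValues {n k : ℕ} (hk : k ≤ n) (σ : Equiv.Perm (Fin n)) :
    (firstValues k σ)ᶜ.card = n - k := by
  rw [Finset.card_compl, card_firstValues hk, Fintype.card_fin]

theorem unshuffle_apply_first {n k : ℕ} (hk : k ≤ n) {σ : Equiv.Perm (Fin n)}
    (hσ : σ ∈ unshuffles n k) (i : Fin k) :
    σ ⟨i, by omega⟩ = (firstValues k σ).orderEmbOfFin (card_firstValues hk σ) i := by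
  have h : ∀ i j : Fin n, i < j → (j.val < k ∨ k ≤ i.val) → σ i < σ j := by
    simpa [unshuffles] using hσ
  refine congrFun (Finset.orderEmbOfFin_unique (card_firstValues hk σ)
    (f := fun i : Fin k => σ ⟨i, by omega⟩) ?_ ?_) i
  · intro i
    simp [firstValues]
  · intro i j hij
    exact h _ _ hij (Or.inl j.2)

theorem unshuffle_apply_last {n k : ℕ} (hk : k ≤ n) {σ : Equiv.Perm (Fin n)}
    (hσ : σ ∈ unshuffles n k) (i : Fin (n - k)) :
    σ ⟨k + i, by omega⟩ =
      (firstValues k σ)ᶜ.orderEmbOfFin (card_compl_firstValues hk σ) i := by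
  have h : ∀ i j : Fin n, i < j → (j.val < k ∨ k ≤ i.val) → σ i < σ j := by
    simpa [unshuffles] using hσ
  refine congrFun (Finset.orderEmbOfFin_unique (card_compl_firstValues hk σ)
    (f := fun i : Fin (n - k) => σ ⟨k + i, by omega⟩) ?_ ?_) i
  · intro i
    simp [compl_firstValues]
  · intro i j hij
    exact h _ _ (Nat.add_lt_add_left hij k) (Or.inr (Nat.le_add_right _ _))

theorem koszulSign_unshuffle {n k : ℕ} (d : Fin n → ℤ) {σ : Equiv.Perm (Fin n)}
    (hσ : σ ∈ unshuffles n k) :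
    koszulSign d σ = koszulPair d (firstValues k σ) (firstValues k σ)ᶜ := by
  have h : ∀ i j : Fin n, i < j → (j.val < k ∨ k ≤ i.val) → σ i < σ j := by
    simpa [unshuffles] using hσ
  have hval : ∀ p p' : Fin n, (if p.val < k then (0 : Fin 2) else 1) <
      (if p'.val < k then 0 else 1) ↔ p.val < k ∧ k ≤ p'.val := by
    intro p p'
    by_cases hp : p.val < k <;> by_cases hp' : p'.val < k <;>
      (simp [hp, hp']; try omega)
  rw [koszulSign_eq_prod_koszulPair d σ (fun p => if p.val < k then (0 : Fin 2) else 1)]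
  · have h3 : Finset.univ.filter (fun x : Fin 2 × Fin 2 => x.1 < x.2) = {(0, 1)} := by decide
    rw [h3, Finset.prod_singleton, compl_firstValues]
    simp [firstValues]
  · intro p p' hpp' hσ'
    rw [hval]
    by_contra hcon
    exact lt_asymm hσ' (h p p' hpp' (by omega))
  · intro p p'
    rw [hval]
    intro h3
    exact Fin.lt_def.2 (by omega)

theorem exists_unshuffle {n : ℕ} (S : Finset (Fin n)) :
    ∃ σ ∈ unshuffles n S.card, firstValues S.card σ = S := by
  have hc : n = S.card + Sᶜ.card := by
    rw [Finset.card_compl, Fintype.card_fin]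
    have := card_finset_fin_le S
    omega
  set σ : Equiv.Perm (Fin n) := (finCongr hc).trans
    (finSumFinEquiv.symm.trans (finSumEquivOfFinset (s := S) rfl rfl)) with hσ
  have h1 : ∀ (p : Fin n) (hp : p.val < S.card), σ p = S.orderEmbOfFin rfl ⟨p, hp⟩ := by
    intro p hp
    have : finCongr hc p = Fin.castAdd _ ⟨p, hp⟩ := rfl
    rw [hσ, Equiv.trans_apply, Equiv.trans_apply, this, finSumFinEquiv_symm_apply_castAdd,
      finSumEquivOfFinset_inl]
  have h2 : ∀ (p : Fin n) (hp : ¬ p.val < S.card),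
      σ p = Sᶜ.orderEmbOfFin rfl ⟨p - S.card, by omega⟩ := by
    intro p hp
    have : finCongr hc p = Fin.natAdd _ ⟨p - S.card, by omega⟩ := by
      ext; simp; omega
    rw [hσ, Equiv.trans_apply, Equiv.trans_apply, this, finSumFinEquiv_symm_apply_natAdd,
      finSumEquivOfFinset_inr]
  refine ⟨σ, ?_, ?_⟩
  · simp only [unshuffles, Finset.mem_filter, Finset.mem_univ, true_and]
    intro i j hij hor
    rcases hor with h | h
    · rw [h1 j h, h1 i (lt_trans hij h)]
      simpa using hij
    · have h' : S.card ≤ j.val := h.trans hij.le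
      rw [h2 j (not_lt.2 h'), h2 i (not_lt.2 h), OrderEmbedding.lt_iff_lt, Fin.lt_def]
      have : i.val < j.val := hij
      simp only
      omega
  · refine Finset.eq_of_subset_of_card_le ?_ ?_
    · intro a ha
      simp only [firstValues, Finset.mem_map, Finset.mem_filter, Finset.mem_univ, true_and,
        Equiv.coe_toEmbedding] at ha
      obtain ⟨p, hp, rfl⟩ := ha
      rw [h1 p hp]
      exact Finset.orderEmbOfFin_mem _ _ _
    · rw [card_firstValues (card_finset_fin_le S |>.trans (le_of_eq (by simp)))]

theorem nijenhuisRichardsonSquare_eq_sum_subsets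
    (q : ∀ n : ℕ, MultilinearMap K (fun _ : Fin n => V) V) (hq : q 0 = 0) {n : ℕ} (d : Fin n → ℤ)
    (v : Fin n → V) :
    nijenhuisRichardsonSquare q n d v = ∑ S : Finset (Fin n), koszulPair d S Sᶜ •
      q (Sᶜ.card + 1) (Fin.cons (α := fun _ => V) (onBlock q v S)
        (fun i => v (Sᶜ.orderEmbOfFin rfl i))) := by
  rw [nijenhuisRichardsonSquare, Finset.sum_sigma']
  refine Finset.sum_of_injOn (fun x => firstValues (x.1.val + 1) x.2) ?_ ?_ ?_ ?_
  · rintro ⟨k, σ⟩ hσ ⟨k', σ'⟩ hσ' h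
    simp only [Finset.coe_sigma, Set.mem_sigma_iff, Finset.coe_univ, Set.mem_univ, true_and,
      Finset.mem_coe] at hσ hσ'
    have hS : firstValues (k.val + 1) σ = firstValues (k'.val + 1) σ' := h
    have hk : k = k' := by
      have := card_firstValues (Nat.succ_le_of_lt k.2) σ
      rw [hS, card_firstValues (Nat.succ_le_of_lt k'.2)] at this
      exact Fin.ext (by omega)
    subst hk
    congr 1
    refine Equiv.ext fun p => ?_
    have hkn := Nat.succ_le_of_lt k.2
    by_cases hp : p.val < k.val + 1
    · have e1 := unshuffle_apply_first hkn hσ ⟨p, hp⟩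
      have e2 := unshuffle_apply_first hkn hσ' ⟨p, hp⟩
      simp only [hS] at e1
      exact e1.trans e2.symm
    · have e1 := unshuffle_apply_last hkn hσ ⟨p - (k + 1), by omega⟩
      have e2 := unshuffle_apply_last hkn hσ' ⟨p - (k + 1), by omega⟩
      have ep : (⟨k.val + 1 + (p.val - (k.val + 1)), by omega⟩ : Fin n) = p := by
        ext; simp; omega
      simp only [hS, ep] at e1 e2
      exact e1.trans e2.symm
  · intro x _
    simp
  · intro S _ hS
    have hS0 : S = ∅ := by
      by_contra hne
      have hpos : 0 < S.card := Finset.card_pos.2 (Finset.nonempty_iff_ne_empty.2 hne)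
      obtain ⟨σ, hσ, hσS⟩ := exists_unshuffle S
      have hle := card_finset_fin_le S
      refine hS ⟨⟨⟨S.card - 1, by omega⟩, σ⟩, ?_, ?_⟩
      · simpa [Nat.sub_add_cancel hpos] using hσ
      · simpa [Nat.sub_add_cancel hpos] using hσS
    subst hS0
    rw [onBlock_empty hq, (q _).map_coord_zero 0 (by simp), smul_zero]
  · rintro ⟨k, σ⟩ hσ
    simp only [Finset.mem_sigma, Finset.mem_univ, true_and] at hσ
    have hkn := Nat.succ_le_of_lt k.2
    rw [koszulSign_unshuffle d hσ]
    congr 1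
    refine apply_eq_of_length_eq (fun n u => q n u) ?_ fun i => ?_
    · rw [card_compl_firstValues hkn]
    · refine Fin.cases ?_ (fun i => ?_) i
      · simp only [Fin.cons_zero, onBlock]
        refine apply_eq_of_length_eq (fun n u => q n u) (card_firstValues hkn σ).symm fun i => ?_
        rw [unshuffle_apply_first hkn hσ i]
        congr 1
      · have : Fin.cast (by rw [card_compl_firstValues hkn]) i.succ =
            (Fin.cast (card_compl_firstValues hkn σ).symm i).succ := rfl
        rw [this, Fin.cons_succ, Fin.cons_succ, unshuffle_apply_last hkn hσ i]
        congr 1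

/-- The square of the coderivation with Taylor coefficients the graded symmetrizations of `f`. -/
theorem nijenhuisRichardsonSquare_gradedSymm [CharZero K] {𝒱 : ℤ → Submodule K V}
    (h𝒱 : DirectSum.IsInternal 𝒱) (f : ∀ n : ℕ, MultilinearMap K (fun _ : Fin n => V) V)
    (hf0 : f 0 = 0)
    (hf : IsGradedSymmetric 𝒱 𝒱 1 (fun n => gradedSymm h𝒱 (f n))) {n N : ℕ} (hN : n < N)
    {d : Fin n → ℤ} {v : Fin n → V} (hv : ∀ i, v i ∈ 𝒱 (d i)) :
    nijenhuisRichardsonSquare (fun n => gradedSymm h𝒱 (f n)) n d v =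
      ∑ m ∈ Finset.range N, convDeriv d (f (m + 1)) (singles v)
        (onBlock (fun n => gradedSymm h𝒱 (f n)) v) Finset.univ := by
  have hq0 : gradedSymm h𝒱 (f 0) = 0 := by
    ext u; rw [gradedSymm_apply]; simp [hf0]
  rw [nijenhuisRichardsonSquare_eq_sum_subsets _ hq0]
  set Y := onBlock (fun n => gradedSymm h𝒱 (f n)) v with hY
  rw [← Finset.sum_fiberwise_of_maps_to (s := Finset.univ) (t := Finset.range N)
    (g := fun S : Finset (Fin n) => Sᶜ.card)]
  swap
  · intro S _
    exact Finset.mem_range.2 (lt_of_le_of_lt (card_finset_fin_le _) hN)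
  refine Finset.sum_congr rfl fun m _ => ?_
  have hm : ((m.factorial : ℕ) : K) ≠ 0 := Nat.cast_ne_zero.2 m.factorial_ne_zero
  refine smul_right_injective V hm ?_
  simp only [Nat.cast_smul_eq_nsmul]
  rw [← conv_cons_gradedSymm h𝒱 d (f (m + 1)) (isFamily_singles hv) (isFamily_onBlock hf hv),
    conv_cons d _ (by simp), Finset.powerset_univ, Finset.smul_sum, Finset.sum_filter]
  refine Finset.sum_congr rfl fun S _ => ?_
  rw [← Finset.compl_eq_univ_sdiff]
  simp only [Function.update_self, Function.update_of_ne (Fin.succ_ne_zero _)]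
  have hcoord : ∀ (u : Fin m → V) i, u i = 0 →
      gradedSymm h𝒱 (f (m + 1)) (Fin.cons (α := fun _ => V) (Y S) u) = 0 := by
    intro u i hu
    exact (gradedSymm h𝒱 (f (m + 1))).map_coord_zero i.succ (by simpa using hu)
  split_ifs with hS
  · subst hS
    rw [conv_singles d Sᶜ _ hcoord, smul_comm]
    congr 1
    have : ∀ σ : Equiv.Perm (Fin Sᶜ.card), koszulSign (fun i => d (Sᶜ.orderEmbOfFin rfl i)) σ •
        gradedSymm h𝒱 (f (Sᶜ.card + 1)) (Fin.cons (α := fun _ => V) (Y S)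
          (fun i => v (Sᶜ.orderEmbOfFin rfl (σ i)))) =
        gradedSymm h𝒱 (f (Sᶜ.card + 1)) (Fin.cons (α := fun _ => V) (Y S)
          (fun i => v (Sᶜ.orderEmbOfFin rfl i))) := by
      intro σ
      have h1 := gradedSymm_comp_perm h𝒱 (f (Sᶜ.card + 1))
        (d := Fin.cons (degOn d S + 1) (fun i => d (Sᶜ.orderEmbOfFin rfl i)))
        (v := Fin.cons (α := fun _ => V) (Y S) (fun i => v (Sᶜ.orderEmbOfFin rfl i)))
        (fun i => by
          refine Fin.cases ?_ (fun i => ?_) i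
          · simpa using isFamily_onBlock hf hv S
          · simpa using hv _) (Equiv.Perm.decomposeFin.symm (0, σ))
      rw [koszulSign_decomposeFin] at h1
      simp only [Fin.cons_succ] at h1
      have h2 : (fun i => Fin.cons (α := fun _ => V) (Y S)
          (fun i => v (Sᶜ.orderEmbOfFin rfl i)) (Equiv.Perm.decomposeFin.symm (0, σ) i)) =
          Fin.cons (α := fun _ => V) (Y S) (fun i => v (Sᶜ.orderEmbOfFin rfl (σ i))) := by
        funext i
        refine Fin.cases ?_ (fun i => ?_) i <;> simp
      rw [← h2, h1, smul_smul, Int.units_mul_self, one_smul]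
    rw [Finset.sum_congr rfl fun σ _ => this σ, Finset.sum_const, Finset.card_univ,
      Fintype.card_perm, Fintype.card_fin]
  · rw [conv_singles_of_card_ne d (Ne.symm hS) _ hcoord, smul_zero]

/-! ### Multi-unshuffles and the composition with a morphism of coalgebras -/

/-- The `i`-th block of values of a permutation, cut according to the composition `c`. -/
def blockValues {n : ℕ} (c : Composition n) (σ : Equiv.Perm (Fin n)) (i : Fin c.length) :
    Finset (Fin n) :=
  (Finset.univ.filter (fun p => c.index p = i)).map σ.toEmbedding

theorem composition_embedding_lt {n : ℕ} (c : Composition n) {p p' : Fin n}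
    (h : c.index p < c.index p') : p < p' := by
  have h1 : (p : ℕ) < c.sizeUpTo (c.index p + 1) := c.lt_sizeUpTo_index_succ p
  have h2 : c.sizeUpTo (c.index p') ≤ p' := c.sizeUpTo_index_le p'
  have h3 : c.sizeUpTo (c.index p + 1) ≤ c.sizeUpTo (c.index p') := c.monotone_sizeUpTo h
  exact Fin.lt_def.2 (by omega)

theorem filter_index_eq {n : ℕ} (c : Composition n) (i : Fin c.length) :
    Finset.univ.filter (fun p => c.index p = i) =
      Finset.univ.map (c.embedding i).toEmbedding := by
  ext p
  simp only [Finset.mem_filter, Finset.mem_univ, true_and, Finset.mem_map]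
  constructor
  · rintro rfl
    exact ⟨c.invEmbedding p, c.embedding_comp_inv p⟩
  · rintro ⟨a, rfl⟩
    exact c.index_embedding i a

theorem card_blockValues {n : ℕ} (c : Composition n) (σ : Equiv.Perm (Fin n)) (i : Fin c.length) :
    (blockValues c σ i).card = c.blocksFun i := by
  rw [blockValues, filter_index_eq]; simp

theorem multiUnshuffle_apply {n : ℕ} (c : Composition n) {σ : Equiv.Perm (Fin n)}
    (hσ : σ ∈ multiUnshuffles c) (i : Fin c.length) (a : Fin (c.blocksFun i)) :
    σ (c.embedding i a) = (blockValues c σ i).orderEmbOfFin (card_blockValues c σ i) a := by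
  have h : ∀ (i : Fin c.length) (a b : Fin (c.blocksFun i)), a < b →
      σ (c.embedding i a) < σ (c.embedding i b) := by
    simpa [multiUnshuffles] using hσ
  refine congrFun (Finset.orderEmbOfFin_unique (card_blockValues c σ i)
    (f := fun a => σ (c.embedding i a)) ?_ ?_) a
  · intro a
    simp [blockValues]
  · intro a b hab
    exact h i a b hab

theorem koszulSign_multiUnshuffle {n : ℕ} (d : Fin n → ℤ) (c : Composition n)
    {σ : Equiv.Perm (Fin n)} (hσ : σ ∈ multiUnshuffles c) :
    koszulSign d σ = blockSign d (fun _ => 0) (blockValues c σ) := by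
  have h : ∀ (i : Fin c.length) (a b : Fin (c.blocksFun i)), a < b →
      σ (c.embedding i a) < σ (c.embedding i b) := by
    simpa [multiUnshuffles] using hσ
  rw [koszulSign_eq_prod_koszulPair d σ c.index, blockSign]
  · refine Finset.prod_congr rfl fun x _ => ?_
    simp [blockValues]
  · intro p p' hpp' hσ'
    rcases lt_trichotomy (c.index p) (c.index p') with h1 | h1 | h1
    · exact h1
    · exfalso
      obtain ⟨i, a, rfl⟩ : ∃ i a, c.embedding i a = p := ⟨_, _, c.embedding_comp_inv p⟩
      obtain ⟨i', a', rfl⟩ : ∃ i a, c.embedding i a = p' := ⟨_, _, c.embedding_comp_inv p'⟩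
      rw [c.index_embedding, c.index_embedding] at h1
      subst h1
      exact lt_asymm hσ' (h _ a a' ((c.embedding i).lt_iff_lt.1 hpp'))
    · exact absurd (composition_embedding_lt c h1) (not_lt_of_gt hpp')
  · intro p p'
    exact composition_embedding_lt c

theorem blockValues_mem_decomps {n : ℕ} (c : Composition n) (σ : Equiv.Perm (Fin n)) :
    blockValues c σ ∈ decomps c.length Finset.univ := by
  refine mem_decomps.2 ⟨fun i j hij => ?_, ?_⟩
  · rw [blockValues, blockValues, Finset.disjoint_map]
    refine Finset.disjoint_filter.2 fun p _ h1 h2 => hij (h1.symm.trans h2)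
  · ext a
    simp [blockValues]

theorem exists_multiUnshuffle {n j : ℕ} {P : Fin j → Finset (Fin n)}
    (hP : P ∈ decomps j Finset.univ) (hne : ∀ i, (P i).Nonempty) :
    ∃ (c : Composition n) (σ : Equiv.Perm (Fin n)), σ ∈ multiUnshuffles c ∧
      (⟨c.length, blockValues c σ⟩ : Σ j, Fin j → Finset (Fin n)) = ⟨j, P⟩ := by
  obtain ⟨hP1, hP2⟩ := mem_decomps.1 hP
  obtain ⟨c, hc, hcP⟩ : ∃ (c : Composition n) (hc : c.length = j),
      ∀ i, c.blocksFun i = (P (Fin.cast hc i)).card := by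
    refine ⟨⟨List.ofFn (fun i => (P i).card), ?_, ?_⟩, ?_, ?_⟩
    · intro i hi
      obtain ⟨k, rfl⟩ := (List.mem_ofFn' _ _).1 hi
      exact (hne k).card_pos
    · rw [List.sum_ofFn, ← Finset.card_biUnion, hP2]
      · simp
      · intro i _ k _ hik
        exact hP1 i k hik
    · simp [Composition.length]
    · intro i
      simp only [Composition.blocksFun, List.get_eq_getElem, List.getElem_ofFn]
      rfl
  subst hc
  simp only [Fin.cast_eq_self] at hcP
  set g : (Σ i : Fin c.length, Fin (c.blocksFun i)) → Fin n :=
    fun x => (P x.1).orderEmbOfFin (hcP x.1).symm x.2 with hg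
  have hinj : Function.Injective g := by
    rintro ⟨i, a⟩ ⟨i', a'⟩ h
    have hi : i = i' := by
      by_contra hne
      have h1 : g ⟨i, a⟩ ∈ P i := Finset.orderEmbOfFin_mem _ _ _
      have h2 : g ⟨i', a'⟩ ∈ P i' := Finset.orderEmbOfFin_mem _ _ _
      exact Finset.disjoint_left.1 (hP1 i i' hne) h1 (h ▸ h2)
    subst hi
    have := ((P i).orderEmbOfFin (hcP i).symm).injective h
    exact congrArg (Sigma.mk i) this
  have hbij : Function.Bijective g := by
    rw [Fintype.bijective_iff_injective_and_card]
    exact ⟨hinj, Fintype.card_congr c.blocksFinEquiv⟩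
  set σ : Equiv.Perm (Fin n) := c.blocksFinEquiv.symm.trans (Equiv.ofBijective g hbij) with hσ
  have hσa : ∀ i a, σ (c.embedding i a) = (P i).orderEmbOfFin (hcP i).symm a := by
    intro i a
    have : c.blocksFinEquiv ⟨i, a⟩ = c.embedding i a := rfl
    rw [← this, hσ, Equiv.trans_apply, Equiv.symm_apply_apply]
    rfl
  refine ⟨c, σ, ?_, ?_⟩
  · simp only [multiUnshuffles, Finset.mem_filter, Finset.mem_univ, true_and]
    intro i a b hab
    rw [hσa, hσa]
    exact ((P i).orderEmbOfFin (hcP i).symm).lt_iff_lt.2 hab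
  · congr 1
    funext i
    refine Finset.eq_of_subset_of_card_le ?_ ?_
    · intro x hx
      rw [blockValues, filter_index_eq] at hx
      simp only [Finset.mem_map, Finset.mem_univ, true_and] at hx
      obtain ⟨_, ⟨a, rfl⟩, rfl⟩ := hx
      have := hσa i a
      simp only [RelEmbedding.coe_toEmbedding, Equiv.coe_toEmbedding]
      rw [this]
      exact Finset.orderEmbOfFin_mem _ _ _
    · rw [card_blockValues, hcP]

/-- `q₊ F` for a coderivation whose Taylor coefficients are the graded symmetrizations of `f`. -/
theorem plusComp_gradedSymm [CharZero K] {𝒱 : ℤ → Submodule K V} {𝒲 : ℤ → Submodule K W}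
    (h𝒱 : DirectSum.IsInternal 𝒱) (f : ∀ n : ℕ, MultilinearMap K (fun _ : Fin n => V) V)
    {F : ∀ n : ℕ, MultilinearMap K (fun _ : Fin n => W) V} (hF0 : F 0 = 0)
    (hF : IsGradedSymmetric 𝒲 𝒱 0 F) {n N : ℕ} (hN : n < N) {d : Fin n → ℤ} {w : Fin n → W}
    (hw : ∀ i, w i ∈ 𝒲 (d i)) :
    plusComp (fun n => gradedSymm h𝒱 (f n)) F n d w =
      ∑ j ∈ (Finset.range N).filter (2 ≤ ·),
        conv d (fun _ => 0) (f j) (fun _ => onBlock F w) Finset.univ := by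
  set X := onBlock F w with hX
  have hXfam : IsFamily d 𝒱 0 X := isFamily_onBlock hF hw
  have hX0 : X ∅ = 0 := onBlock_empty hF0 w
  -- replace each sum over `j`-block decompositions of `f` by one of its graded symmetrization
  have h1 : ∀ j, conv d (fun _ => 0) (f j) (fun _ => X) Finset.univ = ((j.factorial : K))⁻¹ •
      conv d (fun _ => 0) (gradedSymm h𝒱 (f j)) (fun _ => X) Finset.univ := by
    intro j
    have hj : ((j.factorial : ℕ) : K) ≠ 0 := Nat.cast_ne_zero.2 j.factorial_ne_zero
    rw [conv_gradedSymm h𝒱 d _ _ (fun _ => hXfam), eq_inv_smul_iff₀ hj]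
    simp [koszulSign_eq_one, Fintype.card_perm, Nat.cast_smul_eq_nsmul]
  simp only [h1]
  rw [plusComp]
  simp only [Finset.smul_sum, conv]
  rw [Finset.sum_sigma', Finset.sum_sigma']
  refine Finset.sum_of_injOn
    (fun x => (⟨x.1.length, blockValues x.1 x.2⟩ : Σ j, Fin j → Finset (Fin n))) ?_ ?_ ?_ ?_
  · rintro ⟨c, σ⟩ h ⟨c', σ'⟩ h' heq
    simp only [Finset.coe_sigma, Set.mem_sigma_iff, Finset.mem_coe] at h h'
    have hc : c = c' := by
      have := congrArg (fun x : Σ j, Fin j → Finset (Fin n) =>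
        List.ofFn (fun i => (x.2 i).card)) heq
      simp only [card_blockValues, Composition.ofFn_blocksFun] at this
      exact Composition.ext this
    subst hc
    have hb : blockValues c σ = blockValues c σ' := by
      simpa using heq
    congr 1
    refine Equiv.ext fun p => ?_
    obtain ⟨i, a, rfl⟩ : ∃ i a, c.embedding i a = p := ⟨_, _, c.embedding_comp_inv p⟩
    rw [multiUnshuffle_apply c h.2, multiUnshuffle_apply c h'.2]
    simp only [hb]
  · rintro ⟨c, σ⟩ h
    simp only [Finset.coe_sigma, Set.mem_sigma_iff, Finset.mem_coe, Finset.mem_filter,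
      Finset.mem_univ, true_and, Finset.mem_range] at h ⊢
    exact ⟨⟨lt_of_le_of_lt c.length_le hN, h.1⟩, blockValues_mem_decomps c σ⟩
  · rintro ⟨j, P⟩ h hn
    simp only [Finset.mem_sigma, Finset.mem_filter] at h
    by_cases hne : ∀ i, (P i).Nonempty
    · exfalso
      obtain ⟨c, σ, hσ, hcσ⟩ := exists_multiUnshuffle h.2 hne
      have hlen : c.length = j := congrArg Sigma.fst hcσ
      exact hn ⟨⟨c, σ⟩, by simpa [hσ, hlen] using h.1.2, hcσ⟩
    · push Not at hne
      obtain ⟨i, hi⟩ := hne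
      rw [(gradedSymm h𝒱 (f j)).map_coord_zero i (by simp only [hi, hX0]), smul_zero, smul_zero]
  · rintro ⟨c, σ⟩ h
    simp only [Finset.mem_sigma] at h
    rw [koszulSign_multiUnshuffle d c h.2]
    congr 3
    funext i
    rw [hX, onBlock]
    refine apply_eq_of_length_eq (fun n u => F n u) (card_blockValues c σ i).symm fun a => ?_
    rw [multiUnshuffle_apply c h.2]
    congr 1

end Blocks

/-! ### Power series in a nilpotent operator -/

section NilpotentCalculus

theorem sum_range_range_eq_sum_antidiagonal {A : Type*} [AddCommMonoid A] {N : ℕ}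
    (g : ℕ → ℕ → A) (hg : ∀ i k, N ≤ i + k → g i k = 0) :
    ∑ i ∈ Finset.range N, ∑ k ∈ Finset.range N, g i k =
      ∑ m ∈ Finset.range N, ∑ p ∈ Finset.HasAntidiagonal.antidiagonal m, g p.1 p.2 := by
  rw [← Finset.sum_product', Finset.sum_sigma']
  symm
  refine Finset.sum_of_injOn (fun x => x.2) ?_ ?_ ?_ ?_
  · rintro ⟨m, p⟩ h ⟨m', p'⟩ h' (rfl : p = p')
    simp only [Finset.coe_sigma, Set.mem_sigma_iff, Finset.mem_coe, Finset.HasAntidiagonal.mem_antidiagonal] at h h'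
    obtain rfl : m = m' := h.2.symm.trans h'.2
    rfl
  · rintro ⟨m, p⟩ h
    simp only [Finset.coe_sigma, Set.mem_sigma_iff, Finset.mem_coe, Finset.HasAntidiagonal.mem_antidiagonal,
      Finset.mem_range] at h
    simp only [Finset.mem_coe, Finset.mem_product, Finset.mem_range]
    omega
  · rintro ⟨i, k⟩ _ h
    refine hg i k ?_
    by_contra hlt
    exact h ⟨⟨i + k, (i, k)⟩, by simpa using hlt, rfl⟩
  · intro _ _
    rfl

variable {K E : Type*} [Field K] [AddCommGroup E] [Module K E]

/-- The value `p(z)` of a power series at an operator with `z ^ N = 0`. -/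
noncomputable def nilEval (N : ℕ) (p : PowerSeries K) (z : Module.End K E) : Module.End K E :=
  ∑ k ∈ Finset.range N, PowerSeries.coeff k p • z ^ k

theorem nilEval_apply (N : ℕ) (p : PowerSeries K) (z : Module.End K E) (u : E) :
    nilEval N p z u = ∑ k ∈ Finset.range N, PowerSeries.coeff k p • (z ^ k) u := by
  simp [nilEval]

theorem nilEval_mul {N : ℕ} (p q : PowerSeries K) {z : Module.End K E} (hz : z ^ N = 0) (u : E) :
    nilEval N (p * q) z u = nilEval N p z (nilEval N q z u) := by
  have h0 : ∀ m, N ≤ m → z ^ m = 0 := fun m hm => pow_eq_zero_of_le hm hz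
  simp only [nilEval_apply, map_sum, map_smul, Finset.smul_sum]
  rw [Finset.sum_comm, sum_range_range_eq_sum_antidiagonal
    (fun i k => PowerSeries.coeff k q • PowerSeries.coeff i p • (z ^ i) ((z ^ k) u))]
  · refine Finset.sum_congr rfl fun m _ => ?_
    rw [PowerSeries.coeff_mul, Finset.sum_smul]
    refine Finset.sum_congr rfl fun x hx => ?_
    rw [smul_smul, mul_comm, ← Module.End.mul_apply, ← pow_add, Finset.HasAntidiagonal.mem_antidiagonal.1 hx]
  · intro i k hik
    rw [← Module.End.mul_apply, ← pow_add, h0 _ hik]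
    simp

theorem nilEval_one {N : ℕ} (hN : 0 < N) (z : Module.End K E) (u : E) : nilEval N 1 z u = u := by
  rw [nilEval_apply, Finset.sum_eq_single_of_mem 0 (Finset.mem_range.2 hN)]
  · simp
  · intro k _ hk
    simp [PowerSeries.coeff_one, hk]

theorem nilEval_mem {N : ℕ} (p : PowerSeries K) {z : Module.End K E} {E₁ : Submodule K E}
    (hz : ∀ u ∈ E₁, z u ∈ E₁) {u : E} (hu : u ∈ E₁) : nilEval N p z u ∈ E₁ := by
  rw [nilEval_apply]
  refine Submodule.sum_mem _ fun k _ => Submodule.smul_mem _ _ ?_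
  clear * - hz hu
  induction k with
  | zero => simpa using hu
  | succ k ih => rw [pow_succ']; exact hz _ ih

/-- The operator `z + ε b` on `E ⊗ K[ε]/ε²`; a pair `(u₁, u₂)` stands for `u₂ + ε u₁`.  Power
series in this operator encode the derivatives of power series in `z` along `b`. -/
def dualEnd (z b : Module.End K E) : Module.End K (E × E) :=
  (z ∘ₗ LinearMap.fst K E E + b ∘ₗ LinearMap.snd K E E).prod (z ∘ₗ LinearMap.snd K E E)

theorem dualEnd_apply (z b : Module.End K E) (u : E × E) :
    dualEnd z b u = (z u.1 + b u.2, z u.2) := rfl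

theorem dualEnd_pow_snd (z b : Module.End K E) (j : ℕ) (u : E × E) :
    ((dualEnd z b ^ j) u).2 = (z ^ j) u.2 := by
  induction j with
  | zero => simp
  | succ j ih => rw [pow_succ', pow_succ', Module.End.mul_apply, dualEnd_apply, ih]; rfl

theorem dualEnd_pow_inl (z b : Module.End K E) (j : ℕ) (u : E) :
    (dualEnd z b ^ j) (u, 0) = ((z ^ j) u, 0) := by
  induction j with
  | zero => simp
  | succ j ih => rw [pow_succ', pow_succ', Module.End.mul_apply, ih, dualEnd_apply]; simp

theorem pow_eq_zero_of_dualEnd {z b : Module.End K E} {N : ℕ} (h : dualEnd z b ^ N = 0) :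
    z ^ N = 0 := by
  ext u
  rw [← dualEnd_pow_snd z b N (0, u), h]; rfl

theorem nilEval_dualEnd_snd (N : ℕ) (p : PowerSeries K) (z b : Module.End K E) (u : E × E) :
    (nilEval N p (dualEnd z b) u).2 = nilEval N p z u.2 := by
  simp [nilEval_apply, Prod.snd_sum, dualEnd_pow_snd]

theorem nilEval_dualEnd_fst (N : ℕ) (p : PowerSeries K) (z b : Module.End K E) (u : E × E) :
    (nilEval N p (dualEnd z b) u).1 =
      nilEval N p z u.1 + (nilEval N p (dualEnd z b) (0, u.2)).1 := by
  have h : u = (u.1, 0) + (0, u.2) := by simp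
  conv_lhs => rw [h, map_add, Prod.fst_add]
  congr 1
  simp [nilEval_apply, Prod.fst_sum, dualEnd_pow_inl]

/-! ### Exponential, Todd and Bernoulli series of a derivation -/

/-- The power series `(exp t - 1) / t`. -/
noncomputable def expSubOneDiv (K : Type*) [Field K] [CharZero K] : PowerSeries K :=
  PowerSeries.mk fun n => algebraMap ℚ K (1 / (n + 1).factorial)

variable [CharZero K]

theorem X_mul_expSubOneDiv : PowerSeries.X * expSubOneDiv K = PowerSeries.exp K - 1 := by
  ext n
  cases n with
  | zero => simp
  | succ n =>
    rw [mul_comm, PowerSeries.coeff_succ_mul_X]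
    simp [expSubOneDiv, PowerSeries.coeff_exp, PowerSeries.coeff_one]

theorem bernoulli_mul_expSubOneDiv : bernoulliPowerSeries K * expSubOneDiv K = 1 := by
  have h := bernoulliPowerSeries_mul_exp_sub_one K
  rw [← X_mul_expSubOneDiv, mul_left_comm] at h
  exact mul_left_cancel₀ PowerSeries.X_ne_zero (h.trans (mul_one _).symm)

theorem bernoulli'_mul_expSubOneDiv :
    bernoulli'PowerSeries K * expSubOneDiv K = PowerSeries.exp K := by
  have h := bernoulli'PowerSeries_mul_exp_sub_one K
  rw [← X_mul_expSubOneDiv, mul_left_comm] at h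
  exact mul_left_cancel₀ PowerSeries.X_ne_zero h

/-- The setting of the identities below: `B` is a symmetric bilinear operation on `E₁` (the bracket
of elements of degree one), and `z` is a nilpotent derivation of it. -/
structure IsNilpotentDerivation (N : ℕ) (B : E →ₗ[K] E →ₗ[K] E) (z : Module.End K E)
    (E₁ : Submodule K E) : Prop where
  stable : ∀ u ∈ E₁, z u ∈ E₁
  leibniz : ∀ u ∈ E₁, ∀ w ∈ E₁, z (B u w) = B (z u) w + B u (z w)
  symm : ∀ u ∈ E₁, ∀ w ∈ E₁, B u w = B w u
  vanish : ∀ u w, ∀ a b, N ≤ a + b → B ((z ^ a) u) ((z ^ b) w) = 0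

namespace IsNilpotentDerivation

variable {N : ℕ} {B : E →ₗ[K] E →ₗ[K] E} {z : Module.End K E} {E₁ : Submodule K E}
  (hB : IsNilpotentDerivation N B z E₁)
include hB

theorem pow_mem {u : E} (hu : u ∈ E₁) (k : ℕ) : (z ^ k) u ∈ E₁ := by
  induction k with
  | zero => simpa using hu
  | succ k ih => rw [pow_succ']; exact hB.stable _ ih

theorem pow_bracket {u w : E} (hu : u ∈ E₁) (hw : w ∈ E₁) (j : ℕ) :
    (z ^ j) (B u w) = ∑ p ∈ Finset.HasAntidiagonal.antidiagonal j,
      (j.choose p.2 : K) • B ((z ^ p.1) u) ((z ^ p.2) w) := by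
  induction j with
  | zero => simp
  | succ j ih =>
    have h1 : ∀ p ∈ Finset.HasAntidiagonal.antidiagonal (j + 1),
        (((j + 1).choose p.2 : ℕ) : K) • B ((z ^ p.1) u) ((z ^ p.2) w) =
        ((if p.2 = 0 then 0 else j.choose (p.2 - 1) : ℕ) : K) • B ((z ^ p.1) u) ((z ^ p.2) w) +
          (j.choose p.2 : K) • B ((z ^ p.1) u) ((z ^ p.2) w) := by
      rintro ⟨a, b⟩ _
      rw [← add_smul, ← Nat.cast_add]
      cases b with
      | zero => simp
      | succ b => simp [Nat.choose_succ_succ]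
    rw [Finset.sum_congr rfl h1, Finset.sum_add_distrib, Finset.Nat.sum_antidiagonal_succ',
      Finset.Nat.sum_antidiagonal_succ, pow_succ', Module.End.mul_apply, ih, map_sum]
    simp only [if_true, Nat.cast_zero, zero_smul, zero_add, Nat.succ_ne_zero, if_false,
      Nat.add_sub_cancel, Nat.choose_succ_self, map_smul, ← Finset.sum_add_distrib]
    refine Finset.sum_congr rfl fun p _ => ?_
    rw [hB.leibniz _ (hB.pow_mem hu _) _ (hB.pow_mem hw _), smul_add, add_comm, pow_succ' z p.1,
      pow_succ' z p.2]
    rfl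

theorem dualEnd_pow_inr {u y : E} (hu : u ∈ E₁) (hy : y ∈ E₁) (j : ℕ) :
    ((dualEnd z (B.flip y) ^ (j + 1)) (0, u)).1 = ∑ p ∈ Finset.HasAntidiagonal.antidiagonal j,
      ((j + 1).choose (p.2 + 1) : K) • B ((z ^ p.1) u) ((z ^ p.2) y) := by
  induction j with
  | zero => simp [dualEnd_apply]
  | succ j ih =>
    have h1 : ∀ p ∈ Finset.HasAntidiagonal.antidiagonal (j + 1),
        (((j + 1 + 1).choose (p.2 + 1) : ℕ) : K) • B ((z ^ p.1) u) ((z ^ p.2) y) =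
        ((j + 1).choose p.2 : K) • B ((z ^ p.1) u) ((z ^ p.2) y) +
          ((j + 1).choose (p.2 + 1) : K) • B ((z ^ p.1) u) ((z ^ p.2) y) := by
      rintro ⟨a, b⟩ _
      rw [← add_smul, ← Nat.cast_add, Nat.choose_succ_succ]
    rw [Finset.sum_congr rfl h1, Finset.sum_add_distrib, Finset.Nat.sum_antidiagonal_succ',
      Finset.Nat.sum_antidiagonal_succ, pow_succ', Module.End.mul_apply, dualEnd_apply, ih,
      dualEnd_pow_snd, map_sum]
    simp only [Nat.choose_zero_right, Nat.cast_one, one_smul, Nat.choose_succ_self, Nat.cast_zero,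
      zero_smul, zero_add, map_smul, pow_zero, Module.End.one_apply, LinearMap.flip_apply]
    rw [add_assoc, ← Finset.sum_add_distrib, add_comm]
    congr 1
    refine Finset.sum_congr rfl fun p _ => ?_
    rw [hB.leibniz _ (hB.pow_mem hu _) _ (hB.pow_mem hy _), smul_add, add_comm, pow_succ' z p.1,
      pow_succ' z p.2]
    rfl

theorem nilEval_dualEnd_inr {u y : E} (hu : u ∈ E₁) (hy : y ∈ E₁)
    (hZ : dualEnd z (B.flip y) ^ N = 0) (p : PowerSeries K) :
    (nilEval N p (dualEnd z (B.flip y)) (0, u)).1 =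
      ∑ j ∈ Finset.range N, ∑ x ∈ Finset.HasAntidiagonal.antidiagonal j,
        (PowerSeries.coeff (j + 1) p * (j + 1).choose (x.2 + 1)) •
          B ((z ^ x.1) u) ((z ^ x.2) y) := by
  have h : ∀ j, PowerSeries.coeff (j + 1) p •
      ((dualEnd z (B.flip y) ^ (j + 1)) (0, u)).1 = ∑ x ∈ Finset.HasAntidiagonal.antidiagonal j,
        (PowerSeries.coeff (j + 1) p * (j + 1).choose (x.2 + 1)) •
          B ((z ^ x.1) u) ((z ^ x.2) y) := by
    intro j
    rw [hB.dualEnd_pow_inr hu hy, Finset.smul_sum]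
    simp [smul_smul]
  rw [← Finset.sum_congr rfl fun j _ => h j, nilEval_apply, Prod.fst_sum]
  have h2 := Finset.sum_range_succ (fun j => PowerSeries.coeff j p •
    ((dualEnd z (B.flip y) ^ j) (0, u)).1) N
  rw [Finset.sum_range_succ'] at h2
  simp only [hZ, pow_zero, Module.End.one_apply, LinearMap.zero_apply, Prod.fst_zero, smul_zero,
    add_zero] at h2
  simpa using h2.symm

/-- The exponential of a derivation is an automorphism. -/
theorem exp_bracket {u w : E} (hu : u ∈ E₁) (hw : w ∈ E₁) :
    nilEval N (PowerSeries.exp K) z (B u w) =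
      B (nilEval N (PowerSeries.exp K) z u) (nilEval N (PowerSeries.exp K) z w) := by
  simp only [nilEval_apply, map_sum, LinearMap.sum_apply, map_smul, LinearMap.smul_apply,
    Finset.smul_sum]
  rw [Finset.sum_comm, sum_range_range_eq_sum_antidiagonal (fun a b =>
    PowerSeries.coeff b (PowerSeries.exp K) • PowerSeries.coeff a (PowerSeries.exp K) •
      B ((z ^ a) u) ((z ^ b) w))]
  · refine Finset.sum_congr rfl fun j _ => ?_
    rw [hB.pow_bracket hu hw, Finset.smul_sum]
    refine Finset.sum_congr rfl fun p hp => ?_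
    rw [smul_smul, smul_smul]
    congr 1
    obtain ⟨a, b⟩ := p
    obtain rfl : a + b = j := by simpa using hp
    simp only [PowerSeries.coeff_exp]
    rw [← map_natCast (algebraMap ℚ K), ← map_mul, ← map_mul, Nat.cast_choose ℚ (Nat.le_add_left b a)]
    congr 1
    have h1 := Nat.cast_ne_zero (R := ℚ).2 (a + b).factorial_ne_zero
    have h2 := Nat.cast_ne_zero (R := ℚ).2 a.factorial_ne_zero
    have h3 := Nat.cast_ne_zero (R := ℚ).2 b.factorial_ne_zero
    rw [Nat.add_sub_cancel]
    field_simp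
  · intro a b hab
    rw [hB.vanish u w a b hab]; simp

/-- The derivative of the exponential:
`exp(z + ε [·, y]) u = exp(z) u + ε [exp(z) u, ((exp z - 1)/z) y]`. -/
theorem exp_dualEnd {u y : E} (hu : u ∈ E₁) (hy : y ∈ E₁)
    (hZ : dualEnd z (B.flip y) ^ N = 0) :
    (nilEval N (PowerSeries.exp K) (dualEnd z (B.flip y)) (0, u)).1 =
      B (nilEval N (PowerSeries.exp K) z u) (nilEval N (expSubOneDiv K) z y) := by
  rw [hB.nilEval_dualEnd_inr hu hy hZ]
  simp only [nilEval_apply, map_sum, LinearMap.sum_apply, map_smul, LinearMap.smul_apply,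
    Finset.smul_sum]
  rw [Finset.sum_comm, sum_range_range_eq_sum_antidiagonal (fun a b =>
    PowerSeries.coeff b (expSubOneDiv K) • PowerSeries.coeff a (PowerSeries.exp K) •
      B ((z ^ a) u) ((z ^ b) y))]
  · refine Finset.sum_congr rfl fun j _ => Finset.sum_congr rfl fun p hp => ?_
    rw [smul_smul]
    congr 1
    obtain ⟨a, b⟩ := p
    obtain rfl : a + b = j := by simpa using hp
    simp only [PowerSeries.coeff_exp, expSubOneDiv, PowerSeries.coeff_mk]
    rw [← map_natCast (algebraMap ℚ K), ← map_mul, ← map_mul,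
      Nat.cast_choose ℚ (by omega : b + 1 ≤ a + b + 1)]
    congr 1
    have h1 := Nat.cast_ne_zero (R := ℚ).2 (a + b + 1).factorial_ne_zero
    have h2 := Nat.cast_ne_zero (R := ℚ).2 a.factorial_ne_zero
    have h3 := Nat.cast_ne_zero (R := ℚ).2 (b + 1).factorial_ne_zero
    rw [show a + b + 1 - (b + 1) = a by omega]
    field_simp
  · intro a b hab
    rw [hB.vanish u y a b hab]; simp

/-- The derivative of `J = (exp z - 1)/z`: twice the `ε`-part of `J(z + ε [·, y]) y` is
`[J y, J y]`. -/
theorem expSubOneDiv_dualEnd {y : E} (hy : y ∈ E₁) (hZ : dualEnd z (B.flip y) ^ N = 0) :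
    (nilEval N (expSubOneDiv K) (dualEnd z (B.flip y)) (0, y)).1 =
      (2⁻¹ : K) • B (nilEval N (expSubOneDiv K) z y) (nilEval N (expSubOneDiv K) z y) := by
  rw [eq_inv_smul_iff₀ two_ne_zero, hB.nilEval_dualEnd_inr hy hy hZ]
  simp only [nilEval_apply, map_sum, LinearMap.sum_apply, map_smul, LinearMap.smul_apply,
    Finset.smul_sum]
  rw [Finset.sum_comm (s := Finset.range N) (t := Finset.range N),
    sum_range_range_eq_sum_antidiagonal (fun a b =>
    PowerSeries.coeff b (expSubOneDiv K) • PowerSeries.coeff a (expSubOneDiv K) •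
      B ((z ^ a) y) ((z ^ b) y))]
  · refine Finset.sum_congr rfl fun j _ => ?_
    rw [← Finset.smul_sum, two_smul]
    nth_rewrite 1 [← Finset.Nat.sum_antidiagonal_swap]
    rw [← Finset.sum_add_distrib]
    refine Finset.sum_congr rfl fun p hp => ?_
    obtain ⟨a, b⟩ := p
    obtain rfl : a + b = j := by simpa using hp
    simp only [Prod.swap_prod_mk]
    rw [hB.symm _ (hB.pow_mem hy b) _ (hB.pow_mem hy a), smul_smul, ← add_smul, ← mul_add,
      ← Nat.cast_add]
    congr 1
    have hchoose : (a + b + 1).choose (a + 1) + (a + b + 1).choose (b + 1) =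
        (a + b + 2).choose (b + 1) := by
      rw [Nat.choose_succ_succ (a + b + 1) b]
      congr 1
      rw [← Nat.choose_symm (by omega : a + 1 ≤ a + b + 1)]
      congr 1
      omega
    rw [hchoose]
    simp only [expSubOneDiv, PowerSeries.coeff_mk]
    rw [← map_natCast (algebraMap ℚ K), ← map_mul, ← map_mul,
      Nat.cast_choose ℚ (by omega : b + 1 ≤ a + b + 2)]
    congr 1
    have h1 := Nat.cast_ne_zero (R := ℚ).2 (a + b + 2).factorial_ne_zero
    have h2 := Nat.cast_ne_zero (R := ℚ).2 (a + 1).factorial_ne_zero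
    have h3 := Nat.cast_ne_zero (R := ℚ).2 (b + 1).factorial_ne_zero
    rw [show a + b + 2 - (b + 1) = a + 1 by omega, show a + b + 1 + 1 = a + b + 2 by omega]
    field_simp
  · intro a b hab
    rw [hB.vanish y y a b hab]; simp

/-- The vector field `y = φ(z) h - ψ(z) h'` with `φ(t) = t/(1 - exp(-t))`, `ψ(t) = t/(exp t - 1)`
on the degree zero elements squares to zero, where `h` and `h'` move along `-[h, h]/2` and
`-[h', h']/2`. -/
theorem cocylinder_square_zero (hN : 0 < N) {h h' y : E} (hh : h ∈ E₁) (hh' : h' ∈ E₁)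
    (hy : y = nilEval N (bernoulli'PowerSeries K) z h - nilEval N (bernoulliPowerSeries K) z h')
    (hZ : dualEnd z (B.flip y) ^ N = 0) :
    (nilEval N (bernoulli'PowerSeries K) (dualEnd z (B.flip y)) (-(2⁻¹ : K) • B h h, h)).1 -
      (nilEval N (bernoulliPowerSeries K) (dualEnd z (B.flip y)) (-(2⁻¹ : K) • B h' h', h')).1
      = 0 := by
  have hz := pow_eq_zero_of_dualEnd hZ
  set Z := dualEnd z (B.flip y) with hZdef
  set J := expSubOneDiv K
  have hyE : y ∈ E₁ := by
    rw [hy]; exact sub_mem (nilEval_mem _ hB.stable hh) (nilEval_mem _ hB.stable hh')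
  set g := nilEval N (PowerSeries.exp K) z h with hg
  have hJy : nilEval N J z y = g - h' := by
    rw [hy, map_sub, ← nilEval_mul _ _ hz, ← nilEval_mul _ _ hz, mul_comm,
      bernoulli'_mul_expSubOneDiv, mul_comm, bernoulli_mul_expSubOneDiv, nilEval_one hN]
  set w := nilEval N (bernoulli'PowerSeries K) Z (-(2⁻¹ : K) • B h h, h) -
    nilEval N (bernoulliPowerSeries K) Z (-(2⁻¹ : K) • B h' h', h') with hw
  have hw2 : w.2 = y := by
    rw [hw, Prod.snd_sub, nilEval_dualEnd_snd, nilEval_dualEnd_snd, hy]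
  have hJw : nilEval N J Z w = nilEval N (PowerSeries.exp K) Z (-(2⁻¹ : K) • B h h, h) -
      (-(2⁻¹ : K) • B h' h', h') := by
    rw [hw, map_sub, ← nilEval_mul _ _ hZ, ← nilEval_mul _ _ hZ, mul_comm,
      bernoulli'_mul_expSubOneDiv, mul_comm, bernoulli_mul_expSubOneDiv, nilEval_one hN]
  have hJw1 := congrArg Prod.fst hJw
  rw [Prod.fst_sub, nilEval_dualEnd_fst, nilEval_dualEnd_fst N (PowerSeries.exp K), hw2,
    hB.expSubOneDiv_dualEnd hyE hZ, hB.exp_dualEnd hh hyE hZ, map_smul, hB.exp_bracket hh hh,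
    ← hg, hJy] at hJw1
  have hgE : g ∈ E₁ := nilEval_mem _ hB.stable hh
  have hw1 : nilEval N J z w.1 = 0 := by
    rw [eq_sub_of_add_eq hJw1]
    simp only [map_sub, LinearMap.sub_apply, hB.symm h' hh' g hgE]
    module
  have : w.1 = 0 := by
    rw [← nilEval_one hN z w.1, ← bernoulli_mul_expSubOneDiv, nilEval_mul _ _ hz, hw1, map_zero]
  rw [← Prod.fst_sub]
  exact this

/-- The vector field `y = ψ(z) P exp(z) h`, whose Taylor coefficients are the higher derived
brackets, squares to zero. -/
theorem derivedBrackets_square_zero (hN : 0 < N) (P : E →ₗ[K] E) (hP₁ : ∀ u ∈ E₁, P u ∈ E₁)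
    (hPP : ∀ u ∈ E₁, P (B (P u) (P u)) = B (P u) (P u))
    (hPc : ∀ u ∈ E₁, P (B (u - P u) (u - P u)) = 0) {h y : E} (hh : h ∈ E₁)
    (hy : y = nilEval N (bernoulliPowerSeries K) z (P (nilEval N (PowerSeries.exp K) z h)))
    (hZ : dualEnd z (B.flip y) ^ N = 0) :
    (nilEval N (bernoulliPowerSeries K) (dualEnd z (B.flip y)) (P.prodMap P
      (nilEval N (PowerSeries.exp K) (dualEnd z (B.flip y)) (-(2⁻¹ : K) • B h h, h)))).1 = 0 := by
  have hz := pow_eq_zero_of_dualEnd hZ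
  set Z := dualEnd z (B.flip y) with hZdef
  set J := expSubOneDiv K
  set g := nilEval N (PowerSeries.exp K) z h with hg
  have hgE : g ∈ E₁ := nilEval_mem _ hB.stable hh
  have hyE : y ∈ E₁ := by
    rw [hy]; exact nilEval_mem _ hB.stable (hP₁ _ hgE)
  have hJy : nilEval N J z y = P g := by
    rw [hy, ← nilEval_mul _ _ hz, mul_comm, bernoulli_mul_expSubOneDiv, nilEval_one hN]
  set w := nilEval N (bernoulliPowerSeries K) Z (P.prodMap P
      (nilEval N (PowerSeries.exp K) Z (-(2⁻¹ : K) • B h h, h))) with hw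
  have hw2 : w.2 = y := by
    rw [hw, nilEval_dualEnd_snd, LinearMap.prodMap_apply, nilEval_dualEnd_snd, hy]
  have hJw : nilEval N J Z w = P.prodMap P
      (nilEval N (PowerSeries.exp K) Z (-(2⁻¹ : K) • B h h, h)) := by
    rw [hw, ← nilEval_mul _ _ hZ, mul_comm, bernoulli_mul_expSubOneDiv, nilEval_one hN]
  have hJw1 := congrArg Prod.fst hJw
  rw [LinearMap.prodMap_apply, nilEval_dualEnd_fst, nilEval_dualEnd_fst N (PowerSeries.exp K), hw2,
    hB.expSubOneDiv_dualEnd hyE hZ, hB.exp_dualEnd hh hyE hZ, map_smul, hB.exp_bracket hh hh,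
    ← hg, hJy] at hJw1
  have hw1 : nilEval N J z w.1 = 0 := by
    rw [eq_sub_of_add_eq hJw1]
    have h1 := hPc g hgE
    simp only [map_sub, LinearMap.sub_apply, hB.symm (P g) (hP₁ g hgE) g hgE, hPP g hgE] at h1
    have h2 : P (B g (P g)) = (2⁻¹ : K) • (P (B g g) + B (P g) (P g)) := by
      rw [eq_inv_smul_iff₀ two_ne_zero, two_smul]
      rw [← sub_eq_zero, ← neg_eq_zero, ← h1]
      abel
    simp only [map_add, map_smul, h2]
    module
  rw [← nilEval_one hN z w.1, ← bernoulli_mul_expSubOneDiv, nilEval_mul _ _ hz, hw1, map_zero]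

end IsNilpotentDerivation

end NilpotentCalculus

/-! ### The graded Lie algebra of families -/

section FamilyBracket

variable {K M V : Type*} [Field K] [AddCommGroup M] [Module K M] [AddCommGroup V] [Module K V]
  {ℳ : ℤ → Submodule K M} (g : GradedLieStructure ℳ) {ι : Type*} [LinearOrder ι] (d : ι → ℤ)

theorem units_smul_mem {𝒮 : Submodule K M} {x : M} (hx : x ∈ 𝒮) (s : ℤˣ) : s • x ∈ 𝒮 := by
  rw [Units.smul_def]; exact zsmul_mem hx _

theorem map_units_smul {E F : Type*} [AddCommGroup E] [Module K E] [AddCommGroup F] [Module K F]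
    (f : E →ₗ[K] F) (s : ℤˣ) (x : E) : f (s • x) = s • f x := by
  rw [Units.smul_def, map_zsmul, ← Units.smul_def]

theorem map_units_smul_apply {E F G : Type*} [AddCommGroup E] [Module K E] [AddCommGroup F]
    [Module K F] [AddCommGroup G] [Module K G] (B : E →ₗ[K] F →ₗ[K] G) (s : ℤˣ) (x : E) (y : F) :
    B (s • x) y = s • B x y :=
  map_units_smul (B.flip y) s x

theorem isFamily_convBilin {a b : ℤ} {X Y : Finset ι → M} (hX : IsFamily d ℳ a X)
    (hY : IsFamily d ℳ b Y) (e : ℤ) :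
    IsFamily d ℳ (a + b) (convBilin d e g.bracket X Y) := by
  intro U
  rw [convBilin_apply]
  refine Submodule.sum_mem _ fun T hT => units_smul_mem ?_ _
  have h := g.bracket_mem (hX (U \ T)) (hY T)
  have hU : degOn d U = degOn d (U \ T) + degOn d T := by
    rw [← degOn_union d Finset.sdiff_disjoint,
      Finset.sdiff_union_of_subset (Finset.mem_powerset.1 hT)]
  rw [hU, add_add_add_comm]
  exact h

theorem convBilin_skew {a b : ℤ} {X Y : Finset ι → M} (hX : IsFamily d ℳ a X)
    (hY : IsFamily d ℳ b Y) :
    convBilin d b g.bracket X Y = -((a * b).negOnePow • convBilin d a g.bracket Y X) := by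
  funext U
  simp only [Pi.neg_apply, Pi.smul_apply, convBilin_apply, Finset.smul_sum, ← Finset.sum_neg_distrib]
  refine Finset.sum_bij' (fun T _ => U \ T) (fun T _ => U \ T) ?_ ?_ ?_ ?_ ?_
  · intro T _; exact Finset.mem_powerset.2 Finset.sdiff_subset
  · intro T _; exact Finset.mem_powerset.2 Finset.sdiff_subset
  · intro T hT; exact Finset.sdiff_sdiff_eq_self (Finset.mem_powerset.1 hT)
  · intro T hT; exact Finset.sdiff_sdiff_eq_self (Finset.mem_powerset.1 hT)
  · intro T hT
    rw [Finset.sdiff_sdiff_eq_self (Finset.mem_powerset.1 hT),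
      g.bracket_skew (hX (U \ T)) (hY T), smul_neg, smul_smul, smul_smul,
      koszulPair_comm d Finset.sdiff_disjoint]
    congr 2
    have h : ((degOn d (U \ T) + a) * (degOn d T + b)).negOnePow =
        (degOn d (U \ T) * degOn d T).negOnePow * (b * degOn d (U \ T)).negOnePow *
        ((a * degOn d T).negOnePow * (a * b).negOnePow) := by
      simp only [← Int.negOnePow_add]
      congr 1
      ring
    rw [h]
    have h1 := Int.units_mul_self (degOn d (U \ T) * degOn d T).negOnePow
    have h2 := Int.units_mul_self (b * degOn d (U \ T)).negOnePow
    calc _ = ((degOn d (U \ T) * degOn d T).negOnePow * (degOn d (U \ T) * degOn d T).negOnePow) *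
          ((b * degOn d (U \ T)).negOnePow * (b * degOn d (U \ T)).negOnePow) *
          ((a * b).negOnePow * (koszulPair d T (U \ T) * (a * degOn d T).negOnePow)) := by ac_rfl
      _ = _ := by rw [h1, h2, one_mul, one_mul]

theorem sum_powerset_sdiff_assoc {A : Type*} [AddCommMonoid A] (U : Finset ι)
    (F : Finset ι → Finset ι → Finset ι → A) :
    ∑ T ∈ U.powerset, ∑ C ∈ T.powerset, F (U \ T) (T \ C) C =
      ∑ C ∈ U.powerset, ∑ B ∈ (U \ C).powerset, F ((U \ C) \ B) B C := by
  rw [Finset.sum_sigma', Finset.sum_sigma']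
  refine Finset.sum_bij' (fun x _ => ⟨x.2, x.1 \ x.2⟩) (fun x _ => ⟨x.2 ∪ x.1, x.1⟩) ?_ ?_ ?_ ?_ ?_
  · rintro ⟨T, C⟩ h
    simp only [Finset.mem_sigma, Finset.mem_powerset] at h ⊢
    exact ⟨h.2.trans h.1, Finset.sdiff_subset_sdiff h.1 subset_rfl⟩
  · rintro ⟨C, B⟩ h
    simp only [Finset.mem_sigma, Finset.mem_powerset] at h ⊢
    exact ⟨Finset.union_subset (h.2.trans Finset.sdiff_subset) h.1, Finset.subset_union_right⟩
  · rintro ⟨T, C⟩ h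
    simp only [Finset.mem_sigma, Finset.mem_powerset] at h
    simp [Finset.sdiff_union_of_subset h.2]
  · rintro ⟨C, B⟩ h
    simp only [Finset.mem_sigma, Finset.mem_powerset] at h
    have : Disjoint B C := Finset.disjoint_of_subset_left h.2 Finset.sdiff_disjoint
    simp [Finset.union_sdiff_cancel_right this]
  · rintro ⟨T, C⟩ h
    simp only [Finset.mem_sigma, Finset.mem_powerset] at h
    congr 1
    ext x
    have := @h.2 x
    simp only [Finset.mem_sdiff]
    tauto

theorem sum_powerset_sdiff_swap {A : Type*} [AddCommMonoid A] (U : Finset ι)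
    (F : Finset ι → Finset ι → Finset ι → A) :
    ∑ T ∈ U.powerset, ∑ C ∈ T.powerset, F (T \ C) (U \ T) C =
      ∑ C ∈ U.powerset, ∑ B ∈ (U \ C).powerset, F ((U \ C) \ B) B C := by
  rw [Finset.sum_sigma', Finset.sum_sigma']
  refine Finset.sum_bij' (fun x _ => ⟨x.2, U \ x.1⟩) (fun x _ => ⟨U \ x.2, x.1⟩) ?_ ?_ ?_ ?_ ?_
  · rintro ⟨T, C⟩ h
    simp only [Finset.mem_sigma, Finset.mem_powerset] at h ⊢
    exact ⟨h.2.trans h.1, Finset.sdiff_subset_sdiff subset_rfl h.2⟩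
  · rintro ⟨C, B⟩ h
    simp only [Finset.mem_sigma, Finset.mem_powerset] at h ⊢
    refine ⟨Finset.sdiff_subset, fun x hx => Finset.mem_sdiff.2 ⟨h.1 hx, fun hB => ?_⟩⟩
    exact (Finset.mem_sdiff.1 (h.2 hB)).2 hx
  · rintro ⟨T, C⟩ h
    simp only [Finset.mem_sigma, Finset.mem_powerset] at h
    simp [Finset.inter_eq_right.2 h.1]
  · rintro ⟨C, B⟩ h
    simp only [Finset.mem_sigma, Finset.mem_powerset] at h
    simp [Finset.inter_eq_right.2 (h.2.trans Finset.sdiff_subset)]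
  · rintro ⟨T, C⟩ h
    simp only [Finset.mem_sigma, Finset.mem_powerset] at h
    congr 1
    ext x
    have := @h.1 x
    simp only [Finset.mem_sdiff]
    tauto

theorem convBilin_jacobi {a b c : ℤ} {X Y Z : Finset ι → M} (hX : IsFamily d ℳ a X)
    (hY : IsFamily d ℳ b Y) (hZ : IsFamily d ℳ c Z) :
    convBilin d (b + c) g.bracket X (convBilin d c g.bracket Y Z) =
      convBilin d c g.bracket (convBilin d b g.bracket X Y) Z +
        (a * b).negOnePow • convBilin d (a + c) g.bracket Y (convBilin d c g.bracket X Z) := by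
  funext U
  simp only [Pi.add_apply, Pi.smul_apply, convBilin_apply]
  obtain ⟨F₁, hF₁⟩ : ∃ F : Finset ι → Finset ι → Finset ι → M, F = fun A B C => ((koszulPair d A B * koszulPair d A C * ((b + c) * degOn d A).negOnePow) *
        (koszulPair d B C * (c * degOn d B).negOnePow)) •
          g.bracket (X A) (g.bracket (Y B) (Z C)) :=
    ⟨_, rfl⟩
  obtain ⟨F₂, hF₂⟩ : ∃ F : Finset ι → Finset ι → Finset ι → M, F = fun A B C => ((koszulPair d B A * koszulPair d B C * ((a + c) * degOn d B).negOnePow) *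
        (koszulPair d A C * (c * degOn d A).negOnePow)) •
          g.bracket (Y B) (g.bracket (X A) (Z C)) :=
    ⟨_, rfl⟩
  -- both iterated brackets with the family `Z` innermost, as sums over `U = A ⊔ B ⊔ C`
  have h1 : ∀ T ∈ U.powerset,
      (koszulPair d (U \ T) T * ((b + c) * degOn d (U \ T)).negOnePow) • g.bracket (X (U \ T))
        (∑ C ∈ T.powerset, (koszulPair d (T \ C) C * (c * degOn d (T \ C)).negOnePow) •
          g.bracket (Y (T \ C)) (Z C)) = ∑ C ∈ T.powerset,
      F₁ (U \ T) (T \ C) C := by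
    intro T hT
    rw [map_sum, Finset.smul_sum]
    refine Finset.sum_congr rfl fun C hC => ?_
    simp only [hF₁, map_units_smul, smul_smul]
    congr 3
    rw [← koszulPair_union_right d _ Finset.sdiff_disjoint,
      Finset.sdiff_union_of_subset (Finset.mem_powerset.1 hC)]
  have h2 : ∀ T ∈ U.powerset,
      (koszulPair d (U \ T) T * ((a + c) * degOn d (U \ T)).negOnePow) • g.bracket (Y (U \ T))
        (∑ C ∈ T.powerset, (koszulPair d (T \ C) C * (c * degOn d (T \ C)).negOnePow) •
          g.bracket (X (T \ C)) (Z C)) = ∑ C ∈ T.powerset,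
      F₂ (T \ C) (U \ T) C := by
    intro T hT
    rw [map_sum, Finset.smul_sum]
    refine Finset.sum_congr rfl fun C hC => ?_
    simp only [hF₂, map_units_smul, smul_smul]
    congr 3
    rw [← koszulPair_union_right d _ Finset.sdiff_disjoint,
      Finset.sdiff_union_of_subset (Finset.mem_powerset.1 hC)]
  rw [Finset.sum_congr rfl h1, Finset.sum_congr rfl h2,
    sum_powerset_sdiff_assoc U F₁, sum_powerset_sdiff_swap U F₂, Finset.smul_sum, ← Finset.sum_add_distrib]
  refine Finset.sum_congr rfl fun C hC => ?_
  rw [map_sum, LinearMap.sum_apply, Finset.smul_sum, Finset.smul_sum, ← Finset.sum_add_distrib]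
  refine Finset.sum_congr rfl fun B hB => ?_
  have hAB : Disjoint ((U \ C) \ B) B := Finset.sdiff_disjoint
  have hU : U \ C = (U \ C) \ B ∪ B :=
    (Finset.sdiff_union_of_subset (Finset.mem_powerset.1 hB)).symm
  have hk : koszulPair d (U \ C) C = koszulPair d ((U \ C) \ B) C * koszulPair d B C := by
    conv_lhs => rw [hU]
    exact koszulPair_union_left d C hAB
  have hd : degOn d (U \ C) = degOn d ((U \ C) \ B) + degOn d B := by
    conv_lhs => rw [hU]
    exact degOn_union d hAB
  simp only [hF₁, hF₂]
  rw [hk, hd]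
  generalize (U \ C) \ B = A at hAB
  rw [g.jacobi (hX A) (hY B) (hZ C), smul_add]
  rw [map_units_smul, LinearMap.smul_apply]
  simp only [smul_smul]
  congr 1
  · congr 1
    rw [add_mul, mul_add, Int.negOnePow_add, Int.negOnePow_add]
    ac_rfl
  · congr 1
    have h : ((degOn d A + a) * (degOn d B + b)).negOnePow = (degOn d B * degOn d A).negOnePow *
        (b * degOn d A).negOnePow * ((a * degOn d B).negOnePow * (a * b).negOnePow) := by
      simp only [← Int.negOnePow_add]
      congr 1
      ring
    rw [h, koszulPair_comm d hAB.symm, add_mul, add_mul, Int.negOnePow_add, Int.negOnePow_add]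
    have h1 := Int.units_mul_self (b * degOn d A).negOnePow
    have h2 := Int.units_mul_self (degOn d B * degOn d A).negOnePow
    rw [koszulPair_comm d hAB, mul_comm (degOn d A)]
    generalize (b * degOn d A).negOnePow = s1 at *
    generalize (degOn d B * degOn d A).negOnePow = s2 at *
    calc _ = (s1 * s1) * (s2 * s2) * (koszulPair d B A * koszulPair d A C *
          (c * degOn d A).negOnePow * (koszulPair d B C * (c * degOn d B).negOnePow) *
          ((a * degOn d B).negOnePow * (a * b).negOnePow)) := by ac_rfl
      _ = s2 * s2 * (koszulPair d B A * koszulPair d A C *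
          (c * degOn d A).negOnePow * (koszulPair d B C * (c * degOn d B).negOnePow) *
          ((a * degOn d B).negOnePow * (a * b).negOnePow)) := by rw [h1, one_mul]
      _ = _ := by ac_rfl

theorem convBilin_congr_degree {E F G : Type*} [AddCommGroup E] [Module K E] [AddCommGroup F]
    [Module K F] [AddCommGroup G] [Module K G] {e e' : ℤ} (h : e.negOnePow = e'.negOnePow)
    (B : E →ₗ[K] F →ₗ[K] G) : convBilin d e B = convBilin d e' B := by
  ext X Y U
  rw [convBilin_apply, convBilin_apply]
  refine Finset.sum_congr rfl fun T _ => ?_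
  congr 2
  rcases Int.even_or_odd (degOn d (U \ T)) with hS | hS
  · rw [Int.negOnePow_even _ (hS.mul_left e), Int.negOnePow_even _ (hS.mul_left e')]
  · obtain ⟨k, hk⟩ := hS
    have : ∀ e : ℤ, (e * degOn d (U \ T)).negOnePow = e.negOnePow := by
      intro e
      rw [hk, mul_add, mul_one, Int.negOnePow_add, Int.negOnePow_even _ ⟨e * k, by ring⟩, one_mul]
    rw [this, this, h]

/-- Families which vanish on sets with fewer than `a` elements. -/
def familiesFrom (K M : Type*) [Field K] [AddCommGroup M] [Module K M] (ι : Type*) (a : ℕ) :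
    Submodule K (Finset ι → M) where
  carrier := {X | ∀ U, U.card < a → X U = 0}
  zero_mem' _ _ := rfl
  add_mem' hX hY U hU := by simp [hX U hU, hY U hU]
  smul_mem' c X hX U hU := by simp [hX U hU]

theorem mem_familiesFrom_zero (X : Finset ι → M) : X ∈ familiesFrom K M ι 0 :=
  fun _ h => absurd h (Nat.not_lt_zero _)

theorem mem_familiesFrom_one {X : Finset ι → M} (hX : X ∅ = 0) : X ∈ familiesFrom K M ι 1 :=
  fun U h => by
    rw [Finset.card_eq_zero.1 (Nat.lt_one_iff.1 h), hX]

theorem eq_zero_of_mem_familiesFrom [Fintype ι] {N : ℕ} (hN : Fintype.card ι < N)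
    {X : Finset ι → M} (hX : X ∈ familiesFrom K M ι N) : X = 0 :=
  funext fun U => hX U (lt_of_le_of_lt (Finset.card_le_univ U) hN)

theorem convBilin_mem_familiesFrom {E F G : Type*} [AddCommGroup E] [Module K E] [AddCommGroup F]
    [Module K F] [AddCommGroup G] [Module K G] (e : ℤ) (B : E →ₗ[K] F →ₗ[K] G) {a b : ℕ}
    {X : Finset ι → E} {Y : Finset ι → F} (hX : X ∈ familiesFrom K E ι a)
    (hY : Y ∈ familiesFrom K F ι b) : convBilin d e B X Y ∈ familiesFrom K G ι (a + b) := by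
  intro U hU
  rw [convBilin_apply]
  refine Finset.sum_eq_zero fun T hT => ?_
  have h := Finset.card_sdiff_add_card_eq_card (Finset.mem_powerset.1 hT)
  by_cases h1 : (U \ T).card < a
  · rw [hX _ h1]; simp
  · rw [hY T (by omega)]; simp

/-- The families of degree `e`. -/
def homogeneousFamilies (ℳ : ℤ → Submodule K M) (e : ℤ) : Submodule K (Finset ι → M) where
  carrier := {X | IsFamily d ℳ e X}
  zero_mem' _ := zero_mem _
  add_mem' hX hY U := add_mem (hX U) (hY U)
  smul_mem' c _ hX U := Submodule.smul_mem _ c (hX U)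

/-- The right adjoint action `z = [·, x]` of a family of degree zero. -/
noncomputable def rightAd (x : Finset ι → M) : Module.End K (Finset ι → M) :=
  (convBilin d 0 g.bracket).flip x

theorem rightAd_pow_mem_familiesFrom {x : Finset ι → M} (hx : x ∅ = 0) (j : ℕ) {a : ℕ}
    {X : Finset ι → M} (hX : X ∈ familiesFrom K M ι a) :
    (rightAd g d x ^ j) X ∈ familiesFrom K M ι (a + j) := by
  induction j with
  | zero => simpa using hX
  | succ j ih =>
    rw [pow_succ', ← Nat.add_assoc]
    exact convBilin_mem_familiesFrom d 0 g.bracket ih (mem_familiesFrom_one hx)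

/-- The operator `z + ε [·, y]`. -/
noncomputable def dualAd (x y : Finset ι → M) : Module.End K ((Finset ι → M) × (Finset ι → M)) :=
  dualEnd (rightAd g d x) ((convBilin d 1 g.bracket).flip y)

theorem dualAd_pow_mem_familiesFrom {x y : Finset ι → M} (hx : x ∅ = 0) (hy : y ∅ = 0) (j : ℕ)
    {a : ℕ} {u : (Finset ι → M) × (Finset ι → M)} (hu1 : u.1 ∈ familiesFrom K M ι a)
    (hu2 : u.2 ∈ familiesFrom K M ι a) :
    ((dualAd g d x y ^ j) u).1 ∈ familiesFrom K M ι (a + j) ∧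
      ((dualAd g d x y ^ j) u).2 ∈ familiesFrom K M ι (a + j) := by
  induction j with
  | zero => simpa using ⟨hu1, hu2⟩
  | succ j ih =>
    rw [pow_succ', Module.End.mul_apply, ← Nat.add_assoc]
    have hx' := mem_familiesFrom_one (K := K) hx
    have hy' := mem_familiesFrom_one (K := K) hy
    exact ⟨add_mem (convBilin_mem_familiesFrom d 0 g.bracket ih.1 hx')
      (convBilin_mem_familiesFrom d 1 g.bracket ih.2 hy'),
      convBilin_mem_familiesFrom d 0 g.bracket ih.2 hx'⟩

theorem dualAd_pow_eq_zero [Fintype ι] {N : ℕ} (hN : Fintype.card ι < N) {x y : Finset ι → M}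
    (hx : x ∅ = 0) (hy : y ∅ = 0) : dualAd g d x y ^ N = 0 := by
  refine LinearMap.ext fun u => ?_
  have h := dualAd_pow_mem_familiesFrom g d hx hy N (mem_familiesFrom_zero u.1)
    (mem_familiesFrom_zero u.2)
  rw [Nat.zero_add] at h
  exact Prod.ext (eq_zero_of_mem_familiesFrom hN h.1) (eq_zero_of_mem_familiesFrom hN h.2)

/-- `[·, x]` is a nilpotent derivation of the bracket of families of degree one. -/
theorem isNilpotentDerivation_rightAd [CharZero K] [Fintype ι] {N : ℕ} (hN : Fintype.card ι < N)
    {x : Finset ι → M} (hx : IsFamily d ℳ 0 x) (hx0 : x ∅ = 0) :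
    IsNilpotentDerivation N (convBilin d 1 g.bracket) (rightAd g d x)
      (homogeneousFamilies d ℳ 1) where
  stable u hu := by
    have := isFamily_convBilin g d hu hx 0
    rwa [add_zero] at this
  symm u hu w hw := by
    rw [convBilin_skew g d hu hw]
    simp
  leibniz u hu w hw := by
    have h1 := convBilin_jacobi g d hu hw hx
    have h2 : IsFamily d ℳ 1 (convBilin d 0 g.bracket u x) := by
      have := isFamily_convBilin g d hu hx 0
      rwa [add_zero] at this
    have h3 := convBilin_skew g d hw h2
    simp only [add_zero, mul_one, Int.negOnePow_one, Units.neg_smul, one_smul, neg_neg] at h1 h3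
    rw [h3] at h1
    simp only [rightAd, LinearMap.flip_apply]
    rw [h1]
    abel
  vanish u w a b hab := by
    have h1 := rightAd_pow_mem_familiesFrom g d hx0 a (mem_familiesFrom_zero u)
    have h2 := rightAd_pow_mem_familiesFrom g d hx0 b (mem_familiesFrom_zero w)
    refine eq_zero_of_mem_familiesFrom (K := K) (N := 0 + a + (0 + b)) (by omega) ?_
    exact convBilin_mem_familiesFrom d 1 g.bracket h1 h2

/-- The Jacobi identity `[[h, h], h] = 0` for a family of degree one. -/
theorem convBilin_cube_eq_zero [CharZero K] {h : Finset ι → M} (hh : IsFamily d ℳ 1 h) :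
    convBilin d 1 g.bracket (convBilin d 1 g.bracket h h) h = 0 ∧
      convBilin d 0 g.bracket h (convBilin d 1 g.bracket h h) = 0 := by
  have h1 := convBilin_jacobi g d hh hh hh
  have h2 := convBilin_skew g d (isFamily_convBilin g d hh hh 1) hh
  rw [convBilin_congr_degree d (e := 1 + 1) (e' := 0) (by decide)] at h1 h2
  rw [show ((1 + 1) * 1 : ℤ).negOnePow = 1 by decide, one_smul] at h2
  rw [show (1 * 1 : ℤ).negOnePow = -1 by decide, Units.neg_smul, one_smul, h2] at h1
  set A := convBilin d 0 g.bracket h (convBilin d 1 g.bracket h h)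
  have h3 : (3 : K) • A = 0 := by
    have : A + A + A = 0 := by
      nth_rewrite 1 [h1]; abel
    rw [← this]; module
  have h4 : A = 0 := (smul_eq_zero.1 h3).resolve_left three_ne_zero
  exact ⟨by rw [h2, h4, neg_zero], h4⟩

/-! ### Nested brackets as multilinear maps -/

variable (κ ν : V →ₗ[K] M)

/-- `f(v₀, …, v_{k-1}), v_k ↦ [f(v₀, …, v_{k-1}), ν v_k]`. -/
noncomputable def bracketSnoc {k : ℕ} (f : MultilinearMap K (fun _ : Fin k => V) M) :
    MultilinearMap K (fun _ : Fin (k + 1) => V) M :=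
  ((g.bracket.compl₂ ν).compMultilinearMap f).uncurryRight

theorem bracketSnoc_apply {k : ℕ} (f : MultilinearMap K (fun _ : Fin k => V) M)
    (v : Fin (k + 1) → V) :
    bracketSnoc g ν f v = (g.bracket.compl₂ ν) (f (Fin.init v)) (v (Fin.last k)) := rfl

/-- A linear map, as a multilinear map in one variable. -/
noncomputable def unary : MultilinearMap K (fun _ : Fin 1 => V) M :=
  MultilinearMap.ofSubsingleton K V M (0 : Fin 1) κ

@[simp]
theorem unary_apply (v : Fin 1 → V) : unary κ v = κ (v 0) := rfl

/-- `[⋯[κ v₀, ν v₁]⋯, ν v_j]`. -/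
noncomputable def nestedMul : ∀ j : ℕ, MultilinearMap K (fun _ : Fin (j + 1) => V) M
  | 0 => unary κ
  | j + 1 => bracketSnoc g ν (nestedMul j)

/-- `[⋯[P [⋯[κ v₀, ν v₁]⋯, ν v_k], ν v_{k+1}]⋯, ν v_m]`, and zero if `m < k`. -/
noncomputable def nestedProjMul (P : M →ₗ[K] M) (k : ℕ) :
    ∀ m : ℕ, MultilinearMap K (fun _ : Fin (m + 1) => V) M
  | 0 => if k = 0 then P.compMultilinearMap (nestedMul g κ ν 0) else 0
  | m + 1 => if k = m + 1 then P.compMultilinearMap (nestedMul g κ ν (m + 1)) else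
      bracketSnoc g ν (nestedProjMul P k m)

variable [Fintype ι]

theorem decomps_one (U : Finset ι) : decomps 1 U = {fun _ => U} := by
  ext P
  rw [mem_decomps, Finset.mem_singleton]
  constructor
  · rintro ⟨-, h⟩
    funext i
    rw [← h, Subsingleton.elim i 0]
    simp
  · rintro rfl
    exact ⟨fun i j h => absurd (Subsingleton.elim i j) h, by simp⟩

theorem conv_unary (e : Fin 1 → ℤ) (X : Fin 1 → Finset ι → V) (U : Finset ι) :
    conv d e (unary κ) X U = κ (X 0 U) := by
  have h : (Finset.univ.filter fun p : Fin 1 × Fin 1 => p.1 < p.2) = ∅ := by decide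
  rw [conv, decomps_one, Finset.sum_singleton, unary_apply, blockSign]
  simp [h]

/-- The value and the derivative of the extension of a multilinear map to families. -/
noncomputable def convPair {k : ℕ} (f : (Fin k → V) → M) (X Y : Finset ι → V) :
    (Finset ι → M) × (Finset ι → M) :=
  (convDeriv d f X Y, conv d (fun _ => 0) f (fun _ => X))

theorem convPair_bracketSnoc {k : ℕ} (f : MultilinearMap K (fun _ : Fin k => V) M)
    (X Y : Finset ι → V) :
    convPair d (bracketSnoc g ν f) X Y =
      dualAd g d (fun S => ν (X S)) (fun S => ν (Y S)) (convPair d f X Y) := by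
  have h : (bracketSnoc g ν f : (Fin (k + 1) → V) → M) =
      fun v => (g.bracket.compl₂ ν) (f (Fin.init v)) (v (Fin.last k)) := rfl
  refine Prod.ext ?_ ?_
  · funext U
    rw [convPair, h]
    exact convDeriv_snoc d _ _ X Y U
  · funext U
    rw [convPair, h]
    exact conv_snoc d (fun _ => 0) _ _ (fun _ => X) U

theorem convPair_unary (X Y : Finset ι → V) :
    convPair d (unary κ) X Y = (fun S => κ (Y S), fun S => κ (X S)) := by
  refine Prod.ext ?_ ?_
  · funext U
    simp only [convPair, convDeriv, Fin.sum_univ_one, Fin.isValue, conv_unary,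
      Function.update_self]
  · funext U
    simp only [convPair, conv_unary]

theorem convPair_comp (P : M →ₗ[K] M) {k : ℕ} (f : MultilinearMap K (fun _ : Fin k => V) M)
    (X Y : Finset ι → V) :
    convPair d (P.compMultilinearMap f) X Y =
      (P.compLeft (Finset ι)).prodMap (P.compLeft (Finset ι)) (convPair d f X Y) := by
  refine Prod.ext ?_ ?_
  · funext U
    exact (map_convDeriv d f P X Y U).symm
  · funext U
    exact (map_conv d (fun _ => 0) f P (fun _ => X) U).symm

theorem convPair_zero {k : ℕ} (X Y : Finset ι → V) :
    convPair d (fun _ : Fin k → V => (0 : M)) X Y = 0 := by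
  refine Prod.ext ?_ ?_ <;> funext U <;> simp [convPair, convDeriv, conv]

theorem convPair_add {k : ℕ} (f f' : (Fin k → V) → M) (X Y : Finset ι → V) :
    convPair d (fun v => f v + f' v) X Y = convPair d f X Y + convPair d f' X Y := by
  refine Prod.ext ?_ ?_ <;> funext U <;> simp [convPair, convDeriv, conv, Finset.sum_add_distrib]

theorem convPair_smul {k : ℕ} (c : K) (f : (Fin k → V) → M) (X Y : Finset ι → V) :
    convPair d (fun v => c • f v) X Y = c • convPair d f X Y := by
  refine Prod.ext ?_ ?_ <;> funext U <;>
    simp only [convPair, convDeriv, conv, Finset.smul_sum, Prod.smul_mk, Pi.smul_apply, smul_comm c]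

theorem convPair_sum {k : ℕ} {α : Type*} (s : Finset α) (f : α → (Fin k → V) → M)
    (X Y : Finset ι → V) :
    convPair d (fun v => ∑ i ∈ s, f i v) X Y = ∑ i ∈ s, convPair d (f i) X Y := by
  classical
  induction s using Finset.induction_on with
  | empty => simp [convPair_zero]
  | insert a s ha ih => simp only [Finset.sum_insert ha, convPair_add, ih]

theorem convPair_nestedMul (X Y : Finset ι → V) (j : ℕ) :
    convPair d (nestedMul g κ ν j) X Y =
      (dualAd g d (fun S => ν (X S)) (fun S => ν (Y S)) ^ j)
        (fun S => κ (Y S), fun S => κ (X S)) := by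
  induction j with
  | zero => exact convPair_unary d κ X Y
  | succ j ih =>
    rw [pow_succ', Module.End.mul_apply, ← ih]
    exact convPair_bracketSnoc g d ν _ X Y

theorem convPair_nestedProjMul (P : M →ₗ[K] M) (X Y : Finset ι → V) (k m : ℕ) :
    convPair d (nestedProjMul g κ ν P k m) X Y = if k ≤ m then
      (dualAd g d (fun S => ν (X S)) (fun S => ν (Y S)) ^ (m - k))
        ((P.compLeft (Finset ι)).prodMap (P.compLeft (Finset ι))
          ((dualAd g d (fun S => ν (X S)) (fun S => ν (Y S)) ^ k)
            (fun S => κ (Y S), fun S => κ (X S)))) else 0 := by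
  induction m with
  | zero =>
    rw [nestedProjMul]
    split_ifs with h h' h'
    · subst h
      rw [convPair_comp, convPair_nestedMul]; rfl
    · omega
    · omega
    · exact convPair_zero d X Y
  | succ m ih =>
    rw [nestedProjMul]
    split_ifs with h h' h'
    · rw [convPair_comp, convPair_nestedMul, ← h, Nat.sub_self]; rfl
    · omega
    · rw [convPair_bracketSnoc, ih, if_pos (by omega), show m + 1 - k = (m - k) + 1 by omega,
        pow_succ', Module.End.mul_apply]
    · rw [convPair_bracketSnoc, ih, if_neg (by omega), map_zero]

end FamilyBracket

/-! ### Internal gradings -/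

section Grading

variable {K V W E : Type*} [Field K] [AddCommGroup V] [Module K V] [AddCommGroup W] [Module K W]
  [AddCommGroup E] [Module K E]

/-- The projection of a graded space onto its component of degree `i`. -/
noncomputable def homComponent {𝒱 : ℤ → Submodule K V} (h𝒱 : DirectSum.IsInternal 𝒱) (i : ℤ) :
    V →ₗ[K] V :=
  (𝒱 i).subtype ∘ₗ DirectSum.component K ℤ (fun i => 𝒱 i) i ∘ₗ
    (LinearEquiv.ofBijective (DirectSum.coeLinearMap 𝒱)
      (show Function.Bijective (DirectSum.coeLinearMap 𝒱) from h𝒱)).symm.toLinearMap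

variable {𝒱 : ℤ → Submodule K V} (h𝒱 : DirectSum.IsInternal 𝒱)

theorem homComponent_mem (i : ℤ) (v : V) : homComponent h𝒱 i v ∈ 𝒱 i := by
  simp [homComponent]

theorem homComponent_of_mem {i j : ℤ} {v : V} (hv : v ∈ 𝒱 j) :
    homComponent h𝒱 i v = if j = i then v else 0 := by
  have h : (LinearEquiv.ofBijective (DirectSum.coeLinearMap 𝒱)
      (show Function.Bijective (DirectSum.coeLinearMap 𝒱) from h𝒱)).symm v =
      DirectSum.lof K ℤ (fun i => 𝒱 i) j ⟨v, hv⟩ := by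
    rw [LinearEquiv.symm_apply_eq]
    simp
  simp only [homComponent, LinearMap.comp_apply, LinearEquiv.coe_coe, h]
  split_ifs with hij
  · subst hij
    rw [DirectSum.component.lof_self]; rfl
  · rw [DirectSum.component.of, dif_neg hij]; simp

include h𝒱 in
/-- Induction on the homogeneous decomposition of a vector. -/
theorem induction_homogeneous {p : V → Prop} (hom : ∀ i, ∀ v ∈ 𝒱 i, p v)
    (add : ∀ v w, p v → p w → p (v + w)) (v : V) : p v := by
  have hv : v ∈ ⨆ i, 𝒱 i := by
    rw [h𝒱.submodule_iSup_eq_top]; trivial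
  induction hv using Submodule.iSup_induction' with
  | mem i x hx => exact hom i x hx
  | zero => exact hom 0 0 (zero_mem _)
  | add x y _ _ hx hy => exact add x y hx hy

theorem exists_eq_sum_homComponent (v : V) : ∃ s : Finset ℤ, v = ∑ i ∈ s, homComponent h𝒱 i v := by
  classical
  set x := (LinearEquiv.ofBijective (DirectSum.coeLinearMap 𝒱)
      (show Function.Bijective (DirectSum.coeLinearMap 𝒱) from h𝒱)).symm v with hx
  refine ⟨DFinsupp.support x, ?_⟩
  have h : DirectSum.coeLinearMap 𝒱 x = v :=
    (LinearEquiv.ofBijective (DirectSum.coeLinearMap 𝒱)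
      (show Function.Bijective (DirectSum.coeLinearMap 𝒱) from h𝒱)).apply_symm_apply v
  conv_lhs => rw [← h, ← DirectSum.sum_support_of x, map_sum]
  refine Finset.sum_congr rfl fun i _ => ?_
  rw [DirectSum.coeLinearMap_of]; rfl

/-- A spanning family of subspaces which is told apart by linear maps `p j` is a grading. -/
theorem isInternal_of_detect {𝒲 : ℤ → Submodule K W} (p : ℤ → W →ₗ[K] E)
    (h0 : ∀ i j, i ≠ j → ∀ w ∈ 𝒲 i, p j w = 0) (h1 : ∀ i, ∀ w ∈ 𝒲 i, p i w = 0 → w = 0)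
    (htop : ∀ w, w ∈ ⨆ i, 𝒲 i) : DirectSum.IsInternal 𝒲 := by
  refine DirectSum.isInternal_submodule_of_iSupIndep_of_iSup_eq_top ?_
    (eq_top_iff.2 fun w _ => htop w)
  rw [iSupIndep_def]
  intro i
  rw [Submodule.disjoint_def]
  intro w hw hw'
  refine h1 i w hw ?_
  have : (⨆ j, ⨆ (_ : j ≠ i), 𝒲 j) ≤ LinearMap.ker (p i) :=
    iSup₂_le fun j hj x hx => h0 j i hj x hx
  exact this hw'

include h𝒱 in
theorem isInternal_shift (n : ℤ) : DirectSum.IsInternal (fun i => 𝒱 (i + n)) := by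
  refine isInternal_of_detect (fun j => homComponent h𝒱 (j + n)) ?_ ?_ ?_
  · intro i j hij w hw
    rw [homComponent_of_mem h𝒱 hw, if_neg (by omega)]
  · intro i w hw h
    rwa [homComponent_of_mem h𝒱 hw, if_pos rfl] at h
  · intro w
    refine induction_homogeneous h𝒱 (fun i v hv => ?_) (fun v w hv hw => add_mem hv hw) w
    exact Submodule.mem_iSup_of_mem (i - n) (by rwa [sub_add_cancel])

include h𝒱 in
theorem isInternal_prod {𝒲 : ℤ → Submodule K W} (h𝒲 : DirectSum.IsInternal 𝒲) :
    DirectSum.IsInternal (fun i => (𝒱 i).prod (𝒲 i)) := by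
  refine isInternal_of_detect (fun j => (homComponent h𝒱 j).prodMap (homComponent h𝒲 j)) ?_ ?_ ?_
  · rintro i j hij ⟨v, w⟩ ⟨hv, hw⟩
    simp only [LinearMap.prodMap_apply, homComponent_of_mem h𝒱 hv, homComponent_of_mem h𝒲 hw,
      if_neg hij, Prod.mk_zero_zero]
  · rintro i ⟨v, w⟩ ⟨hv, hw⟩ h
    simpa only [LinearMap.prodMap_apply, homComponent_of_mem h𝒱 hv, homComponent_of_mem h𝒲 hw,
      if_true] using h
  · rintro ⟨v, w⟩
    have h1 : ((v, 0) : V × W) ∈ ⨆ i, (𝒱 i).prod (𝒲 i) :=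
      induction_homogeneous h𝒱 (p := fun v => ((v, 0) : V × W) ∈ ⨆ i, (𝒱 i).prod (𝒲 i))
        (fun i v hv => Submodule.mem_iSup_of_mem i ⟨hv, zero_mem _⟩)
        (fun v w hv hw => by simpa using add_mem hv hw) v
    have h2 : ((0, w) : V × W) ∈ ⨆ i, (𝒱 i).prod (𝒲 i) :=
      induction_homogeneous h𝒲 (p := fun w => ((0, w) : V × W) ∈ ⨆ i, (𝒱 i).prod (𝒲 i))
        (fun i v hv => Submodule.mem_iSup_of_mem i ⟨zero_mem _, hv⟩)
        (fun v w hv hw => by simpa using add_mem hv hw) w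
    simpa using add_mem h1 h2

/-- A submodule which contains the homogeneous components of its elements is graded. -/
theorem isInternal_comap_subtype (S : Submodule K V)
    (hS : ∀ i, ∀ v ∈ S, homComponent h𝒱 i v ∈ S) :
    DirectSum.IsInternal (fun i => (𝒱 i).comap S.subtype) := by
  refine isInternal_of_detect (fun j => homComponent h𝒱 j ∘ₗ S.subtype) ?_ ?_ ?_
  · intro i j hij w hw
    rw [LinearMap.comp_apply, homComponent_of_mem h𝒱 hw, if_neg hij]
  · intro i w hw h
    rw [LinearMap.comp_apply, homComponent_of_mem h𝒱 hw, if_pos rfl] at h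
    exact Subtype.ext h
  · rintro ⟨w, hw⟩
    obtain ⟨s, hs⟩ := exists_eq_sum_homComponent h𝒱 w
    have : (⟨w, hw⟩ : S) = ∑ i ∈ s, ⟨homComponent h𝒱 i w, hS i w hw⟩ := by
      apply Subtype.ext
      rw [AddSubmonoidClass.coe_finsetSum]
      exact hs
    rw [this]
    exact Submodule.sum_mem _ fun i _ =>
      Submodule.mem_iSup_of_mem i (homComponent_mem h𝒱 i w)

theorem map_homComponent {𝒲 : ℤ → Submodule K W} (h𝒲 : DirectSum.IsInternal 𝒲) (T : V →ₗ[K] W)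
    (hT : ∀ i, ∀ v ∈ 𝒱 i, T v ∈ 𝒲 i) (i : ℤ) (v : V) :
    T (homComponent h𝒱 i v) = homComponent h𝒲 i (T v) := by
  refine induction_homogeneous h𝒱
    (p := fun v => T (homComponent h𝒱 i v) = homComponent h𝒲 i (T v))
    (fun j v hv => ?_) (fun v w hv hw => by simp [hv, hw]) v
  rw [homComponent_of_mem h𝒱 hv, homComponent_of_mem h𝒲 (hT j v hv)]
  split_ifs <;> simp

/-- The bilinear map `(v, w) ↦ (-1)^{|v||w|} B(v, w)`. -/
noncomputable def koszulTwist {𝒲 : ℤ → Submodule K W} (h𝒱 : DirectSum.IsInternal 𝒱)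
    (h𝒲 : DirectSum.IsInternal 𝒲) (B : V →ₗ[K] W →ₗ[K] E) : V →ₗ[K] W →ₗ[K] E :=
  B - (2 : K) • B.compl₁₂ (oddPart h𝒱) (oddPart h𝒲)

theorem koszulTwist_of_mem {𝒲 : ℤ → Submodule K W} (h𝒲 : DirectSum.IsInternal 𝒲)
    (B : V →ₗ[K] W →ₗ[K] E) {i j : ℤ} {v : V} {w : W} (hv : v ∈ 𝒱 i) (hw : w ∈ 𝒲 j) :
    koszulTwist h𝒱 h𝒲 B v w = (i * j).negOnePow • B v w := by
  simp only [koszulTwist, LinearMap.sub_apply, LinearMap.smul_apply, LinearMap.compl₁₂_apply]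
  rcases Int.even_or_odd i with hi | hi
  · simp [oddPart_of_even h𝒱 hv hi, Int.negOnePow_even _ (hi.mul_right j)]
  · rcases Int.even_or_odd j with hj | hj
    · simp [oddPart_of_even h𝒲 hw hj, Int.negOnePow_even _ (hj.mul_left i)]
    · rw [oddPart_of_odd h𝒱 hv hi, oddPart_of_odd h𝒲 hw hj, Int.negOnePow_odd _ (hi.mul hj),
        Units.neg_smul, one_smul, two_smul]
      abel

end Grading

/-! ### Derivations and the semidirect product -/

section Derivations

variable {K M : Type*} [Field K] [AddCommGroup M] [Module K M] {ℳ : ℤ → Submodule K M}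
  (g : GradedLieStructure ℳ) (P : M →ₗ[K] M)

/-- The grading of `Der(M/L)`. -/
def relDerGrading (i : ℤ) : Submodule K (relDer g P) := (relDerDeg g P i).comap (relDer g P).subtype

theorem isInternal_relDerGrading : DirectSum.IsInternal (relDerGrading g P) := by
  refine isInternal_of_detect (E := ℤ → M →ₗ[K] M)
    (fun j => LinearMap.pi fun k => (LinearMap.lcomp K M (homComponent g.isInternal k)) ∘ₗ
      (LinearMap.compRight K (homComponent g.isInternal (k + j))) ∘ₗ (relDer g P).subtype) ?_ ?_ ?_
  · intro i j hij D hD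
    funext k
    refine LinearMap.ext fun x => ?_
    have h := hD.1 k _ (homComponent_mem g.isInternal k x)
    simp only [Submodule.subtype_apply] at h
    simp [homComponent_of_mem g.isInternal h, hij]
  · intro i D hD h
    refine Subtype.ext (linearMap_ext_of_homogeneous g.isInternal fun k x hx => ?_)
    have h1 := LinearMap.congr_fun (congrFun h k) x
    have h2 := hD.1 k x hx
    simp only [Submodule.subtype_apply] at h2
    simpa [homComponent_of_mem g.isInternal hx, homComponent_of_mem g.isInternal h2] using h1
  · rintro ⟨D, hD⟩
    refine Submodule.iSup_induction' (relDerDeg g P)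
      (motive := fun D hD => (⟨D, hD⟩ : relDer g P) ∈ ⨆ i, relDerGrading g P i) ?_ ?_ ?_ hD
    · intro i x hx
      exact Submodule.mem_iSup_of_mem i hx
    · exact zero_mem _
    · intro x y hx hy h1 h2
      exact add_mem h1 h2

variable {P}

theorem relDer_apply_mem_ker (D : relDer g P) {x : M} (hx : x ∈ LinearMap.ker P) :
    D.val x ∈ LinearMap.ker P := by
  refine induction_homogeneous (isInternal_relDerGrading g P)
    (p := fun D => D.val x ∈ LinearMap.ker P) (fun i D hD => hD.2.2 x hx) (fun D E h1 h2 => ?_) D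
  exact add_mem h1 h2

theorem comp_mem_relDerDeg {i j : ℤ} {D E : M →ₗ[K] M} (hD : D ∈ relDerDeg g P i)
    (hE : E ∈ relDerDeg g P j) :
    D ∘ₗ E - (i * j).negOnePow • (E ∘ₗ D) ∈ relDerDeg g P (i + j) := by
  refine ⟨fun k x hx => ?_, fun k x hx y => ?_, fun x hx => ?_⟩
  · have h1 := hD.1 _ _ (hE.1 k x hx)
    have h2 := hE.1 _ _ (hD.1 k x hx)
    rw [show k + (i + j) = k + j + i by ring]
    rw [show k + i + j = k + j + i by ring] at h2
    exact sub_mem h1 (units_smul_mem h2 _)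
  · simp only [LinearMap.sub_apply, LinearMap.smul_apply, LinearMap.comp_apply]
    rw [hE.2.1 k x hx y, hD.2.1 k x hx y, map_add, map_add, map_units_smul, map_units_smul,
      hD.2.1 _ _ (hE.1 k x hx) y, hE.2.1 _ _ (hD.1 k x hx) y, hD.2.1 k x hx, hE.2.1 k x hx,
      add_mul, mul_add, mul_add, Int.negOnePow_add, Int.negOnePow_add, Int.negOnePow_add,
      mul_comm j i]
    simp only [map_sub, LinearMap.sub_apply, map_units_smul]
    rcases Int.units_eq_one_or (i * j).negOnePow with h1 | h1 <;>
    rcases Int.units_eq_one_or (i * k).negOnePow with h2 | h2 <;>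
    rcases Int.units_eq_one_or (j * k).negOnePow with h3 | h3 <;>
    · simp only [h1, h2, h3, one_smul, Units.neg_smul, one_mul, neg_mul, neg_neg,
        LinearMap.neg_apply]
      abel
  · exact sub_mem (hD.2.2 _ (hE.2.2 x hx)) (units_smul_mem (hE.2.2 _ (hD.2.2 x hx)) _)

variable (P)

/-- The graded commutator of two endomorphisms in `Der(M/L)`. -/
noncomputable def endComm : relDer g P →ₗ[K] relDer g P →ₗ[K] (M →ₗ[K] M) :=
  (LinearMap.mul K (Module.End K M)).compl₁₂ (relDer g P).subtype (relDer g P).subtype -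
    koszulTwist (isInternal_relDerGrading g P) (isInternal_relDerGrading g P)
      ((LinearMap.mul K (Module.End K M)).flip.compl₁₂ (relDer g P).subtype (relDer g P).subtype)

variable {P}

theorem endComm_of_mem {i j : ℤ} {D E : relDer g P} (hD : D ∈ relDerGrading g P i)
    (hE : E ∈ relDerGrading g P j) :
    endComm g P D E = D.val ∘ₗ E.val - (i * j).negOnePow • (E.val ∘ₗ D.val) := by
  rw [endComm, LinearMap.sub_apply, LinearMap.sub_apply, koszulTwist_of_mem _ _ _ hD hE]
  rfl

theorem endComm_mem_of_mem {i j : ℤ} {D E : relDer g P} (hD : D ∈ relDerGrading g P i)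
    (hE : E ∈ relDerGrading g P j) : endComm g P D E ∈ relDerDeg g P (i + j) := by
  rw [endComm_of_mem g hD hE]
  exact comp_mem_relDerDeg g hD hE

theorem endComm_mem (D E : relDer g P) : endComm g P D E ∈ relDer g P := by
  refine induction_homogeneous (isInternal_relDerGrading g P)
    (p := fun D => endComm g P D E ∈ relDer g P) (fun i D hD => ?_)
    (fun D D' h h' => by rw [map_add, LinearMap.add_apply]; exact add_mem h h') D
  refine induction_homogeneous (isInternal_relDerGrading g P)
    (p := fun E => endComm g P D E ∈ relDer g P) (fun j E hE => ?_)
    (fun E E' h h' => by rw [map_add]; exact add_mem h h') E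
  exact Submodule.mem_iSup_of_mem _ (endComm_mem_of_mem g hD hE)

variable (P)

/-- The bracket of `Der(M/L)`. -/
noncomputable def relDerBracket : relDer g P →ₗ[K] relDer g P →ₗ[K] relDer g P :=
  LinearMap.mk₂ K (fun D E => ⟨endComm g P D E, endComm_mem g D E⟩)
    (fun D D' E => Subtype.ext (by simp)) (fun c D E => Subtype.ext (by simp))
    (fun D E E' => Subtype.ext (by simp)) (fun c D E => Subtype.ext (by simp))

variable {P}

theorem relDerBracket_of_mem {i j : ℤ} {D E : relDer g P} (hD : D ∈ relDerGrading g P i)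
    (hE : E ∈ relDerGrading g P j) :
    (relDerBracket g P D E).val = D.val ∘ₗ E.val - (i * j).negOnePow • (E.val ∘ₗ D.val) :=
  endComm_of_mem g hD hE

variable (P)

/-- The underlying space of the semidirect product `Der(M/L) ⋉ M`. -/
abbrev Semidirect : Type _ := relDer g P × M

/-- The grading of `Der(M/L) ⋉ M`. -/
def semidirectGrading (i : ℤ) : Submodule K (Semidirect g P) := (relDerGrading g P i).prod (ℳ i)

/-- The term `(-1)^{|x||D|} D x` of the bracket of `Der(M/L) ⋉ M`. -/
noncomputable def twistedAction : M →ₗ[K] relDer g P →ₗ[K] M :=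
  koszulTwist g.isInternal (isInternal_relDerGrading g P) (relDer g P).subtype.flip

/-- The bracket of `Der(M/L) ⋉ M`, in which `[D, x] = D x`. -/
noncomputable def semidirectBracket : Semidirect g P →ₗ[K] Semidirect g P →ₗ[K] Semidirect g P :=
  LinearMap.mk₂ K (fun u w => (relDerBracket g P u.1 w.1,
      u.1.val w.2 - twistedAction g P u.2 w.1 + g.bracket u.2 w.2))
    (fun u u' w => by ext1 <;> simp; abel)
    (fun c u w => by ext1 <;> simp [smul_add, smul_sub])
    (fun u w w' => by ext1 <;> simp; abel)
    (fun c u w => by ext1 <;> simp [smul_add, smul_sub])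

variable {P}

theorem semidirectBracket_apply (u w : Semidirect g P) : semidirectBracket g P u w =
    (relDerBracket g P u.1 w.1, u.1.val w.2 - twistedAction g P u.2 w.1 + g.bracket u.2 w.2) := rfl

theorem semidirectBracket_snd_of_mem {i j : ℤ} {u w : Semidirect g P}
    (hu : u ∈ semidirectGrading g P i) (hw : w ∈ semidirectGrading g P j) :
    (semidirectBracket g P u w).2 =
      u.1.val w.2 - (i * j).negOnePow • w.1.val u.2 + g.bracket u.2 w.2 := by
  rw [semidirectBracket_apply, twistedAction, koszulTwist_of_mem _ _ _ hu.2 hw.1]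
  rfl

theorem semidirectBracket_mem {i j : ℤ} {u w : Semidirect g P}
    (hu : u ∈ semidirectGrading g P i) (hw : w ∈ semidirectGrading g P j) :
    semidirectBracket g P u w ∈ semidirectGrading g P (i + j) := by
  refine ⟨endComm_mem_of_mem g hu.1 hw.1, ?_⟩
  rw [semidirectBracket_snd_of_mem g hu hw]
  have h1 := hu.1.1 _ _ hw.2
  have h2 := hw.1.1 _ _ hu.2
  rw [add_comm] at h1
  exact add_mem (sub_mem h1 (units_smul_mem h2 _)) (g.bracket_mem hu.2 hw.2)

variable (P)

/-- The graded Lie algebra `Der(M/L) ⋉ M`. -/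
noncomputable def semidirect : GradedLieStructure (semidirectGrading g P) where
  isInternal := isInternal_prod (isInternal_relDerGrading g P) g.isInternal
  bracket := semidirectBracket g P
  bracket_mem hu hw := semidirectBracket_mem g hu hw
  bracket_skew {i j u w} hu hw := by
    refine Prod.ext (Subtype.ext ?_) ?_
    · simp only [Prod.fst_neg, Prod.smul_fst, semidirectBracket_apply]
      rw [Submodule.coe_neg, Units.smul_def, Submodule.coe_smul_of_tower, ← Units.smul_def,
        relDerBracket_of_mem g hu.1 hw.1, relDerBracket_of_mem g hw.1 hu.1, mul_comm j i,
        smul_sub, smul_smul, Int.units_mul_self, one_smul]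
      abel
    · simp only [Prod.snd_neg, Prod.smul_snd]
      rw [semidirectBracket_snd_of_mem g hu hw, semidirectBracket_snd_of_mem g hw hu,
        g.bracket_skew hu.2 hw.2, mul_comm j i, smul_add, smul_sub, smul_smul,
        Int.units_mul_self, one_smul]
      abel
  jacobi {i j k u v w} hu hv hw := by
    refine Prod.ext (Subtype.ext ?_) ?_
    · simp only [Prod.fst_add, Prod.smul_fst]
      rw [Submodule.coe_add, Units.smul_def, Submodule.coe_smul_of_tower, ← Units.smul_def]
      have h1 : (semidirectBracket g P v w).1 ∈ relDerGrading g P (j + k) :=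
        (semidirectBracket_mem g hv hw).1
      have h2 : (semidirectBracket g P u v).1 ∈ relDerGrading g P (i + j) :=
        (semidirectBracket_mem g hu hv).1
      have h3 : (semidirectBracket g P u w).1 ∈ relDerGrading g P (i + k) :=
        (semidirectBracket_mem g hu hw).1
      have e1 := relDerBracket_of_mem g hu.1 h1
      have e2 := relDerBracket_of_mem g h2 hw.1
      have e3 := relDerBracket_of_mem g hv.1 h3
      simp only [semidirectBracket_apply] at e1 e2 e3 ⊢
      rw [e1, e2, e3]
      rw [relDerBracket_of_mem g hv.1 hw.1, relDerBracket_of_mem g hu.1 hv.1,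
        relDerBracket_of_mem g hu.1 hw.1, add_mul, mul_add, mul_add, Int.negOnePow_add,
        Int.negOnePow_add, Int.negOnePow_add, mul_comm j i]
      refine LinearMap.ext fun x => ?_
      simp only [LinearMap.sub_apply, LinearMap.smul_apply, LinearMap.comp_apply,
        LinearMap.add_apply, map_sub, map_units_smul]
      rcases Int.units_eq_one_or (i * j).negOnePow with h1 | h1 <;>
      rcases Int.units_eq_one_or (i * k).negOnePow with h2 | h2 <;>
      rcases Int.units_eq_one_or (j * k).negOnePow with h3 | h3 <;>
      · simp only [h1, h2, h3, one_smul, Units.neg_smul, one_mul, neg_mul, neg_neg]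
        abel
    · simp only [Prod.snd_add, Prod.smul_snd]
      rw [semidirectBracket_snd_of_mem g hu (semidirectBracket_mem g hv hw),
        semidirectBracket_snd_of_mem g (semidirectBracket_mem g hu hv) hw,
        semidirectBracket_snd_of_mem g hv (semidirectBracket_mem g hu hw),
        semidirectBracket_snd_of_mem g hv hw, semidirectBracket_snd_of_mem g hu hv,
        semidirectBracket_snd_of_mem g hu hw]
      simp only [semidirectBracket_apply]
      rw [relDerBracket_of_mem g hv.1 hw.1, relDerBracket_of_mem g hu.1 hv.1,
        relDerBracket_of_mem g hu.1 hw.1]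
      simp only [LinearMap.sub_apply, LinearMap.smul_apply, LinearMap.comp_apply,
        LinearMap.add_apply, map_add, map_sub, map_units_smul]
      have e1 := hu.1.2.1 j v.2 hv.2 w.2
      have e2 := hv.1.2.1 i u.2 hu.2 w.2
      have e3 := hw.1.2.1 i u.2 hu.2 v.2
      simp only [Submodule.subtype_apply] at e1 e2 e3
      rw [e1, e2, e3, g.jacobi hu.2 hv.2 hw.2,
        g.bracket_skew hv.2 (show u.1.val w.2 ∈ ℳ (k + i) from hu.1.1 _ _ hw.2),
        g.bracket_skew hv.2 (show w.1.val u.2 ∈ ℳ (i + k) from hw.1.1 _ _ hu.2)]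
      simp only [add_mul, mul_add, Int.negOnePow_add, mul_comm j i, mul_comm k i]
      rcases Int.units_eq_one_or (i * j).negOnePow with h1 | h1 <;>
      rcases Int.units_eq_one_or (i * k).negOnePow with h2 | h2 <;>
      rcases Int.units_eq_one_or (j * k).negOnePow with h3 | h3 <;>
      · simp only [h1, h2, h3, one_smul, Units.neg_smul, one_mul, neg_mul, neg_neg]
        abel

end Derivations

/-! ### Square zero -/

section SquareZero

variable {K M V : Type*} [Field K] [AddCommGroup M] [Module K M] [AddCommGroup V] [Module K V]
  {ℳ : ℤ → Submodule K M} (g : GradedLieStructure ℳ)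

theorem isFamily_comp {ι : Type*} [LinearOrder ι] {d : ι → ℤ} {𝒱 : ℤ → Submodule K V} {e a : ℤ}
    {κ : V →ₗ[K] M} (hκ : ∀ i, ∀ v ∈ 𝒱 i, κ v ∈ ℳ (i + e)) {X : Finset ι → V}
    (hX : IsFamily d 𝒱 a X) : IsFamily d ℳ (a + e) (fun S => κ (X S)) := by
  intro S
  rw [← add_assoc]
  exact hκ _ _ (hX S)

theorem convBilin_paritySign {E G : Type*} [AddCommGroup E] [Module K E] [AddCommGroup G]
    [Module K G] {ι : Type*} [LinearOrder ι] {d : ι → ℤ} {a : ℤ} {X : Finset ι → M}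
    (hX : IsFamily d ℳ a X) (e : ℤ) (B : M →ₗ[K] E →ₗ[K] G) (Y : Finset ι → E) :
    convBilin d e B (fun S => paritySign g.isInternal (X S)) Y =
      a.negOnePow • convBilin d (e + 1) B X Y := by
  funext U
  rw [Pi.smul_apply, convBilin_apply, convBilin_apply, Finset.smul_sum]
  refine Finset.sum_congr rfl fun T _ => ?_
  rw [paritySign_of_mem _ (hX _), map_units_smul_apply, smul_smul, smul_smul, add_mul, one_mul,
    Int.negOnePow_add, Int.negOnePow_add]
  congr 1
  ac_rfl

/-- The maps `½ [ςκ v₀, κ v₁]` in two variables, and zero in the other numbers of variables, where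
`ς x = (-1)^|x| x`. -/
noncomputable def halfBracketMul (κ : V →ₗ[K] M) :
    ∀ m : ℕ, MultilinearMap K (fun _ : Fin (m + 1) => V) M
  | 0 => 0
  | 1 => (2⁻¹ : K) • bracketSnoc g κ (unary (paritySign g.isInternal ∘ₗ κ))
  | _ + 2 => 0

theorem sum_convPair_halfBracketMul {ι : Type*} [LinearOrder ι] [Fintype ι] {d : ι → ℤ}
    {κ : V →ₗ[K] M} {X Y : Finset ι → V} (hX : IsFamily d ℳ 1 (fun S => κ (X S)))
    (hY : IsFamily d ℳ 2 (fun S => κ (Y S))) {N : ℕ} (hN : 2 ≤ N) :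
    ∑ m ∈ Finset.range N, convPair d (halfBracketMul g κ m) X Y =
      ((2⁻¹ : K) • (convBilin d 1 g.bracket (fun S => κ (Y S)) (fun S => κ (X S)) -
          convBilin d 0 g.bracket (fun S => κ (X S)) (fun S => κ (Y S))),
        -(2⁻¹ : K) • convBilin d 1 g.bracket (fun S => κ (X S)) (fun S => κ (X S))) := by
  rw [Finset.sum_eq_single_of_mem 1 (Finset.mem_range.2 (by omega))]
  · have h : (halfBracketMul g κ 1 : (Fin 2 → V) → M) =
      fun v => (2⁻¹ : K) • bracketSnoc g κ (unary (paritySign g.isInternal ∘ₗ κ)) v := rfl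
    rw [h, convPair_smul, convPair_bracketSnoc, convPair_unary]
    have h1 := convBilin_paritySign g hX 0 g.bracket (fun S => κ (X S))
    have h2 := convBilin_paritySign g hY 0 g.bracket (fun S => κ (X S))
    have h3 := convBilin_paritySign g hX 1 g.bracket (fun S => κ (Y S))
    rw [Int.negOnePow_one, Units.neg_smul, one_smul] at h1 h3
    rw [show (2 : ℤ).negOnePow = 1 by decide, one_smul] at h2
    rw [convBilin_congr_degree d (e := 1 + 1) (e' := 0) (by decide)] at h3
    rw [zero_add] at h1 h2
    have h4 : dualAd g d (fun S => κ (X S)) (fun S => κ (Y S))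
        (fun S => (paritySign g.isInternal ∘ₗ κ) (Y S),
          fun S => (paritySign g.isInternal ∘ₗ κ) (X S)) =
        (convBilin d 0 g.bracket (fun S => paritySign g.isInternal (κ (Y S))) (fun S => κ (X S)) +
        convBilin d 1 g.bracket (fun S => paritySign g.isInternal (κ (X S))) (fun S => κ (Y S)),
        convBilin d 0 g.bracket (fun S => paritySign g.isInternal (κ (X S)))
          (fun S => κ (X S))) := rfl
    rw [h4, h1, h2, h3, Prod.smul_mk, smul_neg, neg_smul, sub_eq_add_neg]
  · intro m _ hm
    match m, hm with
    | 0, _ => exact convPair_zero d X Y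
    | m + 2, _ => exact convPair_zero d X Y

/-- The image under a linear map `T` of the map of graded spaces with Taylor coefficients the
symmetrizations of `f`, evaluated on `Σᵢ tᵢ vᵢ`. -/
theorem map_onBlock_gradedSymm {W : Type*} [AddCommGroup W] [Module K W]
    {𝒱 : ℤ → Submodule K V} (h𝒱 : DirectSum.IsInternal 𝒱)
    {f : ∀ n : ℕ, MultilinearMap K (fun _ : Fin n => V) W} (hf0 : f 0 = 0) {n N : ℕ} (hN : n ≤ N)
    {d : Fin n → ℤ} {v : Fin n → V} (hv : ∀ i, v i ∈ 𝒱 (d i)) (T : W →ₗ[K] M)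
    (φ : ∀ m : ℕ, MultilinearMap K (fun _ : Fin (m + 1) => V) M)
    (hφ : ∀ m u, T (f (m + 1) u) = φ m u) (Y : Finset (Fin n) → V) :
    (fun S => T (onBlock (fun n => gradedSymm h𝒱 (f n)) v S)) =
      (∑ m ∈ Finset.range (N + 1), convPair d (φ m) (singles v) Y).2 := by
  funext S
  have hS : S.card < N + 1 + 1 := by
    have := Finset.card_le_univ S
    simp only [Fintype.card_fin] at this
    omega
  rw [onBlock_gradedSymm h𝒱 f hv S hS, map_sum, Finset.sum_range_succ' _ (N + 1),
    Prod.snd_sum, Finset.sum_apply]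
  have h0 : T (conv d (fun _ => 0) (f 0) (fun _ => singles v) S) = 0 := by
    simp [conv, hf0]
  rw [h0, add_zero]
  refine Finset.sum_congr rfl fun m _ => ?_
  rw [map_conv]
  simp only [hφ]
  rfl

/-- The value and the derivative of `φ(z) κ - ψ(z) κ'`, for the generating functions `φ` and `ψ`
of the Bernoulli numbers `B_m(1)` and `B_m`. -/
theorem sum_convPair_cocylinder [CharZero K] {ι : Type*} [LinearOrder ι] [Fintype ι] (d : ι → ℤ)
    (κ κ' ν : V →ₗ[K] M) (X Y : Finset ι → V) (N : ℕ) :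
    ∑ m ∈ Finset.range N, convPair d
      (((bernoulli' m / m.factorial : ℚ) : K) • nestedMul g κ ν m -
        ((bernoulli m / m.factorial : ℚ) : K) • nestedMul g κ' ν m) X Y =
      nilEval N (bernoulli'PowerSeries K)
        (dualAd g d (fun S => ν (X S)) (fun S => ν (Y S)))
        (fun S => κ (Y S), fun S => κ (X S)) -
      nilEval N (bernoulliPowerSeries K)
        (dualAd g d (fun S => ν (X S)) (fun S => ν (Y S)))
        (fun S => κ' (Y S), fun S => κ' (X S)) := by
  rw [nilEval_apply, nilEval_apply, ← Finset.sum_sub_distrib]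
  refine Finset.sum_congr rfl fun m _ => ?_
  have h1 : (((((bernoulli' m / m.factorial : ℚ) : K) • nestedMul g κ ν m -
      ((bernoulli m / m.factorial : ℚ) : K) • nestedMul g κ' ν m) :
        MultilinearMap K (fun _ : Fin (m + 1) => V) M) : (Fin (m + 1) → V) → M) =
      fun u => (fun u => ((bernoulli' m / m.factorial : ℚ) : K) • nestedMul g κ ν m u) u +
      (fun u => (-((bernoulli m / m.factorial : ℚ) : K)) • nestedMul g κ' ν m u) u := by
    funext u
    simp only [neg_smul, ← sub_eq_add_neg]
    rfl
  rw [h1, convPair_add, convPair_smul, convPair_smul, convPair_nestedMul, convPair_nestedMul,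
    neg_smul, ← sub_eq_add_neg]
  simp only [bernoulli'PowerSeries, bernoulliPowerSeries, PowerSeries.coeff_mk, eq_ratCast]

/-- The value and the derivative of `ψ(z) P exp(z) κ`. -/
theorem sum_convPair_derivedBrackets [CharZero K] {ι : Type*} [LinearOrder ι] [Fintype ι]
    (d : ι → ℤ) (κ ν : V →ₗ[K] M) (P : M →ₗ[K] M) {X Y : Finset ι → V} (hx0 : ν (X ∅) = 0)
    (hy0 : ν (Y ∅) = 0) {N : ℕ} (hcard : Fintype.card ι < N) :
    ∑ m ∈ Finset.range N, convPair d
      (∑ k ∈ Finset.range (m + 1),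
        ((bernoulli (m - k) / (k.factorial * (m - k).factorial) : ℚ) : K) •
        nestedProjMul g κ ν P k m : MultilinearMap K (fun _ : Fin (m + 1) => V) M) X Y =
      nilEval N (bernoulliPowerSeries K)
        (dualAd g d (fun S => ν (X S)) (fun S => ν (Y S)))
        ((P.compLeft (Finset ι)).prodMap (P.compLeft (Finset ι))
          (nilEval N (PowerSeries.exp K) (dualAd g d (fun S => ν (X S)) (fun S => ν (Y S)))
            (fun S => κ (Y S), fun S => κ (X S)))) := by
  set Z := dualAd g d (fun S => ν (X S)) (fun S => ν (Y S)) with hZ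
  set PP := P.compLeft (Finset ι) with hPP
  set u₀ : (Finset ι → M) × (Finset ι → M) :=
    (fun S => κ (Y S), fun S => κ (X S)) with hu₀
  have hvan : ∀ i k, N ≤ i + k → (Z ^ i) (PP.prodMap PP ((Z ^ k) u₀)) = 0 := by
    intro i k hik
    have h1 := dualAd_pow_mem_familiesFrom g d (x := fun S => ν (X S))
      (y := fun S => ν (Y S)) hx0 hy0 k (mem_familiesFrom_zero u₀.1)
      (mem_familiesFrom_zero u₀.2)
    have h2 : ∀ {a : ℕ} {u : Finset ι → M}, u ∈ familiesFrom K M ι a →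
        PP u ∈ familiesFrom K M ι a := by
      intro a u hu U hU
      simp [hPP, hu U hU]
    have h3 := dualAd_pow_mem_familiesFrom g d (x := fun S => ν (X S))
      (y := fun S => ν (Y S)) hx0 hy0 i
      (u := PP.prodMap PP ((Z ^ k) u₀)) (h2 h1.1) (h2 h1.2)
    exact Prod.ext (eq_zero_of_mem_familiesFrom (by omega) h3.1)
      (eq_zero_of_mem_familiesFrom (by omega) h3.2)
  rw [nilEval_apply, nilEval_apply]
  simp only [map_sum, Finset.smul_sum, map_smul, smul_smul]
  rw [sum_range_range_eq_sum_antidiagonal (fun i k =>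
    (PowerSeries.coeff i (bernoulliPowerSeries K) * PowerSeries.coeff k (PowerSeries.exp K)) •
      (Z ^ i) (PP.prodMap PP ((Z ^ k) u₀))) (fun i k hik => by rw [hvan i k hik, smul_zero])]
  refine Finset.sum_congr rfl fun m _ => ?_
  rw [← Finset.Nat.sum_antidiagonal_swap, Finset.Nat.sum_antidiagonal_eq_sum_range_succ_mk]
  have h1 : ((∑ k ∈ Finset.range (m + 1),
      ((bernoulli (m - k) / (k.factorial * (m - k).factorial) : ℚ) : K) •
      nestedProjMul g κ ν P k m : MultilinearMap K (fun _ : Fin (m + 1) => V) M) :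
        (Fin (m + 1) → V) → M) = fun u => ∑ k ∈ Finset.range (m + 1),
      (fun k u => ((bernoulli (m - k) / (k.factorial * (m - k).factorial) : ℚ) : K) •
        nestedProjMul g κ ν P k m u) k u := by
    funext u; rw [sum_apply]; rfl
  rw [h1, convPair_sum]
  refine Finset.sum_congr rfl fun k hk => ?_
  rw [convPair_smul, convPair_nestedProjMul, if_pos (by simpa [Nat.lt_succ_iff] using hk)]
  congr 1
  simp only [bernoulliPowerSeries, PowerSeries.coeff_exp, PowerSeries.coeff_mk, eq_ratCast,
    Prod.swap_prod_mk]
  push_cast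
  field_simp

variable {𝒱 : ℤ → Submodule K V} (h𝒱 : DirectSum.IsInternal 𝒱)
  {f : ∀ n : ℕ, MultilinearMap K (fun _ : Fin n => V) V} (hf0 : f 0 = 0)
  (hf : IsGradedSymmetric 𝒱 𝒱 1 (fun n => gradedSymm h𝒱 (f n)))
  {n N : ℕ} (hN : n ≤ N) {d : Fin n → ℤ} {v : Fin n → V} (hv : ∀ i, v i ∈ 𝒱 (d i))
include hf0 hf hN hv

/-- The image under a linear map `T` of the vector field with Taylor coefficients `f`, and of its
square. -/
theorem map_square_gradedSymm [CharZero K] (T : V →ₗ[K] M)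
    (φ : ∀ m : ℕ, MultilinearMap K (fun _ : Fin (m + 1) => V) M)
    (hφ : ∀ m u, T (f (m + 1) u) = φ m u) :
    (∑ m ∈ Finset.range (N + 1), convPair d (φ m) (singles v)
        (onBlock (fun n => gradedSymm h𝒱 (f n)) v)).2 =
      (fun S => T (onBlock (fun n => gradedSymm h𝒱 (f n)) v S)) ∧
    (∑ m ∈ Finset.range (N + 1), convPair d (φ m) (singles v)
        (onBlock (fun n => gradedSymm h𝒱 (f n)) v)).1 Finset.univ =
      T (nijenhuisRichardsonSquare (fun n => gradedSymm h𝒱 (f n)) n d v) := by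
  constructor
  · exact (map_onBlock_gradedSymm h𝒱 hf0 hN hv T φ hφ _).symm
  · rw [nijenhuisRichardsonSquare_gradedSymm h𝒱 f hf0 hf (N := N + 1) (by omega) hv, map_sum,
      Prod.fst_sum, Finset.sum_apply]
    refine Finset.sum_congr rfl fun m _ => ?_
    rw [map_convDeriv]
    simp only [hφ]
    rfl

variable {κ : V →ₗ[K] M} (hκ : ∀ i, ∀ v ∈ 𝒱 i, κ v ∈ ℳ (i + 1))
  (hfκ : ∀ m u, κ (f (m + 1) u) = halfBracketMul g κ m u)
include hκ hfκ

theorem map_square_halfBracket [CharZero K] :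
    (fun S => κ (onBlock (fun n => gradedSymm h𝒱 (f n)) v S)) =
      -(2⁻¹ : K) • convBilin d 1 g.bracket (fun S => κ (singles v S)) (fun S => κ (singles v S)) ∧
    κ (nijenhuisRichardsonSquare (fun n => gradedSymm h𝒱 (f n)) n d v) = 0 := by
  have hX : IsFamily d ℳ 1 (fun S => κ (singles v S)) := isFamily_comp hκ (isFamily_singles hv)
  have hY : IsFamily d ℳ 2 (fun S => κ (onBlock (fun n => gradedSymm h𝒱 (f n)) v S)) :=
    isFamily_comp hκ (isFamily_onBlock hf hv)
  have h := map_square_gradedSymm h𝒱 hf0 hf (N := N + 1) (hN.trans (Nat.le_succ N)) hv κ _ hfκ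
  rw [sum_convPair_halfBracketMul g hX hY (by omega)] at h
  have h1 := h.1.symm
  refine ⟨h1, ?_⟩
  rw [← h.2, h1]
  have hc := convBilin_cube_eq_zero g d hX
  simp only [map_smul, LinearMap.smul_apply, hc.1, hc.2]
  simp

variable [CharZero K] {ν : V →ₗ[K] M} (hν : ∀ i, ∀ v ∈ 𝒱 i, ν v ∈ ℳ i)
include hν

/-- The coefficients of the extension of the mapping cocylinder square to zero in the direction
of `M`. -/
theorem map_square_cocylinder {κ' : V →ₗ[K] M} (hκ' : ∀ i, ∀ v ∈ 𝒱 i, κ' v ∈ ℳ (i + 1))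
    (hfκ' : ∀ m u, κ' (f (m + 1) u) = halfBracketMul g κ' m u)
    (hfν : ∀ m u, ν (f (m + 1) u) =
      ((bernoulli' m / m.factorial : ℚ) : K) • nestedMul g κ ν m u -
        ((bernoulli m / m.factorial : ℚ) : K) • nestedMul g κ' ν m u) :
    ν (nijenhuisRichardsonSquare (fun n => gradedSymm h𝒱 (f n)) n d v) = 0 := by
  set Y := onBlock (fun n => gradedSymm h𝒱 (f n)) v with hYdef
  set NR := nijenhuisRichardsonSquare (fun n => gradedSymm h𝒱 (f n)) n d v with hNR
  have hX : IsFamily d ℳ 1 (fun S => κ (singles v S)) := isFamily_comp hκ (isFamily_singles hv)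
  have hX' : IsFamily d ℳ 1 (fun S => κ' (singles v S)) := isFamily_comp hκ' (isFamily_singles hv)
  have hx : IsFamily d ℳ 0 (fun S => ν (singles v S)) :=
    isFamily_comp (e := 0) (by simpa using hν) (isFamily_singles hv)
  have hx0 : ν (singles v ∅) = 0 := by
    rw [singles_of_card_ne_one v (by simp), map_zero]
  have hy0 : ν (Y ∅) = 0 := by
    rw [hYdef, onBlock_empty, map_zero]
    ext u; rw [gradedSymm_apply]; simp [hf0]
  have h := map_square_gradedSymm h𝒱 hf0 hf hN hv ν
    (fun m => ((bernoulli' m / m.factorial : ℚ) : K) • nestedMul g κ ν m -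
        ((bernoulli m / m.factorial : ℚ) : K) • nestedMul g κ' ν m)
    (fun m u => hfν m u)
  rw [sum_convPair_cocylinder, (map_square_halfBracket g h𝒱 hf0 hf hN hv hκ hfκ).1,
    (map_square_halfBracket g h𝒱 hf0 hf hN hv hκ' hfκ').1] at h
  rw [← h.2]
  have hcard : Fintype.card (Fin n) < N + 1 := by rw [Fintype.card_fin]; omega
  have hD := isNilpotentDerivation_rightAd g d hcard hx hx0
  have h1 := hD.cocylinder_square_zero (Nat.succ_pos N) hX hX' (y := fun S => ν (Y S))
    (by
      rw [← h.1, Prod.snd_sub, dualAd, nilEval_dualEnd_snd, nilEval_dualEnd_snd])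
    (dualAd_pow_eq_zero g d hcard hx0 hy0)
  exact congrFun h1 Finset.univ

/-- The coefficients given by the higher derived brackets square to zero in the direction of
`A`. -/
theorem map_square_derivedBrackets {P : M →ₗ[K] M} (hP : IsLieProjection g P)
    (hfν : ∀ m u, ν (f (m + 1) u) = ∑ k ∈ Finset.range (m + 1),
      ((bernoulli (m - k) / (k.factorial * (m - k).factorial) : ℚ) : K) •
        nestedProjMul g κ ν P k m u) :
    ν (nijenhuisRichardsonSquare (fun n => gradedSymm h𝒱 (f n)) n d v) = 0 := by
  set Y := onBlock (fun n => gradedSymm h𝒱 (f n)) v with hYdef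
  have hX : IsFamily d ℳ 1 (fun S => κ (singles v S)) := isFamily_comp hκ (isFamily_singles hv)
  have hx : IsFamily d ℳ 0 (fun S => ν (singles v S)) :=
    isFamily_comp (e := 0) (by simpa using hν) (isFamily_singles hv)
  have hx0 : ν (singles v ∅) = 0 := by
    rw [singles_of_card_ne_one v (by simp), map_zero]
  have hy0 : ν (Y ∅) = 0 := by
    rw [hYdef, onBlock_empty, map_zero]
    ext u; rw [gradedSymm_apply]; simp [hf0]
  have h := map_square_gradedSymm h𝒱 hf0 hf hN hv ν
    (fun m => ∑ k ∈ Finset.range (m + 1),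
      ((bernoulli (m - k) / (k.factorial * (m - k).factorial) : ℚ) : K) •
        nestedProjMul g κ ν P k m)
    (fun m u => by
      rw [hfν, sum_apply]
      rfl)
  have hcard : Fintype.card (Fin n) < N + 1 := by rw [Fintype.card_fin]; omega
  rw [sum_convPair_derivedBrackets g d κ ν P hx0 hy0 hcard] at h
  rw [← h.2]
  have hκY := (map_square_halfBracket g h𝒱 hf0 hf hN hv hκ hfκ).1
  have hD := isNilpotentDerivation_rightAd g d hcard hx hx0
  have hfam : ∀ u ∈ homogeneousFamilies (K := K) d ℳ 1, P.compLeft _ u ∈ homogeneousFamilies d ℳ 1 :=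
    fun u hu S => hP.map_mem (hu S)
  have hrange : ∀ x y, P (g.bracket (P x) (P y)) = g.bracket (P x) (P y) := by
    intro x y
    obtain ⟨w, hw⟩ := hP.range_closed (P x) ⟨x, rfl⟩ (P y) ⟨y, rfl⟩
    rw [← hw, hP.idem]
  have hker : ∀ x y, P (g.bracket (x - P x) (y - P y)) = 0 := fun x y =>
    hP.ker_closed (x - P x) (by simp [hP.idem]) (y - P y) (by simp [hP.idem])
  have h1 := hD.derivedBrackets_square_zero (Nat.succ_pos N) (P.compLeft _) hfam
    (fun u _ => by
      funext U
      change P (convBilin d 1 g.bracket (P.compLeft _ u) (P.compLeft _ u) U) = _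
      rw [convBilin_apply, map_sum]
      refine Finset.sum_congr rfl fun T _ => ?_
      rw [map_units_smul]
      exact congrArg _ (hrange _ _))
    (fun u _ => by
      funext U
      change P (convBilin d 1 g.bracket (u - P.compLeft _ u) (u - P.compLeft _ u) U) = _
      rw [convBilin_apply, map_sum]
      refine Finset.sum_eq_zero fun T _ => ?_
      rw [map_units_smul]
      exact (congrArg _ (hker _ _)).trans (smul_zero _))
    hX (y := fun S => ν (Y S))
    (by
      rw [← h.1, dualAd, nilEval_dualEnd_snd, LinearMap.prodMap_apply, nilEval_dualEnd_snd])
    (dualAd_pow_eq_zero g d hcard hx0 hy0)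
  rw [hκY]
  exact congrFun h1 Finset.univ

end SquareZero

/-! ### Degrees and closure properties of nested brackets -/

section NestedMem

variable {K M V : Type*} [Field K] [AddCommGroup M] [Module K M] [AddCommGroup V] [Module K V]
  {ℳ : ℤ → Submodule K M} (g : GradedLieStructure ℳ) {κ ν : V →ₗ[K] M}
  {𝒱 : ℤ → Submodule K V}

theorem bracketSnoc_mem (hν : ∀ i, ∀ v ∈ 𝒱 i, ν v ∈ ℳ i) {m : ℕ}
    {f : MultilinearMap K (fun _ : Fin m => V) M} {e : ℤ}
    (hf : ∀ (d : Fin m → ℤ) v, (∀ i, v i ∈ 𝒱 (d i)) → f v ∈ ℳ ((∑ i, d i) + e))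
    {d : Fin (m + 1) → ℤ} {v : Fin (m + 1) → V} (hv : ∀ i, v i ∈ 𝒱 (d i)) :
    bracketSnoc g ν f v ∈ ℳ ((∑ i, d i) + e) := by
  rw [Fin.sum_univ_castSucc, add_right_comm]
  exact g.bracket_mem (hf (fun i => d i.castSucc) (Fin.init v) fun i => hv i.castSucc)
    (hν _ _ (hv (Fin.last m)))

theorem nestedMul_mem (hκ : ∀ i, ∀ v ∈ 𝒱 i, κ v ∈ ℳ (i + 1)) (hν : ∀ i, ∀ v ∈ 𝒱 i, ν v ∈ ℳ i)
    (m : ℕ) (d : Fin (m + 1) → ℤ) (v : Fin (m + 1) → V) (hv : ∀ i, v i ∈ 𝒱 (d i)) :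
    nestedMul g κ ν m v ∈ ℳ ((∑ i, d i) + 1) := by
  induction m with
  | zero => rw [Fin.sum_univ_one]; exact hκ _ _ (hv 0)
  | succ m ih => exact bracketSnoc_mem g hν ih hv

theorem nestedProjMul_mem (hκ : ∀ i, ∀ v ∈ 𝒱 i, κ v ∈ ℳ (i + 1))
    (hν : ∀ i, ∀ v ∈ 𝒱 i, ν v ∈ ℳ i) {P : M →ₗ[K] M} (hP : IsLieProjection g P) (k : ℕ)
    (m : ℕ) (d : Fin (m + 1) → ℤ) (v : Fin (m + 1) → V) (hv : ∀ i, v i ∈ 𝒱 (d i)) :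
    nestedProjMul g κ ν P k m v ∈ ℳ ((∑ i, d i) + 1) := by
  induction m with
  | zero =>
    rw [nestedProjMul]
    split_ifs
    · exact hP.map_mem (nestedMul_mem g hκ hν 0 d v hv)
    · exact zero_mem _
  | succ m ih =>
    rw [nestedProjMul]
    split_ifs
    · exact hP.map_mem (nestedMul_mem g hκ hν (m + 1) d v hv)
    · exact bracketSnoc_mem g hν ih hv

theorem nestedProjMul_mem_range {P : M →ₗ[K] M} (hP : IsLieProjection g P)
    (hν : ∀ v, ν v ∈ LinearMap.range P) (k m : ℕ) (v : Fin (m + 1) → V) :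
    nestedProjMul g κ ν P k m v ∈ LinearMap.range P := by
  induction m with
  | zero =>
    rw [nestedProjMul]
    split_ifs
    · exact ⟨_, rfl⟩
    · exact zero_mem _
  | succ m ih =>
    rw [nestedProjMul]
    split_ifs
    · exact ⟨_, rfl⟩
    · exact hP.range_closed _ (ih _) _ (hν _)

theorem halfBracketMul_mem (hκ : ∀ i, ∀ v ∈ 𝒱 i, κ v ∈ ℳ (i + 1)) (m : ℕ) (d : Fin (m + 1) → ℤ)
    (v : Fin (m + 1) → V) (hv : ∀ i, v i ∈ 𝒱 (d i)) :
    halfBracketMul g κ m v ∈ ℳ ((∑ i, d i) + 2) := by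
  match m with
  | 0 => exact zero_mem _
  | m + 2 => exact zero_mem _
  | 1 =>
    refine Submodule.smul_mem _ _ ?_
    have h := g.bracket_mem (x := paritySign g.isInternal (κ (v 0))) (y := κ (v 1))
      (by rw [paritySign_of_mem _ (hκ _ _ (hv 0))]; exact units_smul_mem (hκ _ _ (hv 0)) _)
      (hκ _ _ (hv 1))
    rw [show (∑ i, d i) + 2 = d 0 + 1 + (d 1 + 1) by rw [Fin.sum_univ_two]; ring]
    exact h

theorem map_paritySign {𝒲 : ℤ → Submodule K V} (h𝒲 : DirectSum.IsInternal 𝒲)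
    (T : M →ₗ[K] V) (hT : ∀ i, ∀ v ∈ ℳ i, T v ∈ 𝒲 i) (v : M) :
    T (paritySign g.isInternal v) = paritySign h𝒲 (T v) := by
  simp [paritySign, map_oddPart g.isInternal h𝒲 T hT]

theorem halfBracketMul_mem_ker {P : M →ₗ[K] M} (hP : IsLieProjection g P)
    (hκ : ∀ v, κ v ∈ LinearMap.ker P) (m : ℕ) (v : Fin (m + 1) → V) :
    halfBracketMul g κ m v ∈ LinearMap.ker P := by
  match m with
  | 0 => exact zero_mem _
  | m + 2 => exact zero_mem _
  | 1 =>
    refine Submodule.smul_mem _ _ (hP.ker_closed _ ?_ _ (hκ _))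
    change P (paritySign g.isInternal (κ (v 0))) = 0
    rw [map_paritySign g g.isInternal P (fun i v hv => hP.map_mem hv),
      LinearMap.mem_ker.1 (hκ _), map_zero]

end NestedMem

/-! ### The projection of the semidirect product -/

section Structures

variable {K M : Type*} [Field K] [AddCommGroup M] [Module K M] {ℳ : ℤ → Submodule K M}
  (g : GradedLieStructure ℳ) (P : M →ₗ[K] M)

/-- The projection `(D, m) ↦ (0, P m)` of `Der(M/L) ⋉ M`, with kernel `Der(M/L) ⋉ L`. -/
def semidirectProj : Semidirect g P →ₗ[K] Semidirect g P :=
  LinearMap.inr K (relDer g P) M ∘ₗ P ∘ₗ LinearMap.snd K (relDer g P) M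

theorem semidirectProj_apply (x : Semidirect g P) : semidirectProj g P x = (0, P x.2) := rfl

variable {g P}

theorem mem_ker_semidirectProj {x : Semidirect g P} :
    x ∈ LinearMap.ker (semidirectProj g P) ↔ x.2 ∈ LinearMap.ker P := by
  simp [semidirectProj_apply, Prod.ext_iff]

theorem mem_range_semidirectProj {x : Semidirect g P} :
    x ∈ LinearMap.range (semidirectProj g P) ↔ x.1 = 0 ∧ x.2 ∈ LinearMap.range P := by
  constructor
  · rintro ⟨y, rfl⟩
    exact ⟨rfl, y.2, rfl⟩
  · rintro ⟨h, y, hy⟩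
    exact ⟨(0, y), Prod.ext h.symm hy⟩

theorem semidirect_bracket_inr_right (x : Semidirect g P) (a : M) :
    (semidirect g P).bracket x (0, a) = (0, x.1.val a + g.bracket x.2 a) := by
  change semidirectBracket g P x (0, a) = _
  rw [semidirectBracket_apply]
  simp

theorem isLieProjection_semidirectProj (hP : IsLieProjection g P) :
    IsLieProjection (semidirect g P) (semidirectProj g P) where
  idem x := by simp [semidirectProj_apply, hP.idem]
  map_mem hx := ⟨zero_mem _, hP.map_mem hx.2⟩
  ker_closed x hx y hy := by
    rw [mem_ker_semidirectProj] at *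
    change x.1.val y.2 - twistedAction g P x.2 y.1 + g.bracket x.2 y.2 ∈ LinearMap.ker P
    refine add_mem (sub_mem (relDer_apply_mem_ker g _ hy) ?_) (hP.ker_closed _ hx _ hy)
    have hodd : oddPart g.isInternal x.2 ∈ LinearMap.ker P := by
      rw [LinearMap.mem_ker, map_oddPart g.isInternal g.isInternal P
        (fun i v hv => hP.map_mem hv), LinearMap.mem_ker.1 hx, map_zero]
    exact sub_mem (relDer_apply_mem_ker g y.1 hx)
      (Submodule.smul_mem _ (2 : K) (relDer_apply_mem_ker g _ hodd))
  range_closed x hx y hy := by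
    rw [mem_range_semidirectProj] at *
    obtain ⟨y1, y2⟩ := y
    obtain rfl : y1 = 0 := hy.1
    rw [semidirect_bracket_inr_right]
    refine ⟨rfl, ?_⟩
    rw [hx.1]
    simpa using hP.range_closed _ hx.2 _ hy.2

variable (g)

theorem isInternal_ker (hP : IsLieProjection g P) :
    DirectSum.IsInternal (fun i => (ℳ i).comap (LinearMap.ker P).subtype) :=
  isInternal_comap_subtype g.isInternal _ fun i v hv => by
    rw [LinearMap.mem_ker, map_homComponent g.isInternal g.isInternal P
      (fun i v hv => hP.map_mem hv), LinearMap.mem_ker.1 hv, map_zero]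

theorem isInternal_range (hP : IsLieProjection g P) :
    DirectSum.IsInternal (fun i => (ℳ i).comap (LinearMap.range P).subtype) :=
  isInternal_comap_subtype g.isInternal _ fun i v hv => by
    obtain ⟨w, rfl⟩ := hv
    exact ⟨_, map_homComponent g.isInternal g.isInternal P (fun i v hv => hP.map_mem hv) i w⟩

theorem isInternal_cocylGrading (hP : IsLieProjection g P) :
    DirectSum.IsInternal (cocylGrading g P) :=
  isInternal_prod (isInternal_shift (isInternal_relDerGrading g P) 1)
    (isInternal_prod (isInternal_shift g.isInternal 1)
      (isInternal_prod (isInternal_shift (isInternal_ker g hP) 1) g.isInternal))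

theorem isInternal_hdbGrading (hP : IsLieProjection g P) :
    DirectSum.IsInternal (hdbGrading g P) :=
  isInternal_prod (isInternal_shift (isInternal_relDerGrading g P) 1)
    (isInternal_prod (isInternal_shift g.isInternal 1) (isInternal_range g hP))

variable (P)

/-! ### The extension of the mapping cocylinder -/

/-- `(s⁻¹D, s⁻¹m, s⁻¹l, n) ↦ (D, m)`. -/
def cocylFst : CocylSpace g P →ₗ[K] Semidirect g P where
  toFun x := (x.1, x.2.1)
  map_add' _ _ := rfl
  map_smul' _ _ := rfl

/-- `(s⁻¹D, s⁻¹m, s⁻¹l, n) ↦ (D, l)`. -/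
def cocylSnd : CocylSpace g P →ₗ[K] Semidirect g P where
  toFun x := (x.1, (x.2.2.1 : M))
  map_add' _ _ := rfl
  map_smul' _ _ := rfl

/-- `(s⁻¹D, s⁻¹m, s⁻¹l, n) ↦ (0, n)`. -/
def cocylPath : CocylSpace g P →ₗ[K] Semidirect g P where
  toFun x := (0, x.2.2.2)
  map_add' _ _ := by simp
  map_smul' _ _ := by simp

variable {P}

theorem cocylFst_mem (i : ℤ) (v : CocylSpace g P) (hv : v ∈ cocylGrading g P i) :
    cocylFst g P v ∈ semidirectGrading g P (i + 1) := ⟨hv.1, hv.2.1⟩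

theorem cocylSnd_mem (i : ℤ) (v : CocylSpace g P) (hv : v ∈ cocylGrading g P i) :
    cocylSnd g P v ∈ semidirectGrading g P (i + 1) := ⟨hv.1, hv.2.2.1⟩

theorem cocylPath_mem (i : ℤ) (v : CocylSpace g P) (hv : v ∈ cocylGrading g P i) :
    cocylPath g P v ∈ semidirectGrading g P i := ⟨zero_mem _, hv.2.2.2⟩

theorem mem_cocylGrading {i : ℤ} {v : CocylSpace g P}
    (h1 : cocylFst g P v ∈ semidirectGrading g P (i + 1))
    (h2 : cocylSnd g P v ∈ semidirectGrading g P (i + 1))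
    (h3 : cocylPath g P v ∈ semidirectGrading g P i) : v ∈ cocylGrading g P i :=
  ⟨h1.1, h1.2, h2.2, h3.2⟩

theorem cocyl_ext {v w : CocylSpace g P} (h1 : cocylFst g P v = cocylFst g P w)
    (h2 : cocylSnd g P v = cocylSnd g P w) (h3 : cocylPath g P v = cocylPath g P w) : v = w :=
  Prod.ext (Prod.ext_iff.1 h1).1 (Prod.ext (Prod.ext_iff.1 h1).2
    (Prod.ext (Subtype.ext (Prod.ext_iff.1 h2).2) (Prod.ext_iff.1 h3).2))

variable (P)

/-- The difference `B_m(1)/m! [⋯[(D, m), n₁]⋯, n_m] - B_m/m! [⋯[(D, l), n₁]⋯, n_m]` in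
`Der(M/L) ⋉ M`. -/
noncomputable def cocylPathMul (m : ℕ) :
    MultilinearMap K (fun _ : Fin (m + 1) => CocylSpace g P) (Semidirect g P) :=
  ((bernoulli' m / m.factorial : ℚ) : K) •
      nestedMul (semidirect g P) (cocylFst g P) (cocylPath g P) m -
    ((bernoulli m / m.factorial : ℚ) : K) •
      nestedMul (semidirect g P) (cocylSnd g P) (cocylPath g P) m

variable {P} (hP : IsLieProjection g P)

theorem cocylSnd_mem_ker (v : CocylSpace g P) :
    cocylSnd g P v ∈ LinearMap.ker (semidirectProj g P) :=
  mem_ker_semidirectProj.2 v.2.2.1.2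

/-- Taylor coefficients whose graded symmetrizations are those of the extension of the mapping
cocylinder. -/
noncomputable def cocylMul : ∀ n : ℕ, MultilinearMap K (fun _ : Fin n => CocylSpace g P)
    (CocylSpace g P)
  | 0 => 0
  | m + 1 =>
    ((LinearMap.fst K _ _).compMultilinearMap
        (halfBracketMul (semidirect g P) (cocylFst g P) m)).prod
      (((LinearMap.snd K _ _).compMultilinearMap
        (halfBracketMul (semidirect g P) (cocylFst g P) m)).prod
      ((((LinearMap.snd K _ _).compMultilinearMap
        (halfBracketMul (semidirect g P) (cocylSnd g P) m)).codRestrict (LinearMap.ker P)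
          fun v => mem_ker_semidirectProj.1 (halfBracketMul_mem_ker _
            (isLieProjection_semidirectProj hP) (cocylSnd_mem_ker g) m v)).prod
      ((LinearMap.snd K _ _).compMultilinearMap (cocylPathMul g P m))))

theorem cocylFst_cocylMul (m : ℕ) (u : Fin (m + 1) → CocylSpace g P) :
    cocylFst g P (cocylMul g hP (m + 1) u) =
      halfBracketMul (semidirect g P) (cocylFst g P) m u := rfl

theorem halfBracketMul_fst_eq {V : Type*} [AddCommGroup V] [Module K V]
    {κ κ' : V →ₗ[K] Semidirect g P} (h : ∀ v, (κ v).1 = (κ' v).1) (m : ℕ) (u : Fin (m + 1) → V) :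
    (halfBracketMul (semidirect g P) κ m u).1 = (halfBracketMul (semidirect g P) κ' m u).1 := by
  match m with
  | 0 => rfl
  | m + 2 => rfl
  | 1 =>
    have hs : ∀ x : Semidirect g P, (paritySign (semidirect g P).isInternal x).1 =
        paritySign (isInternal_relDerGrading g P) x.1 := fun x =>
      map_paritySign (semidirect g P) (isInternal_relDerGrading g P) (LinearMap.fst K _ _)
        (fun i v hv => hv.1) x
    change (2⁻¹ : K) • relDerBracket g P (paritySign (semidirect g P).isInternal (κ (u 0))).1
      (κ (u 1)).1 = (2⁻¹ : K) • relDerBracket g P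
        (paritySign (semidirect g P).isInternal (κ' (u 0))).1 (κ' (u 1)).1
    rw [hs, hs, h, h]

theorem cocylSnd_cocylMul (m : ℕ) (u : Fin (m + 1) → CocylSpace g P) :
    cocylSnd g P (cocylMul g hP (m + 1) u) =
      halfBracketMul (semidirect g P) (cocylSnd g P) m u :=
  Prod.ext (halfBracketMul_fst_eq g (κ := cocylFst g P) (κ' := cocylSnd g P) (fun _ => rfl) m u) rfl

theorem nestedMul_succ_fst {V : Type*} [AddCommGroup V] [Module K V]
    {κ ν : V →ₗ[K] Semidirect g P} (h : ∀ v, (ν v).1 = 0) (m : ℕ) (u : Fin (m + 2) → V) :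
    (nestedMul (semidirect g P) κ ν (m + 1) u).1 = 0 := by
  change relDerBracket g P _ (ν _).1 = 0
  rw [h, map_zero]

theorem cocylPathMul_fst (m : ℕ) (u : Fin (m + 1) → CocylSpace g P) :
    (cocylPathMul g P m u).1 = 0 := by
  rw [cocylPathMul, sub_apply, smul_apply, smul_apply, Prod.fst_sub,
    Prod.smul_fst, Prod.smul_fst]
  cases m with
  | zero =>
    simp only [bernoulli'_zero, bernoulli_zero]
    exact sub_self _
  | succ m =>
    rw [nestedMul_succ_fst g (fun _ => rfl), nestedMul_succ_fst g (fun _ => rfl), smul_zero,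
      smul_zero, sub_zero]

theorem cocylPath_cocylMul (m : ℕ) (u : Fin (m + 1) → CocylSpace g P) :
    cocylPath g P (cocylMul g hP (m + 1) u) = cocylPathMul g P m u :=
  Prod.ext (cocylPathMul_fst g m u).symm rfl

theorem isGradedSymmetric_cocylMul :
    IsGradedSymmetric (cocylGrading g P) (cocylGrading g P) 1
      (fun n => gradedSymm (isInternal_cocylGrading g hP) (cocylMul g hP n)) := by
  refine isGradedSymmetric_gradedSymm _ _ fun n d v hv => ?_
  cases n with
  | zero => exact zero_mem _
  | succ m =>
    refine mem_cocylGrading g ?_ ?_ ?_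
    · rw [cocylFst_cocylMul, add_assoc]
      exact halfBracketMul_mem _ (cocylFst_mem g) m d v hv
    · rw [cocylSnd_cocylMul, add_assoc]
      exact halfBracketMul_mem _ (cocylSnd_mem g) m d v hv
    · rw [cocylPath_cocylMul]
      exact sub_mem
        (Submodule.smul_mem _ _ (nestedMul_mem _ (cocylFst_mem g) (cocylPath_mem g) m d v hv))
        (Submodule.smul_mem _ _ (nestedMul_mem _ (cocylSnd_mem g) (cocylPath_mem g) m d v hv))

/-- The `L∞[1]` structure on `s⁻¹Der(M/L) × (s⁻¹M × s⁻¹L × M)`. -/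
noncomputable def cocylStructure [CharZero K] : LInfinityOne (cocylGrading g P) where
  isInternal := isInternal_cocylGrading g hP
  q n := gradedSymm (isInternal_cocylGrading g hP) (cocylMul g hP n)
  q_zero := by ext1 u; rw [gradedSymm_apply]; simp [cocylMul]
  gradedSymmetric := isGradedSymmetric_cocylMul g hP
  square_zero n d v hv := by
    have hs := isGradedSymmetric_cocylMul g hP
    refine cocyl_ext g ?_ ?_ ?_
    · rw [map_zero]
      exact (map_square_halfBracket (semidirect g P) (isInternal_cocylGrading g hP) rfl hs le_rfl hv
        (cocylFst_mem g) (cocylFst_cocylMul g hP)).2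
    · rw [map_zero]
      exact (map_square_halfBracket (semidirect g P) (isInternal_cocylGrading g hP) rfl hs le_rfl hv
        (cocylSnd_mem g) (cocylSnd_cocylMul g hP)).2
    · rw [map_zero]
      exact map_square_cocylinder (semidirect g P) (isInternal_cocylGrading g hP) rfl hs le_rfl hv
        (cocylFst_mem g) (cocylFst_cocylMul g hP) (cocylPath_mem g) (cocylSnd_mem g)
        (cocylSnd_cocylMul g hP) (cocylPath_cocylMul g hP)

/-! ### The structure of higher derived brackets -/

variable (P)

/-- `(s⁻¹D, s⁻¹m, a) ↦ (D, m)`. -/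
def hdbFst : HDBSpace g P →ₗ[K] Semidirect g P where
  toFun x := (x.1, x.2.1)
  map_add' _ _ := rfl
  map_smul' _ _ := rfl

/-- `(s⁻¹D, s⁻¹m, a) ↦ (0, a)`. -/
def hdbSnd : HDBSpace g P →ₗ[K] Semidirect g P where
  toFun x := (0, (x.2.2 : M))
  map_add' _ _ := by simp
  map_smul' _ _ := by simp

variable {P}

theorem hdbFst_mem (i : ℤ) (v : HDBSpace g P) (hv : v ∈ hdbGrading g P i) :
    hdbFst g P v ∈ semidirectGrading g P (i + 1) := ⟨hv.1, hv.2.1⟩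

theorem hdbSnd_mem (i : ℤ) (v : HDBSpace g P) (hv : v ∈ hdbGrading g P i) :
    hdbSnd g P v ∈ semidirectGrading g P i := ⟨zero_mem _, hv.2.2⟩

theorem hdbSnd_mem_range (v : HDBSpace g P) :
    hdbSnd g P v ∈ LinearMap.range (semidirectProj g P) :=
  mem_range_semidirectProj.2 ⟨rfl, v.2.2.2⟩

theorem mem_hdbGrading {i : ℤ} {v : HDBSpace g P}
    (h1 : hdbFst g P v ∈ semidirectGrading g P (i + 1))
    (h2 : hdbSnd g P v ∈ semidirectGrading g P i) : v ∈ hdbGrading g P i :=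
  ⟨h1.1, h1.2, h2.2⟩

theorem hdb_ext {v w : HDBSpace g P} (h1 : hdbFst g P v = hdbFst g P w)
    (h2 : hdbSnd g P v = hdbSnd g P w) : v = w :=
  Prod.ext (Prod.ext_iff.1 h1).1 (Prod.ext (Prod.ext_iff.1 h1).2
    (Subtype.ext (Prod.ext_iff.1 h2).2))

variable (P)

/-- The sums `Σ_k B_{m-k}/(k! (m-k)!) [⋯[P [⋯[(D, m), a₁]⋯, a_k], a_{k+1}]⋯, a_m]`. -/
noncomputable def hdbSndMul (m : ℕ) :
    MultilinearMap K (fun _ : Fin (m + 1) => HDBSpace g P) (Semidirect g P) :=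
  ∑ k ∈ Finset.range (m + 1),
    ((bernoulli (m - k) / (k.factorial * (m - k).factorial) : ℚ) : K) •
      nestedProjMul (semidirect g P) (hdbFst g P) (hdbSnd g P) (semidirectProj g P) k m

variable {P}

theorem hdbSndMul_apply (m : ℕ) (u : Fin (m + 1) → HDBSpace g P) :
    hdbSndMul g P m u = ∑ k ∈ Finset.range (m + 1),
      ((bernoulli (m - k) / (k.factorial * (m - k).factorial) : ℚ) : K) •
        nestedProjMul (semidirect g P) (hdbFst g P) (hdbSnd g P) (semidirectProj g P) k m u := by
  rw [hdbSndMul, sum_apply]; rfl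

include hP in
theorem hdbSndMul_mem_range (m : ℕ) (u : Fin (m + 1) → HDBSpace g P) :
    hdbSndMul g P m u ∈ LinearMap.range (semidirectProj g P) := by
  rw [hdbSndMul_apply]
  exact Submodule.sum_mem _ fun k _ => Submodule.smul_mem _ _
    (nestedProjMul_mem_range _ (isLieProjection_semidirectProj hP) (hdbSnd_mem_range g) k m u)

/-- Taylor coefficients whose graded symmetrizations are the higher derived brackets. -/
noncomputable def hdbMul : ∀ n : ℕ, MultilinearMap K (fun _ : Fin n => HDBSpace g P)
    (HDBSpace g P)
  | 0 => 0
  | m + 1 =>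
    ((LinearMap.fst K _ _).compMultilinearMap
        (halfBracketMul (semidirect g P) (hdbFst g P) m)).prod
      (((LinearMap.snd K _ _).compMultilinearMap
        (halfBracketMul (semidirect g P) (hdbFst g P) m)).prod
      (((LinearMap.snd K _ _).compMultilinearMap (hdbSndMul g P m)).codRestrict (LinearMap.range P)
          fun v => (mem_range_semidirectProj.1 (hdbSndMul_mem_range g hP m v)).2))

theorem hdbFst_hdbMul (m : ℕ) (u : Fin (m + 1) → HDBSpace g P) :
    hdbFst g P (hdbMul g hP (m + 1) u) =
      halfBracketMul (semidirect g P) (hdbFst g P) m u := rfl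

theorem hdbSnd_hdbMul (m : ℕ) (u : Fin (m + 1) → HDBSpace g P) :
    hdbSnd g P (hdbMul g hP (m + 1) u) = hdbSndMul g P m u :=
  Prod.ext (mem_range_semidirectProj.1 (hdbSndMul_mem_range g hP m u)).1.symm rfl

theorem isGradedSymmetric_hdbMul :
    IsGradedSymmetric (hdbGrading g P) (hdbGrading g P) 1
      (fun n => gradedSymm (isInternal_hdbGrading g hP) (hdbMul g hP n)) := by
  refine isGradedSymmetric_gradedSymm _ _ fun n d v hv => ?_
  cases n with
  | zero => exact zero_mem _
  | succ m =>
    refine mem_hdbGrading g ?_ ?_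
    · rw [hdbFst_hdbMul, add_assoc]
      exact halfBracketMul_mem _ (hdbFst_mem g) m d v hv
    · rw [hdbSnd_hdbMul, hdbSndMul_apply]
      exact Submodule.sum_mem _ fun k _ => Submodule.smul_mem _ _
        (nestedProjMul_mem _ (hdbFst_mem g) (hdbSnd_mem g) (isLieProjection_semidirectProj hP)
          k m d v hv)

/-- The `L∞[1]` structure on `s⁻¹Der(M/L) × s⁻¹M × A` given by higher derived brackets. -/
noncomputable def hdbStructure [CharZero K] : LInfinityOne (hdbGrading g P) where
  isInternal := isInternal_hdbGrading g hP
  q n := gradedSymm (isInternal_hdbGrading g hP) (hdbMul g hP n)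
  q_zero := by ext1 u; rw [gradedSymm_apply]; simp [hdbMul]
  gradedSymmetric := isGradedSymmetric_hdbMul g hP
  square_zero n d v hv := by
    have hs := isGradedSymmetric_hdbMul g hP
    refine hdb_ext g ?_ ?_
    · rw [map_zero]
      exact (map_square_halfBracket (semidirect g P) (isInternal_hdbGrading g hP) rfl hs le_rfl hv
        (hdbFst_mem g) (hdbFst_hdbMul g hP)).2
    · rw [map_zero]
      exact map_square_derivedBrackets (semidirect g P) (isInternal_hdbGrading g hP) rfl hs le_rfl
        hv (hdbFst_mem g) (hdbFst_hdbMul g hP) (hdbSnd_mem g) (isLieProjection_semidirectProj hP)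
        (fun m u => (hdbSnd_hdbMul g hP m u).trans (hdbSndMul_apply g m u))

end Structures

/-! ### Homotopy transfer -/

section Transfer

variable {K M : Type*} [Field K] [AddCommGroup M] [Module K M] {ℳ : ℤ → Submodule K M}

theorem onBlock_univ {V W : Type*} [AddCommGroup V] [Module K V] [AddCommGroup W] [Module K W]
    (q : ∀ n : ℕ, MultilinearMap K (fun _ : Fin n => V) W) {n : ℕ} (v : Fin n → V) :
    onBlock q v Finset.univ = q n v := by
  refine apply_eq_of_length_eq (fun n u => q n u) (Finset.card_fin n) fun i => ?_
  congr 1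
  have h := Finset.orderEmbOfFin_unique (s := (Finset.univ : Finset (Fin n))) rfl
    (f := fun i => Fin.cast (Finset.card_fin n) i) (fun _ => Finset.mem_univ _) (fun _ _ h => h)
  exact (congrFun h i).symm

/-- The image under a linear map `T` of the nonlinear part of a composition. -/
theorem map_plusComp_gradedSymm [CharZero K] {V W : Type*} [AddCommGroup V] [Module K V]
    [AddCommGroup W] [Module K W] {𝒱 : ℤ → Submodule K V} {𝒲 : ℤ → Submodule K W}
    (h𝒱 : DirectSum.IsInternal 𝒱) (f : ∀ n : ℕ, MultilinearMap K (fun _ : Fin n => V) V)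
    {F : ∀ n : ℕ, MultilinearMap K (fun _ : Fin n => W) V} (hF0 : F 0 = 0)
    (hF : IsGradedSymmetric 𝒲 𝒱 0 F) {n : ℕ} {d : Fin n → ℤ} {w : Fin n → W}
    (hw : ∀ i, w i ∈ 𝒲 (d i)) (T : V →ₗ[K] M)
    (φ : ∀ m : ℕ, MultilinearMap K (fun _ : Fin (m + 1) => V) M)
    (hφ : ∀ m u, T (f (m + 1) u) = φ m u) (Y : Finset (Fin n) → V) :
    T (plusComp (fun n => gradedSymm h𝒱 (f n)) F n d w) =
      (∑ m ∈ Finset.range (n + 1), convPair d (φ m) (onBlock F w) Y).2 Finset.univ -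
        (convPair d (φ 0) (onBlock F w) Y).2 Finset.univ := by
  rw [plusComp_gradedSymm h𝒱 f hF0 hF (N := n + 2) (by omega) hw, map_sum, Finset.sum_filter,
    Finset.sum_range_succ' _ (n + 1), Finset.sum_range_succ' _ n, Finset.sum_range_succ' _ n,
    Prod.snd_add, Pi.add_apply, add_sub_cancel_right, Prod.snd_sum, Finset.sum_apply,
    if_neg (by omega), if_neg (by omega), add_zero, add_zero]
  refine Finset.sum_congr rfl fun m _ => ?_
  rw [if_pos (by omega), map_conv]
  simp only [hφ]
  rfl

/-- `exp(z) ψ(z) = φ(z)` for the generating functions `φ` and `ψ` of the `B_m(1)` and `B_m`. -/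
theorem nilEval_bernoulli' [CharZero K] {E : Type*} [AddCommGroup E] [Module K E] {N : ℕ}
    {z : Module.End K E} (hz : z ^ N = 0) (u : E) :
    nilEval N (bernoulli'PowerSeries K) z u =
      nilEval N (bernoulliPowerSeries K) z (nilEval N (PowerSeries.exp K) z u) := by
  rw [← nilEval_mul _ _ hz, ← bernoulli'_mul_expSubOneDiv, mul_left_comm,
    bernoulli_mul_expSubOneDiv, mul_one]

theorem rightAd_pow_eq_zero (g : GradedLieStructure ℳ) {ι : Type*} [LinearOrder ι] [Fintype ι]
    (d : ι → ℤ) {N : ℕ} (hN : Fintype.card ι < N) {x : Finset ι → M} (hx : x ∅ = 0) :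
    rightAd g d x ^ N = 0 := by
  refine LinearMap.ext fun u => ?_
  have h := rightAd_pow_mem_familiesFrom (K := K) g d hx N (mem_familiesFrom_zero u)
  rw [Nat.zero_add] at h
  exact eq_zero_of_mem_familiesFrom hN h

variable (g : GradedLieStructure ℳ) (P : M →ₗ[K] M)

/-- `v ↦ κ v` in one variable, and zero in the other numbers of variables. -/
noncomputable def linearMul {V : Type*} [AddCommGroup V] [Module K V] (κ : V →ₗ[K] M) :
    ∀ m : ℕ, MultilinearMap K (fun _ : Fin (m + 1) => V) M
  | 0 => unary κ
  | _ + 1 => 0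

theorem sum_convPair_linearMul {V : Type*} [AddCommGroup V] [Module K V] (κ : V →ₗ[K] M)
    {ι : Type*} [LinearOrder ι] [Fintype ι] (d : ι → ℤ) (X Y : Finset ι → V) (N : ℕ) :
    ∑ m ∈ Finset.range (N + 1), convPair d (linearMul κ m) X Y =
      (fun S => κ (Y S), fun S => κ (X S)) := by
  rw [Finset.sum_range_succ', Finset.sum_eq_zero fun m _ => ?_, zero_add]
  · exact convPair_unary d κ X Y
  · exact convPair_zero d X Y

theorem linearMul_mem {V : Type*} [AddCommGroup V] [Module K V] {𝒱 : ℤ → Submodule K V}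
    {κ : V →ₗ[K] M} {e : ℤ} (hκ : ∀ i, ∀ v ∈ 𝒱 i, κ v ∈ ℳ (i + e)) (m : ℕ)
    (d : Fin (m + 1) → ℤ) (v : Fin (m + 1) → V) (hv : ∀ i, v i ∈ 𝒱 (d i)) :
    linearMul κ m v ∈ ℳ ((∑ i, d i) + e) := by
  cases m with
  | zero => rw [Fin.sum_univ_one]; exact hκ _ _ (hv 0)
  | succ m => exact zero_mem _

/-- The maps `1/m! P^⊥ [⋯[(D, m), a₁]⋯, a_m]` with values in `Der(M/L) ⋉ L`. -/
noncomputable def transferSndMul (m : ℕ) :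
    MultilinearMap K (fun _ : Fin (m + 1) => HDBSpace g P) (Semidirect g P) :=
  ((1 / m.factorial : ℚ) : K) • (LinearMap.id - semidirectProj g P).compMultilinearMap
    (nestedMul (semidirect g P) (hdbFst g P) (hdbSnd g P) m)

variable {P} (hP : IsLieProjection g P)

include hP in
theorem transferSndMul_mem_ker (m : ℕ) (u : Fin (m + 1) → HDBSpace g P) :
    transferSndMul g P m u ∈ LinearMap.ker (semidirectProj g P) := by
  refine Submodule.smul_mem _ _ ?_
  change semidirectProj g P (_ - _) = 0
  rw [map_sub, LinearMap.id_apply, (isLieProjection_semidirectProj hP).idem, sub_self]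

theorem transferSndMul_fst (m : ℕ) (u : Fin (m + 1) → HDBSpace g P) :
    (transferSndMul g P m u).1 = (linearMul (hdbFst g P) m u).1 := by
  have h : (transferSndMul g P m u).1 = ((1 / m.factorial : ℚ) : K) •
      (nestedMul (semidirect g P) (hdbFst g P) (hdbSnd g P) m u).1 := by
    change ((1 / m.factorial : ℚ) : K) •
      ((nestedMul (semidirect g P) (hdbFst g P) (hdbSnd g P) m u).1 - 0) = _
    rw [sub_zero]
  rw [h]
  cases m with
  | zero =>
    simp only [Nat.factorial_zero, Nat.cast_one, div_one, Rat.cast_one, one_smul]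
    rfl
  | succ m =>
    rw [nestedMul_succ_fst g (fun _ => rfl), smul_zero]
    rfl

theorem sum_convPair_transferSndMul [CharZero K] {ι : Type*} [LinearOrder ι] [Fintype ι]
    (d : ι → ℤ) (X Y : Finset ι → HDBSpace g P) (N : ℕ) :
    (∑ m ∈ Finset.range N, convPair d (transferSndMul g P m) X Y).2 =
      (LinearMap.id - semidirectProj g P).compLeft _ (nilEval N (PowerSeries.exp K)
        (rightAd (semidirect g P) d (fun S => hdbSnd g P (X S))) (fun S => hdbFst g P (X S))) := by
  rw [nilEval_apply, map_sum, Prod.snd_sum]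
  refine Finset.sum_congr rfl fun m _ => ?_
  have h : (transferSndMul g P m : (Fin (m + 1) → HDBSpace g P) → Semidirect g P) =
      fun u => ((1 / m.factorial : ℚ) : K) • (LinearMap.id - semidirectProj g P).compMultilinearMap
        (nestedMul (semidirect g P) (hdbFst g P) (hdbSnd g P) m) u := rfl
  rw [h, convPair_smul, convPair_comp, convPair_nestedMul, Prod.smul_snd, map_smul,
    PowerSeries.coeff_exp, eq_ratCast, LinearMap.prodMap_apply, dualAd, dualEnd_pow_snd]

/-- Taylor coefficients whose graded symmetrizations are those of the morphism from the structure
of higher derived brackets to the extension of the mapping cocylinder. -/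
noncomputable def transferMul : ∀ n : ℕ, MultilinearMap K (fun _ : Fin n => HDBSpace g P)
    (CocylSpace g P)
  | 0 => 0
  | m + 1 =>
    ((LinearMap.fst K _ _).compMultilinearMap (linearMul (hdbFst g P) m)).prod
      (((LinearMap.snd K _ _).compMultilinearMap (linearMul (hdbFst g P) m)).prod
      ((((LinearMap.snd K _ _).compMultilinearMap (transferSndMul g P m)).codRestrict
        (LinearMap.ker P) fun v => mem_ker_semidirectProj.1 (transferSndMul_mem_ker g hP m v)).prod
      ((LinearMap.snd K _ _).compMultilinearMap (linearMul (hdbSnd g P) m))))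

theorem cocylFst_transferMul (m : ℕ) (u : Fin (m + 1) → HDBSpace g P) :
    cocylFst g P (transferMul g hP (m + 1) u) = linearMul (hdbFst g P) m u := rfl

theorem cocylSnd_transferMul (m : ℕ) (u : Fin (m + 1) → HDBSpace g P) :
    cocylSnd g P (transferMul g hP (m + 1) u) = transferSndMul g P m u :=
  Prod.ext (transferSndMul_fst g m u).symm rfl

theorem cocylPath_transferMul (m : ℕ) (u : Fin (m + 1) → HDBSpace g P) :
    cocylPath g P (transferMul g hP (m + 1) u) = linearMul (hdbSnd g P) m u := by
  cases m with
  | zero => rfl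
  | succ m => rfl

/-- The Taylor coefficients of the morphism from the structure of higher derived brackets to the
extension of the mapping cocylinder. -/
noncomputable def transferMap (n : ℕ) :
    MultilinearMap K (fun _ : Fin n => HDBSpace g P) (CocylSpace g P) :=
  gradedSymm (isInternal_hdbGrading g hP) (transferMul g hP n)

theorem transferMap_zero : transferMap g hP 0 = 0 := by
  ext1 u; rw [transferMap, gradedSymm_apply]; simp [transferMul]

theorem isGradedSymmetric_transferMap :
    IsGradedSymmetric (hdbGrading g P) (cocylGrading g P) 0 (transferMap g hP) := by
  refine isGradedSymmetric_gradedSymm _ _ fun n d v hv => ?_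
  cases n with
  | zero => exact zero_mem _
  | succ m =>
    rw [add_zero]
    refine mem_cocylGrading g ?_ ?_ ?_
    · rw [cocylFst_transferMul]
      exact linearMul_mem (hdbFst_mem g) m d v hv
    · rw [cocylSnd_transferMul]
      refine Submodule.smul_mem _ _ ?_
      have h := nestedMul_mem (semidirect g P) (hdbFst_mem g) (hdbSnd_mem g) m d v hv
      exact sub_mem h ((isLieProjection_semidirectProj hP).map_mem h)
    · rw [cocylPath_transferMul]
      have := linearMul_mem (ℳ := semidirectGrading g P) (κ := hdbSnd g P) (e := 0)
        (fun i v hv => by rw [add_zero]; exact hdbSnd_mem g i v hv) m d v hv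
      rwa [add_zero] at this

theorem cocylSnd_retrIncl (w : HDBSpace g P) : cocylSnd g P (retrIncl hP w) =
    hdbFst g P w - semidirectProj g P (hdbFst g P w) :=
  Prod.ext (sub_zero _).symm rfl

theorem cocylSnd_retrHomotopy (v : CocylSpace g P) : cocylSnd g P (retrHomotopy hP v) =
    cocylPath g P v - semidirectProj g P (cocylPath g P v) :=
  Prod.ext (sub_zero _).symm rfl

theorem hdbSnd_retrProj (v : CocylSpace g P) : hdbSnd g P (retrProj g P v) =
    semidirectProj g P (cocylPath g P v) := rfl

include hP in
theorem projection_hdbSnd (w : HDBSpace g P) :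
    semidirectProj g P (hdbSnd g P w) = hdbSnd g P w := by
  obtain ⟨y, hy⟩ := hdbSnd_mem_range g w
  rw [← hy, (isLieProjection_semidirectProj hP).idem]

theorem transferMap_one (w : Fin 1 → HDBSpace g P) :
    transferMap g hP 1 w = retrIncl hP (w 0) := by
  have hw : w = fun _ => w 0 := funext fun i => by rw [Subsingleton.elim i 0]
  rw [hw, transferMap, gradedSymm_one]
  refine cocyl_ext g ?_ ?_ ?_
  · rw [cocylFst_transferMul]; rfl
  · rw [cocylSnd_transferMul, cocylSnd_retrIncl]
    change ((1 / (0).factorial : ℚ) : K) • (hdbFst g P (w 0) - _) = _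
    simp only [Nat.factorial_zero, Nat.cast_one, div_one, Rat.cast_one, one_smul]
    rfl
  · rw [cocylPath_transferMul]; rfl

variable [CharZero K]

theorem cocylStructure_linear (v : CocylSpace g P) :
    (cocylStructure g hP).linear v = (0, 0, 0, v.2.1 - v.2.2.1) := by
  change gradedSymm (isInternal_cocylGrading g hP) (cocylMul g hP 1) (fun _ => v) = _
  rw [gradedSymm_one]
  refine cocyl_ext g ?_ ?_ ?_
  · rw [cocylFst_cocylMul]; rfl
  · rw [cocylSnd_cocylMul]; rfl
  · rw [cocylPath_cocylMul]
    have h : cocylPathMul g P 0 (fun _ => v) =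
      ((bernoulli' 0 / (0).factorial : ℚ) : K) • cocylFst g P v -
        ((bernoulli 0 / (0).factorial : ℚ) : K) • cocylSnd g P v := rfl
    rw [h]
    simp only [bernoulli'_zero, bernoulli_zero, Nat.factorial_zero, Nat.cast_one, div_one,
      Rat.cast_one, one_smul]
    exact Prod.ext (sub_self _) rfl

theorem hdbStructure_linear (w : HDBSpace g P) :
    (hdbStructure g hP).linear w = (0, 0, P.rangeRestrict w.2.1) := by
  change gradedSymm (isInternal_hdbGrading g hP) (hdbMul g hP 1) (fun _ => w) = _
  rw [gradedSymm_one]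
  refine hdb_ext g ?_ ?_
  · rw [hdbFst_hdbMul]; rfl
  · rw [hdbSnd_hdbMul, hdbSndMul_apply, Finset.sum_range_one]
    simp only [bernoulli_zero, Nat.factorial_zero, Nat.cast_one, div_one, mul_one,
      Rat.cast_one, one_smul, Nat.sub_self]
    rfl

theorem isHomotopyRetraction : IsHomotopyRetraction (cocylStructure g hP) (hdbStructure g hP)
    (retrProj g P) (retrIncl hP) (retrHomotopy hP) where
  π_mem hv := ⟨hv.1, hv.2.1, hP.map_mem hv.2.2.2⟩
  f₁_mem hw := ⟨hw.1, hw.2.1, sub_mem hw.2.1 (hP.map_mem hw.2.1), hw.2.2⟩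
  h_mem {i v} hv := by
    have h : ∀ x : M, x ∈ ℳ i → x - P x ∈ ℳ (i - 1 + 1) := fun x hx => by
      rw [sub_add_cancel]; exact sub_mem hx (hP.map_mem hx)
    exact ⟨zero_mem _, zero_mem _, h _ hv.2.2.2, zero_mem _⟩
  π_comm v := by
    rw [cocylStructure_linear, hdbStructure_linear]
    refine Prod.ext rfl (Prod.ext rfl (Subtype.ext ?_))
    change P (v.2.1 - v.2.2.1) = P v.2.1
    rw [map_sub, LinearMap.mem_ker.1 v.2.2.1.2, sub_zero]
  f₁_comm w := by
    rw [cocylStructure_linear, hdbStructure_linear]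
    refine Prod.ext rfl (Prod.ext rfl (Prod.ext (map_zero _) ?_))
    change P w.2.1 = w.2.1 - (w.2.1 - P w.2.1)
    rw [sub_sub_cancel]
  π_f₁ w := by
    obtain ⟨y, hy⟩ := w.2.2.2
    refine Prod.ext rfl (Prod.ext rfl (Subtype.ext ?_))
    change P (w.2.2 : M) = w.2.2
    rw [← hy, hP.idem]
  homotopy v := by
    rw [cocylStructure_linear, cocylStructure_linear]
    refine Prod.ext ?_ (Prod.ext ?_ (Prod.ext (Subtype.ext ?_) ?_))
    · change (0 : relDer g P) + 0 = v.1 - v.1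
      rw [sub_self, add_zero]
    · change (0 : M) + 0 = v.2.1 - v.2.1
      rw [sub_self, add_zero]
    · change (v.2.1 - v.2.2.1 - P (v.2.1 - v.2.2.1) : M) + 0 = v.2.1 - P v.2.1 - v.2.2.1
      rw [map_sub, LinearMap.mem_ker.1 v.2.2.1.2]
      abel
    · change (0 : M) + (0 - (v.2.2.2 - P v.2.2.2)) = P v.2.2.2 - v.2.2.2
      abel

section Values

variable {n : ℕ} {d : Fin n → ℤ} {w : Fin n → HDBSpace g P} (hw : ∀ i, w i ∈ hdbGrading g P (d i))
include hw

theorem cocylFst_onBlock_transferMap :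
    (fun S => cocylFst g P (onBlock (transferMap g hP) w S)) =
      fun S => hdbFst g P (singles w S) := by
  have h := map_onBlock_gradedSymm (isInternal_hdbGrading g hP) (f := transferMul g hP) rfl le_rfl
    hw (cocylFst g P) _ (cocylFst_transferMul g hP) 0
  rw [sum_convPair_linearMul] at h
  exact h

theorem cocylPath_onBlock_transferMap :
    (fun S => cocylPath g P (onBlock (transferMap g hP) w S)) =
      fun S => hdbSnd g P (singles w S) := by
  have h := map_onBlock_gradedSymm (isInternal_hdbGrading g hP) (f := transferMul g hP) rfl le_rfl
    hw (cocylPath g P) _ (cocylPath_transferMul g hP) 0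
  rw [sum_convPair_linearMul] at h
  exact h

theorem cocylSnd_onBlock_transferMap :
    (fun S => cocylSnd g P (onBlock (transferMap g hP) w S)) =
      (LinearMap.id - semidirectProj g P).compLeft _ (nilEval (n + 1) (PowerSeries.exp K)
        (rightAd (semidirect g P) d (fun S => hdbSnd g P (singles w S)))
        (fun S => hdbFst g P (singles w S))) := by
  have h := map_onBlock_gradedSymm (isInternal_hdbGrading g hP) (f := transferMul g hP) rfl le_rfl
    hw (cocylSnd g P) _ (cocylSnd_transferMul g hP) 0
  rw [sum_convPair_transferSndMul] at h
  exact h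

theorem hdbSnd_hdbStructure : hdbSnd g P ((hdbStructure g hP).q n w) =
    nilEval (n + 1) (bernoulliPowerSeries K)
      (rightAd (semidirect g P) d (fun S => hdbSnd g P (singles w S)))
      ((semidirectProj g P).compLeft _ (nilEval (n + 1) (PowerSeries.exp K)
        (rightAd (semidirect g P) d (fun S => hdbSnd g P (singles w S)))
        (fun S => hdbFst g P (singles w S)))) Finset.univ := by
  have h := map_onBlock_gradedSymm (isInternal_hdbGrading g hP) (f := hdbMul g hP) rfl le_rfl
    hw (hdbSnd g P) _ (hdbSnd_hdbMul g hP) 0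
  have hx0 : hdbSnd g P (singles w ∅) = 0 := by
    rw [singles_of_card_ne_one w (by simp), map_zero]
  simp only [hdbSndMul] at h
  rw [sum_convPair_derivedBrackets (semidirect g P) d (hdbFst g P) (hdbSnd g P)
    (semidirectProj g P) hx0 (map_zero _) (by rw [Fintype.card_fin]; omega), dualAd,
    nilEval_dualEnd_snd, LinearMap.prodMap_apply, nilEval_dualEnd_snd] at h
  have h' := congrFun h Finset.univ
  rw [onBlock_univ] at h'
  exact h'

theorem hdbFst_hdbStructure : hdbFst g P ((hdbStructure g hP).q n w) =
    (-(2⁻¹ : K) • convBilin d 1 (semidirect g P).bracket (fun S => hdbFst g P (singles w S))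
      (fun S => hdbFst g P (singles w S))) Finset.univ := by
  have h := (map_square_halfBracket (semidirect g P) (isInternal_hdbGrading g hP) rfl
    (isGradedSymmetric_hdbMul g hP) le_rfl hw (hdbFst_mem g) (hdbFst_hdbMul g hP)).1
  have h' := congrFun h Finset.univ
  rw [onBlock_univ] at h'
  exact h'

theorem cocylFst_plusComp (hn : 2 ≤ n) :
    cocylFst g P (plusComp (cocylStructure g hP).q (transferMap g hP) n d w) =
      hdbFst g P ((hdbStructure g hP).q n w) := by
  have h := map_plusComp_gradedSymm (isInternal_cocylGrading g hP) (cocylMul g hP)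
    (F := transferMap g hP) (transferMap_zero g hP) (isGradedSymmetric_transferMap g hP) hw
    (cocylFst g P) (halfBracketMul (semidirect g P) (cocylFst g P)) (cocylFst_cocylMul g hP) 0
  have hX : IsFamily d (semidirectGrading g P) 1 (fun S => hdbFst g P (singles w S)) :=
    isFamily_comp (e := 1) (a := 0) (ℳ := semidirectGrading g P) (𝒱 := hdbGrading g P)
      (hdbFst_mem g) (isFamily_singles hw)
  have hXF := cocylFst_onBlock_transferMap g hP hw
  have h0 : convPair d (halfBracketMul (semidirect g P) (cocylFst g P) 0)
      (onBlock (transferMap g hP) w) 0 = 0 := convPair_zero _ _ _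
  rw [sum_convPair_halfBracketMul (semidirect g P) (by rw [hXF]; exact hX)
    (fun S => by simp) (by omega), h0, hXF] at h
  rw [hdbFst_hdbStructure g hP hw]
  exact h.trans (sub_zero _)

theorem cocylPath_plusComp (hn : 2 ≤ n) :
    cocylPath g P (plusComp (cocylStructure g hP).q (transferMap g hP) n d w) =
      hdbSnd g P ((hdbStructure g hP).q n w) +
        cocylSnd g P (transferMap g hP n w) := by
  have h := map_plusComp_gradedSymm (isInternal_cocylGrading g hP) (cocylMul g hP)
    (F := transferMap g hP) (transferMap_zero g hP) (isGradedSymmetric_transferMap g hP) hw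
    (cocylPath g P) (cocylPathMul g P) (cocylPath_cocylMul g hP) 0
  have hx0 : hdbSnd g P (singles w ∅) = 0 := by
    rw [singles_of_card_ne_one w (by simp), map_zero]
  have hs : singles w Finset.univ = 0 :=
    singles_of_card_ne_one w (by rw [Finset.card_fin]; omega)
  have hz := rightAd_pow_eq_zero (K := K) (semidirect g P) d (N := n + 1)
    (by rw [Fintype.card_fin]; omega) (x := fun S => hdbSnd g P (singles w S)) hx0
  have hF := congrFun (cocylSnd_onBlock_transferMap g hP hw) Finset.univ
  rw [onBlock_univ] at hF
  -- the linear term is `κ - κ'`, and `κ` vanishes on sets which are not singletons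
  have h0 : (convPair d (cocylPathMul g P 0) (onBlock (transferMap g hP) w) 0).2 Finset.univ =
      -cocylSnd g P (transferMap g hP n w) := by
    have h1 := sum_convPair_cocylinder (semidirect g P) d (cocylFst g P) (cocylSnd g P)
      (cocylPath g P) (onBlock (transferMap g hP) w) 0 1
    have h2 := congrFun (cocylFst_onBlock_transferMap g hP hw) Finset.univ
    simp only [onBlock_univ, hs, map_zero] at h2
    rw [Finset.sum_range_one] at h1
    rw [cocylPathMul, h1]
    simp only [Finset.sum_range_one, nilEval_apply, pow_zero, Module.End.one_apply,
      bernoulli'PowerSeries, bernoulliPowerSeries, PowerSeries.coeff_mk, bernoulli'_zero,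
      bernoulli_zero, Nat.factorial_zero, Nat.cast_one, div_one, map_one, one_smul,
      Prod.snd_sub, Pi.sub_apply, onBlock_univ, h2, zero_sub]
  rw [h0, sub_neg_eq_add] at h
  refine h.trans ?_
  congr 1
  simp only [cocylPathMul]
  rw [sum_convPair_cocylinder, Prod.snd_sub, dualAd, nilEval_dualEnd_snd, nilEval_dualEnd_snd,
    cocylFst_onBlock_transferMap g hP hw, cocylSnd_onBlock_transferMap g hP hw,
    cocylPath_onBlock_transferMap g hP hw, nilEval_bernoulli' hz, ← map_sub,
    hdbSnd_hdbStructure g hP hw]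
  refine congrFun (congrArg _ (funext fun S => ?_)) _
  exact sub_sub_cancel _ _

end Values

theorem isHomotopyTransfer : IsHomotopyTransfer (cocylStructure g hP) (hdbStructure g hP)
    (retrProj g P) (retrIncl hP) (retrHomotopy hP) := by
  refine ⟨isHomotopyRetraction g hP, transferMap g hP, transferMap_zero g hP,
    isGradedSymmetric_transferMap g hP, transferMap_one g hP, ?_, ?_⟩
  · intro n hn d w hw
    have hR := projection_hdbSnd g hP ((hdbStructure g hP).q n w)
    have hF := LinearMap.mem_ker.1 (cocylSnd_mem_ker g (transferMap g hP n w))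
    have hs : singles w Finset.univ = 0 :=
      singles_of_card_ne_one w (by rw [Finset.card_fin]; omega)
    have h1 := congrFun (cocylFst_onBlock_transferMap g hP hw) Finset.univ
    have h2 := congrFun (cocylPath_onBlock_transferMap g hP hw) Finset.univ
    simp only [onBlock_univ, hs, map_zero] at h1 h2
    refine cocyl_ext g ?_ ?_ ?_
    · rw [h1]; rfl
    · rw [cocylSnd_retrHomotopy, cocylPath_plusComp g hP hw hn, map_add, hR, hF, add_zero,
        add_sub_cancel_left]
    · rw [h2]; rfl
  · intro n hn d w hw
    refine hdb_ext g ?_ ?_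
    · exact (cocylFst_plusComp g hP hw hn).symm
    · rw [hdbSnd_retrProj, cocylPath_plusComp g hP hw hn, map_add, projection_hdbSnd g hP,
        LinearMap.mem_ker.1 (cocylSnd_mem_ker g (transferMap g hP n w)), add_zero]

end Transfer

/-! ### Values on nested brackets -/

section NestedValues

variable {K M V : Type*} [Field K] [AddCommGroup M] [Module K M] [AddCommGroup V] [Module K V]
  {ℳ : ℤ → Submodule K M} (g : GradedLieStructure ℳ) (κ ν : V →ₗ[K] M)

theorem nestedMul_eq_nested (m : ℕ) (u : Fin (m + 1) → V) :
    nestedMul g κ ν m u = g.nested (κ (u 0)) (List.ofFn fun i : Fin m => ν (u i.succ)) := by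
  induction m with
  | zero => rfl
  | succ m ih =>
    rw [nestedMul, bracketSnoc_apply, ih, List.ofFn_succ', List.concat_eq_append,
      GradedLieStructure.nested, GradedLieStructure.nested, List.foldl_append]
    rfl

theorem nestedProjMul_eq_nested (P : M →ₗ[K] M) {k m : ℕ} (hk : k ≤ m) (u : Fin (m + 1) → V) :
    nestedProjMul g κ ν P k m u =
      g.nested (P (g.nested (κ (u 0)) ((List.ofFn fun i : Fin m => ν (u i.succ)).take k)))
        ((List.ofFn fun i : Fin m => ν (u i.succ)).drop k) := by
  induction m with
  | zero =>
    obtain rfl : k = 0 := by omega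
    rfl
  | succ m ih =>
    rw [nestedProjMul]
    split_ifs with h
    · subst h
      rw [List.take_of_length_le (by simp), List.drop_of_length_le (by simp),
        ← nestedMul_eq_nested]
      rfl
    · have hk' : k ≤ (List.ofFn fun i : Fin m => ν (u i.castSucc.succ)).length := by
        rw [List.length_ofFn]; omega
      rw [bracketSnoc_apply, ih (by omega), List.ofFn_succ', List.concat_eq_append,
        List.take_append_of_le_length hk', List.drop_append_of_le_length hk']
      simp only [GradedLieStructure.nested, List.foldl_append]
      rfl

theorem nestedMul_eq_zero_of_left (m : ℕ) {u : Fin (m + 1) → V} (h : κ (u 0) = 0) :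
    nestedMul g κ ν m u = 0 := by
  induction m with
  | zero => exact h
  | succ m ih => rw [nestedMul, bracketSnoc_apply, ih h, map_zero, LinearMap.zero_apply]

theorem nestedProjMul_eq_zero_of_left (P : M →ₗ[K] M) (k m : ℕ) {u : Fin (m + 1) → V}
    (h : κ (u 0) = 0) : nestedProjMul g κ ν P k m u = 0 := by
  have hn : ∀ m (u : Fin (m + 1) → V), κ (u 0) = 0 →
      P.compMultilinearMap (nestedMul g κ ν m) u = 0 := fun m u h => by
    rw [LinearMap.compMultilinearMap_apply, nestedMul_eq_zero_of_left g κ ν m h, map_zero]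
  induction m with
  | zero =>
    rw [nestedProjMul]
    split_ifs
    · exact hn 0 u h
    · rfl
  | succ m ih =>
    rw [nestedProjMul]
    split_ifs
    · exact hn _ u h
    · rw [bracketSnoc_apply, ih h, map_zero, LinearMap.zero_apply]

theorem nestedMul_eq_zero_of_right (m : ℕ) {u : Fin (m + 1) → V} {i : Fin (m + 1)} (hi : i ≠ 0)
    (h : ν (u i) = 0) : nestedMul g κ ν m u = 0 := by
  induction m with
  | zero => exact absurd (Fin.ext (by omega)) hi
  | succ m ih =>
    rw [nestedMul, bracketSnoc_apply]
    induction i using Fin.lastCases with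
    | last => rw [LinearMap.compl₂_apply, h, map_zero]
    | cast j =>
      rw [ih (u := Fin.init u) (i := j) (fun hj => hi (by rw [hj]; rfl)) h, map_zero,
        LinearMap.zero_apply]

theorem nestedProjMul_eq_zero_of_right (P : M →ₗ[K] M) (k m : ℕ) {u : Fin (m + 1) → V}
    {i : Fin (m + 1)} (hi : i ≠ 0) (h : ν (u i) = 0) : nestedProjMul g κ ν P k m u = 0 := by
  induction m with
  | zero => exact absurd (Fin.ext (by omega)) hi
  | succ m ih =>
    rw [nestedProjMul]
    split_ifs
    · rw [LinearMap.compMultilinearMap_apply, nestedMul_eq_zero_of_right g κ ν _ hi h, map_zero]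
    · rw [bracketSnoc_apply]
      induction i using Fin.lastCases with
      | last => rw [LinearMap.compl₂_apply, h, map_zero]
      | cast j =>
        rw [ih (u := Fin.init u) (i := j) (fun hj => hi (by rw [hj]; rfl)) h, map_zero,
          LinearMap.zero_apply]

theorem halfBracketMul_eq_zero (m : ℕ) {u : Fin (m + 1) → V} (i : Fin (m + 1))
    (h : κ (u i) = 0) : halfBracketMul g κ m u = 0 := by
  match m with
  | 0 => rfl
  | m + 2 => rfl
  | 1 =>
    change (2⁻¹ : K) • g.bracket (paritySign g.isInternal (κ (u 0))) (κ (u 1)) = 0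
    fin_cases i
    · simp only [Fin.zero_eta, Fin.isValue] at h
      rw [h, map_zero, map_zero, LinearMap.zero_apply, smul_zero]
    · simp only [Fin.mk_one, Fin.isValue] at h
      rw [h, map_zero, smul_zero]

theorem nested_add (x y : M) (l : List M) : g.nested (x + y) l = g.nested x l + g.nested y l := by
  induction l generalizing x y with
  | nil => rfl
  | cons a l ih =>
    simp only [GradedLieStructure.nested, List.foldl_cons, map_add, LinearMap.add_apply] at ih ⊢
    exact ih _ _

theorem nested_zero (l : List M) : g.nested 0 l = 0 := by
  have := nested_add g 0 0 l
  rwa [add_zero, left_eq_add] at this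

theorem nestedDer_zero (l : List M) : g.nestedDer 0 l = 0 := by
  cases l with
  | nil => rfl
  | cons a l => exact nested_zero g l

variable {P : M →ₗ[K] M}

theorem nested_semidirect_inr (x : M) (l : List M) :
    (semidirect g P).nested (0, x) (l.map fun a => (0, a)) = (0, g.nested x l) := by
  induction l generalizing x with
  | nil => rfl
  | cons a l ih =>
    have h := ih (g.bracket x a)
    simp only [GradedLieStructure.nested, List.map_cons, List.foldl_cons] at h ⊢
    rw [semidirect_bracket_inr_right, ← h]
    simp

theorem nested_semidirect (x : Semidirect g P) {l : List M} (hl : l ≠ []) :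
    (semidirect g P).nested x (l.map fun a => (0, a)) =
      (0, g.nestedDer x.1.val l + g.nested x.2 l) := by
  cases l with
  | nil => exact absurd rfl hl
  | cons a l =>
    have h := nested_semidirect_inr g (P := P) (x.1.val a + g.bracket x.2 a) l
    rw [nested_add] at h
    rw [List.map_cons, GradedLieStructure.nested, List.foldl_cons, semidirect_bracket_inr_right]
    exact h

theorem semidirectProj_nested (x : Semidirect g P) (l : List M) :
    semidirectProj g P ((semidirect g P).nested x (l.map fun a => (0, a))) =
      (0, P (g.nestedDer x.1.val l + g.nested x.2 l)) := by
  by_cases hl : l = []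
  · subst hl
    rw [semidirectProj_apply]
    simp [GradedLieStructure.nested, GradedLieStructure.nestedDer]
  · rw [nested_semidirect g x hl]; rfl

end NestedValues

/-! ### Values of graded symmetrizations -/

section SymmetrizationValues

variable {K V W : Type*} [Field K] [AddCommGroup V] [Module K V] [AddCommGroup W] [Module K W]
  {𝒱 : ℤ → Submodule K V} (h𝒱 : DirectSum.IsInternal 𝒱)

/-- If `f` vanishes unless the distinguished vector `x` comes first, only the permutations of the
other arguments contribute to the symmetrization. -/
theorem gradedSymm_cons {n : ℕ} (f : MultilinearMap K (fun _ : Fin (n + 1) => V) W) {x : V}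
    {u : Fin n → V} {e : ℤ} {d : Fin n → ℤ} (hx : x ∈ 𝒱 e) (hu : ∀ i, u i ∈ 𝒱 (d i))
    (hf : ∀ ρ : Equiv.Perm (Fin (n + 1)), ρ 0 ≠ 0 →
      f (fun i => Fin.cons (α := fun _ => V) x u (ρ i)) = 0) :
    gradedSymm h𝒱 f (Fin.cons x u) = ∑ σ : Equiv.Perm (Fin n),
      koszulSign d σ • f (Fin.cons x fun i => u (σ i)) := by
  rw [gradedSymm_of_mem h𝒱 f (d := Fin.cons e d) (Fin.cases hx hu),
    ← Equiv.Perm.decomposeFin.symm.sum_comp, Fintype.sum_prod_type, Finset.sum_eq_single 0]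
  · refine Finset.sum_congr rfl fun σ _ => ?_
    congr 1
    · rw [koszulSign_decomposeFin]; rfl
    · congr 1
      funext i
      refine Fin.cases ?_ (fun i => ?_) i
      · simp
      · simp
  · intro p _ hp
    refine Finset.sum_eq_zero fun σ _ => ?_
    rw [hf _ (by simpa using hp), smul_zero]
  · simp

/-- A symmetrization vanishes if every rearrangement of the even and odd parts of its arguments
is sent to zero. -/
theorem gradedSymm_eq_zero {n : ℕ} (f : MultilinearMap K (fun _ : Fin n => V) W) (v : Fin n → V)
    (hf : ∀ (p : Fin n → Bool) (σ : Equiv.Perm (Fin n)),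
      f (fun i => parityPart h𝒱 (p (σ i)) (v (σ i))) = 0) : gradedSymm h𝒱 f v = 0 := by
  rw [gradedSymm_apply]
  exact Finset.sum_eq_zero fun p _ => Finset.sum_eq_zero fun σ _ => by rw [hf, smul_zero]

/-- The bracket of two arguments of degrees `d₀ + 1` and `d₁ + 1`, as a graded symmetric
operation. -/
theorem sum_perm_halfBracketMul [CharZero K] {M : Type*} [AddCommGroup M] [Module K M]
    {ℳ : ℤ → Submodule K M} (g : GradedLieStructure ℳ) {κ : V →ₗ[K] M}
    (hκ : ∀ i, ∀ v ∈ 𝒱 i, κ v ∈ ℳ (i + 1)) {d : Fin 2 → ℤ} {v : Fin 2 → V}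
    (hv : ∀ i, v i ∈ 𝒱 (d i)) :
    ∑ σ : Equiv.Perm (Fin 2), koszulSign d σ • halfBracketMul g κ 1 (fun i => v (σ i)) =
      (d 0 + 1).negOnePow • g.bracket (κ (v 0)) (κ (v 1)) := by
  have h : ∀ σ : Equiv.Perm (Fin 2), halfBracketMul g κ 1 (fun i => v (σ i)) =
      (2⁻¹ : K) • (d (σ 0) + 1).negOnePow • g.bracket (κ (v (σ 0))) (κ (v (σ 1))) := by
    intro σ
    change (2⁻¹ : K) • g.bracket (paritySign g.isInternal (κ (v (σ 0)))) (κ (v (σ 1))) = _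
    rw [paritySign_of_mem _ (hκ _ _ (hv (σ 0))), map_units_smul_apply]
  have huniv : (Finset.univ : Finset (Equiv.Perm (Fin 2))) = {1, Equiv.swap 0 1} := by decide
  have hswap : koszulSign d (Equiv.swap 0 1) = (d 0 * d 1).negOnePow := by
    have hf : (Finset.univ.filter fun p : Fin 2 × Fin 2 => p.1 < p.2 ∧
        Equiv.swap (0 : Fin 2) 1 p.2 < Equiv.swap (0 : Fin 2) 1 p.1) = {(0, 1)} := by decide
    rw [koszulSign, hf, Finset.prod_singleton, Equiv.swap_apply_left, Equiv.swap_apply_right,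
      mul_comm]
  rw [huniv, Finset.sum_pair (by decide), koszulSign_one, hswap, h, h, one_smul,
    Equiv.swap_apply_left, Equiv.swap_apply_right, Equiv.Perm.one_apply, Equiv.Perm.one_apply,
    g.bracket_skew (hκ _ _ (hv 1)) (hκ _ _ (hv 0))]
  have hsign : (d 0 * d 1).negOnePow * ((d 1 + 1).negOnePow * ((d 1 + 1) * (d 0 + 1)).negOnePow) =
      -(d 0 + 1).negOnePow := by
    simp only [← Int.negOnePow_add]
    rw [show d 0 * d 1 + (d 1 + 1 + (d 1 + 1) * (d 0 + 1)) =
      (d 0 + 1) + 1 + 2 * (d 0 * d 1 + d 1) by ring, Int.negOnePow_add, Int.negOnePow_add (d 0 + 1),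
      Int.negOnePow_even (2 * _) (even_two_mul _), Int.negOnePow_one]
    simp
  rw [smul_comm (d 0 * d 1).negOnePow, smul_neg, smul_neg, smul_smul, smul_smul, mul_assoc, hsign,
    Units.neg_smul, neg_neg, ← add_smul]
  rw [show (2⁻¹ : K) + 2⁻¹ = 1 by norm_num, one_smul]

end SymmetrizationValues

/-! ### Taylor coefficients of the extension of the mapping cocylinder -/

section CocylValues

variable {K M : Type*} [Field K] [AddCommGroup M] [Module K M] {ℳ : ℤ → Submodule K M}
  (g : GradedLieStructure ℳ) {P : M →ₗ[K] M} (hP : IsLieProjection g P)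

theorem cocylMul_eq_zero {m : ℕ} {u : Fin (m + 1) → CocylSpace g P}
    (h1 : halfBracketMul (semidirect g P) (cocylFst g P) m u = 0)
    (h2 : halfBracketMul (semidirect g P) (cocylSnd g P) m u = 0)
    (h3 : cocylPathMul g P m u = 0) : cocylMul g hP (m + 1) u = 0 := by
  refine cocyl_ext g ?_ ?_ ?_
  · rw [cocylFst_cocylMul, h1, map_zero]
  · rw [cocylSnd_cocylMul, h2, map_zero]
  · rw [cocylPath_cocylMul, h3, map_zero]

theorem cocylPathMul_apply (m : ℕ) (u : Fin (m + 1) → CocylSpace g P) : cocylPathMul g P m u =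
    ((bernoulli' m / m.factorial : ℚ) : K) •
        nestedMul (semidirect g P) (cocylFst g P) (cocylPath g P) m u -
      ((bernoulli m / m.factorial : ℚ) : K) •
        nestedMul (semidirect g P) (cocylSnd g P) (cocylPath g P) m u := rfl

theorem cocylMul_eq_zero_of_head {m : ℕ} {u : Fin (m + 1) → CocylSpace g P}
    (h1 : cocylFst g P (u 0) = 0) (h2 : cocylSnd g P (u 0) = 0) :
    cocylMul g hP (m + 1) u = 0 := by
  refine cocylMul_eq_zero g hP (halfBracketMul_eq_zero _ _ m 0 h1)
    (halfBracketMul_eq_zero _ _ m 0 h2) ?_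
  rw [cocylPathMul_apply, nestedMul_eq_zero_of_left _ _ _ m h1,
    nestedMul_eq_zero_of_left _ _ _ m h2, smul_zero, smul_zero, sub_zero]

theorem cocylPathMul_eq_zero_of_right {m : ℕ} {u : Fin (m + 1) → CocylSpace g P}
    {i : Fin (m + 1)} (hi : i ≠ 0) (h : cocylPath g P (u i) = 0) : cocylPathMul g P m u = 0 := by
  rw [cocylPathMul_apply, nestedMul_eq_zero_of_right _ _ _ m hi h,
    nestedMul_eq_zero_of_right _ _ _ m hi h, smul_zero, smul_zero, sub_zero]

/-- If two arguments have no component in `M`, then one of them is not in the first place. -/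
theorem cocylPathMul_eq_zero_of_two {n : ℕ} {u : Fin (n + 1) → CocylSpace g P} {i j : Fin (n + 1)}
    (hij : i ≠ j) (hi : cocylPath g P (u i) = 0) (hj : cocylPath g P (u j) = 0) :
    cocylPathMul g P n u = 0 := by
  by_cases h : i = 0
  · exact cocylPathMul_eq_zero_of_right g (fun h' => hij (h.trans h'.symm)) hj
  · exact cocylPathMul_eq_zero_of_right g h hi

theorem cocylMul_cons {i : ℕ} (hi : 1 ≤ i) (x : CocylSpace g P) (n : Fin i → M) :
    cocylMul g hP (i + 1)
        (Fin.cons (α := fun _ => CocylSpace g P) x fun j => (0, 0, 0, n j)) =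
      (0, 0, 0,
        ((bernoulli' i / i.factorial : ℚ) : K) •
          (g.nestedDer x.1.val (List.ofFn n) + g.nested x.2.1 (List.ofFn n)) -
        ((bernoulli i / i.factorial : ℚ) : K) •
          (g.nestedDer x.1.val (List.ofFn n) + g.nested (x.2.2.1 : M) (List.ofFn n))) := by
  obtain ⟨i, rfl⟩ : ∃ k, i = k + 1 := ⟨i - 1, by omega⟩
  have hne : List.ofFn n ≠ [] := by simp
  have hl : (List.ofFn fun j : Fin (i + 1) => cocylPath g P ((0, 0, 0, n j) : CocylSpace g P)) =
      (List.ofFn n).map fun a => ((0, a) : Semidirect g P) := by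
    rw [List.map_ofFn]; rfl
  refine cocyl_ext g ?_ ?_ ?_
  · rw [cocylFst_cocylMul, halfBracketMul_eq_zero _ _ _ 1 rfl]; rfl
  · rw [cocylSnd_cocylMul, halfBracketMul_eq_zero _ _ _ 1 rfl]; rfl
  · rw [cocylPath_cocylMul, cocylPathMul_apply, nestedMul_eq_nested, nestedMul_eq_nested]
    simp only [Fin.cons_zero, Fin.cons_succ]
    rw [hl, nested_semidirect g _ hne, nested_semidirect g _ hne]
    refine Prod.ext ?_ rfl
    simp only [Prod.fst_sub, Prod.smul_fst, smul_zero, sub_zero]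
    rfl

/-! The vanishing of a component of a vector is inherited by its even and odd parts. -/

theorem parityPart_cocyl_fst {v : CocylSpace g P} (h : v.1 = 0) (c : Bool) :
    (parityPart (isInternal_cocylGrading g hP) c v).1 = 0 :=
  map_parityPart_eq_zero (isInternal_cocylGrading g hP) (isInternal_relDerGrading g P)
    { toFun := fun v : CocylSpace g P => v.1,
      map_add' := fun _ _ => rfl,
      map_smul' := fun _ _ => rfl } 1 (fun _ _ hv => hv.1) h c

theorem parityPart_cocyl_m {v : CocylSpace g P} (h : v.2.1 = 0) (c : Bool) :
    (parityPart (isInternal_cocylGrading g hP) c v).2.1 = 0 :=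
  map_parityPart_eq_zero (isInternal_cocylGrading g hP) g.isInternal
    { toFun := fun v : CocylSpace g P => v.2.1,
      map_add' := fun _ _ => rfl,
      map_smul' := fun _ _ => rfl } 1 (fun _ _ hv => hv.2.1) h c

theorem parityPart_cocyl_l {v : CocylSpace g P} (h : v.2.2.1 = 0) (c : Bool) :
    (parityPart (isInternal_cocylGrading g hP) c v).2.2.1 = 0 :=
  map_parityPart_eq_zero (isInternal_cocylGrading g hP) (isInternal_ker g hP)
    { toFun := fun v : CocylSpace g P => v.2.2.1,
      map_add' := fun _ _ => rfl,
      map_smul' := fun _ _ => rfl } 1 (fun _ _ hv => hv.2.2.1) h c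

theorem parityPart_cocyl_n {v : CocylSpace g P} (h : v.2.2.2 = 0) (c : Bool) :
    (parityPart (isInternal_cocylGrading g hP) c v).2.2.2 = 0 :=
  map_parityPart_eq_zero (isInternal_cocylGrading g hP) g.isInternal
    { toFun := fun v : CocylSpace g P => v.2.2.2,
      map_add' := fun _ _ => rfl,
      map_smul' := fun _ _ => rfl } 0 (fun _ _ hv => by rw [add_zero]; exact hv.2.2.2) h c

variable [CharZero K]

/-- The coefficients with one argument in `s⁻¹Der(M/L) × s⁻¹M × s⁻¹L` and the others in `M`. -/
theorem cocylStructure_cons {i : ℕ} (hi : 1 ≤ i) {e : ℤ} {x : CocylSpace g P}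
    (hx : x ∈ cocylGrading g P e) {d : Fin i → ℤ} {n : Fin i → M}
    (hn : ∀ j, n j ∈ ℳ (d j)) :
    (cocylStructure g hP).q (i + 1)
        (Fin.cons (α := fun _ => CocylSpace g P) x fun j => (0, 0, 0, n j)) =
      (0, 0, 0, ∑ σ : Equiv.Perm (Fin i), koszulSign d σ •
        (((bernoulli' i / i.factorial : ℚ) : K) •
          (g.nestedDer x.1.val (List.ofFn fun j => n (σ j)) +
            g.nested x.2.1 (List.ofFn fun j => n (σ j))) -
        ((bernoulli i / i.factorial : ℚ) : K) •
          (g.nestedDer x.1.val (List.ofFn fun j => n (σ j)) +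
            g.nested (x.2.2.1 : M) (List.ofFn fun j => n (σ j))))) := by
  have hu : ∀ j, ((0, 0, 0, n j) : CocylSpace g P) ∈ cocylGrading g P (d j) := fun j =>
    ⟨zero_mem _, zero_mem _, zero_mem _, hn j⟩
  have h := gradedSymm_cons (isInternal_cocylGrading g hP) (cocylMul g hP (i + 1)) hx hu
    (fun ρ hρ => by
      obtain ⟨j, hj⟩ := Fin.exists_succ_eq.2 hρ
      refine cocylMul_eq_zero_of_head g hP ?_ ?_
      · rw [← hj, Fin.cons_succ]; rfl
      · rw [← hj, Fin.cons_succ]; rfl)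
  refine h.trans ?_
  simp only [cocylMul_cons g hP hi x]
  set ψ : M →ₗ[K] CocylSpace g P := LinearMap.inr K (relDer g P) _ ∘ₗ LinearMap.inr K M _ ∘ₗ
    LinearMap.inr K (LinearMap.ker P) M with hψ
  have hψ' : ∀ y, ((0, 0, 0, y) : CocylSpace g P) = ψ y := fun y => rfl
  simp only [hψ', map_sum, map_units_smul]

/-- The coefficients with two arguments in `s⁻¹Der(M/L) × s⁻¹M × s⁻¹L`. -/
theorem cocylStructure_binary {d : Fin 2 → ℤ} {v : Fin 2 → CocylSpace g P}
    (hv : ∀ i, v i ∈ cocylGrading g P (d i)) (h0 : ∀ i, cocylPath g P (v i) = 0)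
    {y : CocylSpace g P}
    (h1 : cocylFst g P y = (d 0 + 1).negOnePow •
      (semidirect g P).bracket (cocylFst g P (v 0)) (cocylFst g P (v 1)))
    (h2 : cocylSnd g P y = (d 0 + 1).negOnePow •
      (semidirect g P).bracket (cocylSnd g P (v 0)) (cocylSnd g P (v 1)))
    (h3 : cocylPath g P y = 0) : (cocylStructure g hP).q 2 v = y := by
  have h := gradedSymm_of_mem (isInternal_cocylGrading g hP) (cocylMul g hP 2) hv
  refine Eq.trans h ?_
  refine cocyl_ext g ?_ ?_ ?_
  · rw [h1, ← sum_perm_halfBracketMul (semidirect g P) (cocylFst_mem g) hv, map_sum]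
    simp only [map_units_smul, cocylFst_cocylMul]
  · rw [h2, ← sum_perm_halfBracketMul (semidirect g P) (cocylSnd_mem g) hv, map_sum]
    simp only [map_units_smul, cocylSnd_cocylMul]
  · rw [h3, map_sum]
    refine Finset.sum_eq_zero fun σ _ => ?_
    rw [map_units_smul, cocylPath_cocylMul, cocylPathMul_eq_zero_of_right g
      (u := fun i => v (σ i)) (i := 1) (by decide) (h0 _), smul_zero]

theorem cocylStructure_otherwise (α β γ δ : ℕ)
    (hne : ¬ (α + β + γ + δ = 1 ∨ (α + β + γ = 2 ∧ δ = 0 ∧ ¬ (β = 1 ∧ γ = 1)) ∨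
      (α = 1 ∧ β = 0 ∧ γ = 0 ∧ δ = 1) ∨ (α = 0 ∧ β + γ = 1)))
    (D : Fin α → relDer g P) (m : Fin β → M) (l : Fin γ → LinearMap.ker P) (n : Fin δ → M) :
    (cocylStructure g hP).q (α + β + γ + δ)
      (Fin.append (Fin.append (Fin.append (fun j => ((D j, 0, 0, 0) : CocylSpace g P))
        (fun j => (0, m j, 0, 0))) (fun j => (0, 0, l j, 0))) (fun j => (0, 0, 0, n j))) = 0 := by
  set v := Fin.append (Fin.append (Fin.append (fun j => ((D j, 0, 0, 0) : CocylSpace g P))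
    (fun j => (0, m j, 0, 0))) (fun j => (0, 0, l j, 0))) (fun j => (0, 0, 0, n j)) with hv
  refine gradedSymm_eq_zero (isInternal_cocylGrading g hP) _ v fun p σ => ?_
  set u : Fin (α + β + γ + δ) → CocylSpace g P :=
    fun i => parityPart (isInternal_cocylGrading g hP) (p (σ i)) (v (σ i)) with hu
  -- the arguments in the first three factors have no component in `M`
  have hghost : ∀ i : Fin (α + β + γ), cocylPath g P (u (σ.symm (Fin.castAdd δ i))) = 0 := by
    intro i
    refine Prod.ext rfl (parityPart_cocyl_n g hP ?_ _)
    rw [Equiv.apply_symm_apply, hv, Fin.append_left]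
    refine Fin.addCases (fun i => ?_) (fun i => ?_) i
    · rw [Fin.append_left]
      refine Fin.addCases (fun i => ?_) (fun i => ?_) i
      · rw [Fin.append_left]
      · rw [Fin.append_right]
    · rw [Fin.append_right]
  obtain hN | ⟨N, hN⟩ : α + β + γ + δ = 0 ∨ ∃ N, α + β + γ + δ = N + 1 := by
    cases h : α + β + γ + δ with
    | zero => exact Or.inl rfl
    | succ N => exact Or.inr ⟨N, rfl⟩
  · have : ∀ (k : ℕ) (hk : k = 0) (u : Fin k → CocylSpace g P), cocylMul g hP k u = 0 := by
      rintro _ rfl u; rfl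
    exact this _ hN u
  -- pass to arguments indexed by `Fin (N + 1)`
  obtain ⟨w, hw⟩ : ∃ w : Fin (N + 1) → CocylSpace g P, w = fun i => u (Fin.cast hN.symm i) :=
    ⟨_, rfl⟩
  have hcast : cocylMul g hP (α + β + γ + δ) u = cocylMul g hP (N + 1) w :=
    apply_eq_of_length_eq (fun n u => cocylMul g hP n u) hN fun i => by rw [hw]; rfl
  rw [hcast]
  have hw' : ∀ j, w (Fin.cast hN (σ.symm j)) =
      parityPart (isInternal_cocylGrading g hP) (p j) (v j) := by
    intro j
    rw [hw, hu]
    simp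
  have hN1 : 1 ≤ N := by omega
  by_cases h2 : 2 ≤ α + β + γ
  · have h3 : cocylPathMul g P N w = 0 := by
      refine cocylPathMul_eq_zero_of_two g
        (i := Fin.cast hN (σ.symm (Fin.castAdd δ ⟨0, by omega⟩)))
        (j := Fin.cast hN (σ.symm (Fin.castAdd δ ⟨1, by omega⟩))) ?_ ?_ ?_
      · intro h
        have := σ.symm.injective (Fin.cast_injective _ h)
        simp [Fin.ext_iff] at this
      · rw [hw]; exact hghost _
      · rw [hw]; exact hghost _
    by_cases hN2 : 2 ≤ N
    · obtain ⟨N, rfl⟩ : ∃ k, N = k + 2 := ⟨N - 2, by omega⟩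
      exact cocylMul_eq_zero g hP rfl rfl h3
    · obtain ⟨rfl, rfl, rfl, rfl⟩ : α = 0 ∧ β = 1 ∧ γ = 1 ∧ δ = 0 := by omega
      refine cocylMul_eq_zero g hP (halfBracketMul_eq_zero _ _ _
        (Fin.cast hN (σ.symm (Fin.castAdd 0
          (Fin.natAdd (0 + 1) (0 : Fin 1) : Fin (0 + 1 + 1))))) ?_)
        (halfBracketMul_eq_zero _ _ _
        (Fin.cast hN (σ.symm (Fin.castAdd 0
          (Fin.castAdd 1 (Fin.natAdd 0 (0 : Fin 1) : Fin (0 + 1)) : Fin (0 + 1 + 1))))) ?_) h3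
      · rw [hw']
        refine Prod.ext (parityPart_cocyl_fst g hP ?_ _) (parityPart_cocyl_m g hP ?_ _) <;>
          rw [hv, Fin.append_left, Fin.append_right]
      · rw [hw']
        refine Prod.ext (parityPart_cocyl_fst g hP ?_ _)
          (congrArg Subtype.val (parityPart_cocyl_l g hP ?_ _)) <;>
          rw [hv, Fin.append_left, Fin.append_left, Fin.append_right]
  · by_cases hα : α = 1
    · obtain ⟨rfl, rfl⟩ : β = 0 ∧ γ = 0 := by omega
      obtain ⟨N, rfl⟩ : ∃ k, N = k + 2 := ⟨N - 2, by omega⟩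
      -- all arguments are in `s⁻¹Der(M/L) × M`, and the Bernoulli numbers `B_N` and `B_N(1)` agree
      have hcomp : ∀ j, (v j).2.1 = 0 ∧ (v j).2.2.1 = 0 := by
        intro j
        rw [hv]
        refine Fin.addCases (fun j => ?_) (fun j => ?_) j
        · rw [Fin.append_left]
          refine Fin.addCases (fun j => ?_) (fun j => j.elim0) j
          rw [Fin.append_left]
          refine Fin.addCases (fun j => ?_) (fun j => j.elim0) j
          rw [Fin.append_left]
          exact ⟨rfl, rfl⟩
        · rw [Fin.append_right]
          exact ⟨rfl, rfl⟩
      refine cocylMul_eq_zero g hP rfl rfl ?_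
      have heq : cocylFst g P (w 0) = cocylSnd g P (w 0) := by
        have h0 : w 0 = w (Fin.cast hN (σ.symm (σ (Fin.cast hN.symm 0)))) := by simp
        rw [h0, hw']
        refine Prod.ext rfl ?_
        exact (parityPart_cocyl_m g hP (hcomp _).1 _).trans
          (congrArg Subtype.val (parityPart_cocyl_l g hP (hcomp _).2 _)).symm
      rw [cocylPathMul_apply, nestedMul_eq_nested, nestedMul_eq_nested, heq,
        bernoulli_eq_bernoulli'_of_ne_one (by omega), sub_self]
    · obtain ⟨rfl, rfl, rfl⟩ : α = 0 ∧ β = 0 ∧ γ = 0 := by omega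
      have hcomp : ∀ j, (v j).1 = 0 ∧ (v j).2.1 = 0 ∧ (v j).2.2.1 = 0 := by
        intro j
        rw [hv]
        refine Fin.addCases (fun j => j.elim0) (fun j => ?_) j
        rw [Fin.append_right]
        exact ⟨rfl, rfl, rfl⟩
      have h0 : w 0 = w (Fin.cast hN (σ.symm (σ (Fin.cast hN.symm 0)))) := by simp
      refine cocylMul_eq_zero_of_head g hP ?_ ?_
      · rw [h0, hw']
        exact Prod.ext (parityPart_cocyl_fst g hP (hcomp _).1 _)
          (parityPart_cocyl_m g hP (hcomp _).2.1 _)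
      · rw [h0, hw']
        exact Prod.ext (parityPart_cocyl_fst g hP (hcomp _).1 _)
          (congrArg Subtype.val (parityPart_cocyl_l g hP (hcomp _).2.2 _))

theorem semidirect_bracket_inr_inr (x y : M) :
    (semidirect g P).bracket (0, x) (0, y) = (0, g.bracket x y) := by
  rw [semidirect_bracket_inr_right]
  simp

theorem semidirect_bracket_inl_inr (D : relDer g P) (y : M) :
    (semidirect g P).bracket (D, 0) (0, y) = (0, D.val y) := by
  rw [semidirect_bracket_inr_right]
  simp

theorem semidirect_bracket_inl_inl (D E : relDer g P) :
    (semidirect g P).bracket (D, 0) (E, 0) = (relDerBracket g P D E, 0) := by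
  change semidirectBracket g P (D, 0) (E, 0) = _
  rw [semidirectBracket_apply]
  simp

theorem isCocylExtension_cocylStructure : IsCocylExtension g P (cocylStructure g hP) where
  linear D m l n := cocylStructure_linear g hP (D, m, l, n)
  binary_m_m i j m₁ h₁ m₂ h₂ := by
    refine cocylStructure_binary g hP (d := ![i - 1, j - 1]) ?_ ?_ ?_ ?_ rfl
    · refine Fin.forall_fin_two.2 ⟨?_, ?_⟩
      · refine ⟨zero_mem _, ?_, zero_mem _, zero_mem _⟩
        change m₁ ∈ ℳ (i - 1 + 1); rwa [sub_add_cancel]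
      · refine ⟨zero_mem _, ?_, zero_mem _, zero_mem _⟩
        change m₂ ∈ ℳ (j - 1 + 1); rwa [sub_add_cancel]
    · exact Fin.forall_fin_two.2 ⟨rfl, rfl⟩
    · change _ = (i - 1 + 1).negOnePow • (semidirect g P).bracket (0, m₁) (0, m₂)
      rw [sub_add_cancel, semidirect_bracket_inr_inr]
      exact Prod.ext (smul_zero _).symm rfl
    · change _ = (i - 1 + 1).negOnePow • (semidirect g P).bracket 0 0
      rw [map_zero, smul_zero]
      rfl
  binary_l_l i j l₁ l₂ h₁ h₂ := by
    refine ⟨⟨g.bracket l₁ l₂, hP.ker_closed _ l₁.2 _ l₂.2⟩, rfl, ?_⟩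
    refine cocylStructure_binary g hP (d := ![i - 1, j - 1]) ?_ ?_ ?_ ?_ rfl
    · refine Fin.forall_fin_two.2 ⟨?_, ?_⟩
      · refine ⟨zero_mem _, zero_mem _, ?_, zero_mem _⟩
        change (l₁ : M) ∈ ℳ (i - 1 + 1); rwa [sub_add_cancel]
      · refine ⟨zero_mem _, zero_mem _, ?_, zero_mem _⟩
        change (l₂ : M) ∈ ℳ (j - 1 + 1); rwa [sub_add_cancel]
    · exact Fin.forall_fin_two.2 ⟨rfl, rfl⟩
    · change _ = (i - 1 + 1).negOnePow • (semidirect g P).bracket 0 0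
      rw [map_zero, smul_zero]
      rfl
    · change _ = (i - 1 + 1).negOnePow • (semidirect g P).bracket (0, (l₁ : M)) (0, (l₂ : M))
      rw [sub_add_cancel, semidirect_bracket_inr_inr]
      exact Prod.ext (smul_zero _).symm (Submodule.coe_smul_of_tower _ _)
  binary_D_D i j D₁ D₂ h₁ h₂ := by
    refine ⟨relDerBracket g P D₁ D₂, relDerBracket_of_mem g h₁ h₂, ?_⟩
    have hb : (i - 1 + 1).negOnePow • (semidirect g P).bracket (D₁, 0) (D₂, 0) =
        (i.negOnePow • relDerBracket g P D₁ D₂, 0) := by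
      rw [sub_add_cancel, semidirect_bracket_inl_inl]
      rw [Prod.smul_mk, smul_zero]
    refine cocylStructure_binary g hP (d := ![i - 1, j - 1]) ?_ ?_ hb.symm hb.symm rfl
    · refine Fin.forall_fin_two.2 ⟨?_, ?_⟩
      · refine ⟨?_, zero_mem _, zero_mem _, zero_mem _⟩
        change (D₁ : M →ₗ[K] M) ∈ relDerDeg g P (i - 1 + 1); rwa [sub_add_cancel]
      · refine ⟨?_, zero_mem _, zero_mem _, zero_mem _⟩
        change (D₂ : M →ₗ[K] M) ∈ relDerDeg g P (j - 1 + 1); rwa [sub_add_cancel]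
    · exact Fin.forall_fin_two.2 ⟨rfl, rfl⟩
  binary_D_m i j D hD m hm := by
    refine cocylStructure_binary g hP (d := ![i - 1, j - 1]) ?_ ?_ ?_ ?_ rfl
    · refine Fin.forall_fin_two.2 ⟨?_, ?_⟩
      · refine ⟨?_, zero_mem _, zero_mem _, zero_mem _⟩
        change (D : M →ₗ[K] M) ∈ relDerDeg g P (i - 1 + 1); rwa [sub_add_cancel]
      · refine ⟨zero_mem _, ?_, zero_mem _, zero_mem _⟩
        change m ∈ ℳ (j - 1 + 1); rwa [sub_add_cancel]
    · exact Fin.forall_fin_two.2 ⟨rfl, rfl⟩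
    · change _ = (i - 1 + 1).negOnePow • (semidirect g P).bracket (D, 0) (0, m)
      rw [sub_add_cancel, semidirect_bracket_inl_inr]
      exact Prod.ext (smul_zero _).symm rfl
    · change _ = (i - 1 + 1).negOnePow • (semidirect g P).bracket (D, 0) 0
      rw [map_zero, smul_zero]
      rfl
  binary_D_l i j D l hD hl := by
    refine ⟨⟨D.val l, relDer_apply_mem_ker g D l.2⟩, rfl, ?_⟩
    refine cocylStructure_binary g hP (d := ![i - 1, j - 1]) ?_ ?_ ?_ ?_ rfl
    · refine Fin.forall_fin_two.2 ⟨?_, ?_⟩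
      · refine ⟨?_, zero_mem _, zero_mem _, zero_mem _⟩
        change (D : M →ₗ[K] M) ∈ relDerDeg g P (i - 1 + 1); rwa [sub_add_cancel]
      · refine ⟨zero_mem _, zero_mem _, ?_, zero_mem _⟩
        change (l : M) ∈ ℳ (j - 1 + 1); rwa [sub_add_cancel]
    · exact Fin.forall_fin_two.2 ⟨rfl, rfl⟩
    · change _ = (i - 1 + 1).negOnePow • (semidirect g P).bracket (D, 0) 0
      rw [map_zero, smul_zero]
      rfl
    · change _ = (i - 1 + 1).negOnePow • (semidirect g P).bracket (D, 0) (0, (l : M))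
      rw [sub_add_cancel, semidirect_bracket_inl_inr]
      exact Prod.ext (smul_zero _).symm (Submodule.coe_smul_of_tower _ _)
  binary_D_n i j D hD n hn := by
    have h := cocylStructure_cons g hP (i := 1) le_rfl (e := i - 1) (x := (D, 0, 0, 0))
      ⟨by change (D : M →ₗ[K] M) ∈ relDerDeg g P (i - 1 + 1); rwa [sub_add_cancel],
        zero_mem _, zero_mem _, zero_mem _⟩ (d := fun _ => j) (n := fun _ => n) (fun _ => hn)
    have hv : (![(D, 0, 0, 0), (0, 0, 0, n)] : Fin 2 → CocylSpace g P) =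
        Fin.cons (D, 0, 0, 0) fun _ : Fin 1 => (0, 0, 0, n) := by
      funext k
      fin_cases k <;> rfl
    rw [hv]
    refine h.trans ?_
    rw [Fintype.sum_unique, Equiv.Perm.default_eq, koszulSign_one, one_smul]
    simp only [ZeroMemClass.coe_zero, nested_zero, add_zero, bernoulli'_one, bernoulli_one,
      Nat.factorial_one, Nat.cast_one, div_one, ← sub_smul]
    rw [← Rat.cast_sub, show (1 / 2 - -1 / 2 : ℚ) = 1 by norm_num, Rat.cast_one, one_smul]
    rfl
  mixed_m i hi e m hm d n hn := by
    refine (cocylStructure_cons g hP hi (e := e - 1) (x := (0, m, 0, 0)) ⟨zero_mem _, ?_,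
      zero_mem _, zero_mem _⟩ hn).trans ?_
    · change m ∈ ℳ (e - 1 + 1); rwa [sub_add_cancel]
    · simp only [ZeroMemClass.coe_zero, nested_zero, nestedDer_zero, zero_add, smul_zero, sub_zero,
        GradedLieStructure.symNested, Finset.smul_sum]
      congr 4
      exact funext fun σ => smul_comm _ _ _
  mixed_l i hi e l hl d n hn := by
    refine (cocylStructure_cons g hP hi (e := e - 1) (x := (0, 0, l, 0)) ⟨zero_mem _, zero_mem _,
      ?_, zero_mem _⟩ hn).trans ?_
    · change (l : M) ∈ ℳ (e - 1 + 1); rwa [sub_add_cancel]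
    · simp only [ZeroMemClass.coe_zero, nested_zero, nestedDer_zero, zero_add, smul_zero, zero_sub,
        GradedLieStructure.symNested, Finset.smul_sum, ← Finset.sum_neg_distrib]
      congr 4
      refine funext fun σ => ?_
      rw [smul_neg, smul_comm]
  otherwise α β γ δ h D m l n := cocylStructure_otherwise g hP α β γ δ h D m l n

end CocylValues

/-! ### Taylor coefficients of the structure of higher derived brackets -/

section HDBValues

variable {K M : Type*} [Field K] [AddCommGroup M] [Module K M] {ℳ : ℤ → Submodule K M}
  (g : GradedLieStructure ℳ) {P : M →ₗ[K] M} (hP : IsLieProjection g P)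

theorem hdbMul_eq_zero {m : ℕ} {u : Fin (m + 1) → HDBSpace g P}
    (h1 : halfBracketMul (semidirect g P) (hdbFst g P) m u = 0)
    (h2 : hdbSndMul g P m u = 0) : hdbMul g hP (m + 1) u = 0 := by
  refine hdb_ext g ?_ ?_
  · rw [hdbFst_hdbMul, h1, map_zero]
  · rw [hdbSnd_hdbMul, h2, map_zero]

theorem hdbMul_eq_zero_of_head {m : ℕ} {u : Fin (m + 1) → HDBSpace g P}
    (h : hdbFst g P (u 0) = 0) : hdbMul g hP (m + 1) u = 0 := by
  refine hdbMul_eq_zero g hP (halfBracketMul_eq_zero _ _ m 0 h) ?_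
  rw [hdbSndMul_apply]
  refine Finset.sum_eq_zero fun k _ => ?_
  rw [nestedProjMul_eq_zero_of_left _ _ _ _ k m h, smul_zero]

theorem hdbSndMul_eq_zero_of_right {m : ℕ} {u : Fin (m + 1) → HDBSpace g P}
    {i : Fin (m + 1)} (hi : i ≠ 0) (h : hdbSnd g P (u i) = 0) : hdbSndMul g P m u = 0 := by
  rw [hdbSndMul_apply]
  refine Finset.sum_eq_zero fun k _ => ?_
  rw [nestedProjMul_eq_zero_of_right _ _ _ _ k m hi h, smul_zero]

/-- If two arguments have no component in `A`, then one of them is not in the first place. -/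
theorem hdbSndMul_eq_zero_of_two {n : ℕ} {u : Fin (n + 1) → HDBSpace g P} {i j : Fin (n + 1)}
    (hij : i ≠ j) (hi : hdbSnd g P (u i) = 0) (hj : hdbSnd g P (u j) = 0) :
    hdbSndMul g P n u = 0 := by
  by_cases h : i = 0
  · exact hdbSndMul_eq_zero_of_right g (fun h' => hij (h.trans h'.symm)) hj
  · exact hdbSndMul_eq_zero_of_right g h hi

theorem hdbSnd_hdbMul_cons {i : ℕ} (x : HDBSpace g P) (a : Fin i → LinearMap.range P) :
    hdbSnd g P (hdbMul g hP (i + 1)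
        (Fin.cons (α := fun _ => HDBSpace g P) x fun j => (0, 0, a j))) =
      (0, ∑ k ∈ Finset.range (i + 1),
        ((bernoulli (i - k) / (k.factorial * (i - k).factorial) : ℚ) : K) •
          g.nested (P (g.nestedDer x.1.val ((List.ofFn fun j => (a j : M)).take k) +
            g.nested x.2.1 ((List.ofFn fun j => (a j : M)).take k)))
            ((List.ofFn fun j => (a j : M)).drop k)) := by
  rw [hdbSnd_hdbMul, hdbSndMul_apply]
  have hl : (List.ofFn fun j : Fin i => hdbSnd g P ((0, 0, a j) : HDBSpace g P)) =
      (List.ofFn fun j => (a j : M)).map fun a => ((0, a) : Semidirect g P) := by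
    rw [List.map_ofFn]; rfl
  have hinr : ∀ y : M, ((0, y) : Semidirect g P) = LinearMap.inr K (relDer g P) M y :=
    fun y => rfl
  rw [hinr, map_sum]
  refine Finset.sum_congr rfl fun k hk => ?_
  rw [map_smul, nestedProjMul_eq_nested _ _ _ _ (by simpa [Nat.lt_succ_iff] using hk)]
  simp only [Fin.cons_zero, Fin.cons_succ]
  rw [hl, ← List.map_take, ← List.map_drop, semidirectProj_nested, nested_semidirect_inr]
  rfl

variable [CharZero K]

/-- The coefficients with one argument in `s⁻¹Der(M/L) × s⁻¹M` and the others in `A`. -/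
theorem hdbStructure_cons {i : ℕ} (hi : 1 ≤ i) {e : ℤ} {x : HDBSpace g P}
    (hx : x ∈ hdbGrading g P e) {d : Fin i → ℤ} {a : Fin i → LinearMap.range P}
    (ha : ∀ j, (a j : M) ∈ ℳ (d j)) {y : M}
    (hy : y = ∑ σ : Equiv.Perm (Fin i), koszulSign d σ • ∑ k ∈ Finset.range (i + 1),
        ((bernoulli (i - k) / (k.factorial * (i - k).factorial) : ℚ) : K) •
          g.nested (P (g.nestedDer x.1.val ((List.ofFn fun j => (a (σ j) : M)).take k) +
            g.nested x.2.1 ((List.ofFn fun j => (a (σ j) : M)).take k)))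
            ((List.ofFn fun j => (a (σ j) : M)).drop k)) :
    ∃ b : LinearMap.range P, (b : M) = y ∧ (hdbStructure g hP).q (i + 1)
        (Fin.cons (α := fun _ => HDBSpace g P) x fun j => (0, 0, a j)) = (0, 0, b) := by
  have hu : ∀ j, ((0, 0, a j) : HDBSpace g P) ∈ hdbGrading g P (d j) := fun j =>
    ⟨zero_mem _, zero_mem _, ha j⟩
  have h : (hdbStructure g hP).q (i + 1)
      (Fin.cons (α := fun _ => HDBSpace g P) x fun j => (0, 0, a j)) = _ :=
    gradedSymm_cons (isInternal_hdbGrading g hP) (hdbMul g hP (i + 1)) hx hu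
    (fun ρ hρ => by
      obtain ⟨j, hj⟩ := Fin.exists_succ_eq.2 hρ
      refine hdbMul_eq_zero_of_head g hP ?_
      rw [← hj, Fin.cons_succ]; rfl)
  have h1 := congrArg (hdbFst g P) h
  have h2 := congrArg (hdbSnd g P) h
  have hinr : ∀ y : M, ((0, y) : Semidirect g P) = LinearMap.inr K (relDer g P) M y :=
    fun y => rfl
  rw [map_sum] at h1 h2
  simp only [map_units_smul, hdbSnd_hdbMul_cons] at h1 h2
  simp only [hinr, ← map_units_smul, ← map_sum] at h2
  rw [← hy] at h2
  refine ⟨((hdbStructure g hP).q (i + 1)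
    (Fin.cons (α := fun _ => HDBSpace g P) x fun j => (0, 0, a j))).2.2,
    congrArg Prod.snd h2, hdb_ext g ?_ rfl⟩
  rw [h1]
  refine Finset.sum_eq_zero fun σ _ => ?_
  obtain ⟨i, rfl⟩ : ∃ k, i = k + 1 := ⟨i - 1, by omega⟩
  rw [hdbFst_hdbMul, halfBracketMul_eq_zero _ _ _ 1 rfl, smul_zero]

/-- The coefficients with two arguments in `s⁻¹Der(M/L) × s⁻¹M`. -/
theorem hdbStructure_binary {d : Fin 2 → ℤ} {v : Fin 2 → HDBSpace g P}
    (hv : ∀ i, v i ∈ hdbGrading g P (d i)) (h0 : ∀ i, hdbSnd g P (v i) = 0)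
    {y : HDBSpace g P}
    (h1 : hdbFst g P y = (d 0 + 1).negOnePow •
      (semidirect g P).bracket (hdbFst g P (v 0)) (hdbFst g P (v 1)))
    (h2 : hdbSnd g P y = 0) : (hdbStructure g hP).q 2 v = y := by
  have h := gradedSymm_of_mem (isInternal_hdbGrading g hP) (hdbMul g hP 2) hv
  refine Eq.trans h ?_
  refine hdb_ext g ?_ ?_
  · rw [h1, ← sum_perm_halfBracketMul (semidirect g P) (hdbFst_mem g) hv, map_sum]
    simp only [map_units_smul, hdbFst_hdbMul]
  · rw [h2, map_sum]
    refine Finset.sum_eq_zero fun σ _ => ?_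
    rw [map_units_smul, hdbSnd_hdbMul, hdbSndMul_eq_zero_of_right g
      (u := fun i => v (σ i)) (i := 1) (by decide) (h0 _), smul_zero]

theorem hdbStructure_otherwise (α β γ : ℕ) (hne : ¬ (α + β = 1 ∨ (α + β = 2 ∧ γ = 0)))
    (D : Fin α → relDer g P) (m : Fin β → M) (a : Fin γ → LinearMap.range P) :
    (hdbStructure g hP).q (α + β + γ)
      (Fin.append (Fin.append (fun j => ((D j, 0, 0) : HDBSpace g P)) (fun j => (0, m j, 0)))
        (fun j => (0, 0, a j))) = 0 := by
  set v := Fin.append (Fin.append (fun j => ((D j, 0, 0) : HDBSpace g P))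
    (fun j => (0, m j, 0))) (fun j => (0, 0, a j)) with hv
  refine gradedSymm_eq_zero (isInternal_hdbGrading g hP) _ v fun p σ => ?_
  set u : Fin (α + β + γ) → HDBSpace g P :=
    fun i => parityPart (isInternal_hdbGrading g hP) (p (σ i)) (v (σ i)) with hu
  -- the arguments in the first two factors have no component in `A`
  have hghost : ∀ i : Fin (α + β), hdbSnd g P (u (σ.symm (Fin.castAdd γ i))) = 0 := by
    intro i
    refine map_parityPart_eq_zero (isInternal_hdbGrading g hP) (semidirect g P).isInternal
      (hdbSnd g P) 0 (fun i v hv => by rw [add_zero]; exact hdbSnd_mem g i v hv) ?_ _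
    rw [Equiv.apply_symm_apply, hv, Fin.append_left]
    refine Fin.addCases (fun i => ?_) (fun i => ?_) i
    · rw [Fin.append_left]; rfl
    · rw [Fin.append_right]; rfl
  obtain hN | ⟨N, hN⟩ : α + β + γ = 0 ∨ ∃ N, α + β + γ = N + 1 := by
    cases h : α + β + γ with
    | zero => exact Or.inl rfl
    | succ N => exact Or.inr ⟨N, rfl⟩
  · have : ∀ (k : ℕ) (hk : k = 0) (u : Fin k → HDBSpace g P), hdbMul g hP k u = 0 := by
      rintro _ rfl u; rfl
    exact this _ hN u
  -- pass to arguments indexed by `Fin (N + 1)`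
  obtain ⟨w, hw⟩ : ∃ w : Fin (N + 1) → HDBSpace g P, w = fun i => u (Fin.cast hN.symm i) :=
    ⟨_, rfl⟩
  have hcast : hdbMul g hP (α + β + γ) u = hdbMul g hP (N + 1) w :=
    apply_eq_of_length_eq (fun n u => hdbMul g hP n u) hN fun i => by rw [hw]; rfl
  rw [hcast]
  by_cases h2 : 2 ≤ α + β
  · obtain ⟨N, rfl⟩ : ∃ k, N = k + 2 := ⟨N - 2, by omega⟩
    refine hdbMul_eq_zero g hP rfl (hdbSndMul_eq_zero_of_two g
      (i := Fin.cast hN (σ.symm (Fin.castAdd γ ⟨0, by omega⟩)))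
      (j := Fin.cast hN (σ.symm (Fin.castAdd γ ⟨1, by omega⟩))) ?_ ?_ ?_)
    · intro h
      have := σ.symm.injective (Fin.cast_injective _ h)
      simp [Fin.ext_iff] at this
    · rw [hw]; exact hghost _
    · rw [hw]; exact hghost _
  · obtain ⟨rfl, rfl⟩ : α = 0 ∧ β = 0 := by omega
    refine hdbMul_eq_zero_of_head g hP ?_
    rw [hw]
    refine map_parityPart_eq_zero (isInternal_hdbGrading g hP) (semidirect g P).isInternal
      (hdbFst g P) 1 (hdbFst_mem g) ?_ _
    rw [hv]
    refine Fin.addCases (fun j => j.elim0) (fun j => ?_) (σ (Fin.cast hN.symm 0))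
    rw [Fin.append_right]
    rfl

theorem isHDBStructure_hdbStructure : IsHDBStructure g P (hdbStructure g hP) where
  linear D m a := hdbStructure_linear g hP (D, m, a)
  binary_m_m i j m₁ h₁ m₂ h₂ := by
    refine hdbStructure_binary g hP (d := ![i - 1, j - 1]) ?_ ?_ ?_ rfl
    · refine Fin.forall_fin_two.2 ⟨?_, ?_⟩
      · refine ⟨zero_mem _, ?_, zero_mem _⟩
        change m₁ ∈ ℳ (i - 1 + 1); rwa [sub_add_cancel]
      · refine ⟨zero_mem _, ?_, zero_mem _⟩
        change m₂ ∈ ℳ (j - 1 + 1); rwa [sub_add_cancel]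
    · exact Fin.forall_fin_two.2 ⟨rfl, rfl⟩
    · change _ = (i - 1 + 1).negOnePow • (semidirect g P).bracket (0, m₁) (0, m₂)
      rw [sub_add_cancel, semidirect_bracket_inr_inr]
      exact Prod.ext (smul_zero _).symm rfl
  binary_D_D i j D₁ D₂ h₁ h₂ := by
    refine ⟨relDerBracket g P D₁ D₂, relDerBracket_of_mem g h₁ h₂, ?_⟩
    have hb : (i - 1 + 1).negOnePow • (semidirect g P).bracket (D₁, 0) (D₂, 0) =
        (i.negOnePow • relDerBracket g P D₁ D₂, 0) := by
      rw [sub_add_cancel, semidirect_bracket_inl_inl]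
      rw [Prod.smul_mk, smul_zero]
    refine hdbStructure_binary g hP (d := ![i - 1, j - 1]) ?_ ?_ hb.symm rfl
    · refine Fin.forall_fin_two.2 ⟨?_, ?_⟩
      · refine ⟨?_, zero_mem _, zero_mem _⟩
        change (D₁ : M →ₗ[K] M) ∈ relDerDeg g P (i - 1 + 1); rwa [sub_add_cancel]
      · refine ⟨?_, zero_mem _, zero_mem _⟩
        change (D₂ : M →ₗ[K] M) ∈ relDerDeg g P (j - 1 + 1); rwa [sub_add_cancel]
    · exact Fin.forall_fin_two.2 ⟨rfl, rfl⟩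
  binary_D_m i j D hD m hm := by
    refine hdbStructure_binary g hP (d := ![i - 1, j - 1]) ?_ ?_ ?_ rfl
    · refine Fin.forall_fin_two.2 ⟨?_, ?_⟩
      · refine ⟨?_, zero_mem _, zero_mem _⟩
        change (D : M →ₗ[K] M) ∈ relDerDeg g P (i - 1 + 1); rwa [sub_add_cancel]
      · refine ⟨zero_mem _, ?_, zero_mem _⟩
        change m ∈ ℳ (j - 1 + 1); rwa [sub_add_cancel]
    · exact Fin.forall_fin_two.2 ⟨rfl, rfl⟩
    · change _ = (i - 1 + 1).negOnePow • (semidirect g P).bracket (D, 0) (0, m)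
      rw [sub_add_cancel, semidirect_bracket_inl_inr]
      exact Prod.ext (smul_zero _).symm rfl
  mixed_D i hi e D hD d a ha := by
    refine hdbStructure_cons g hP hi (e := e - 1) (x := (D, 0, 0)) ⟨?_, zero_mem _, zero_mem _⟩
      ha ?_
    · change (D : M →ₗ[K] M) ∈ relDerDeg g P (e - 1 + 1); rwa [sub_add_cancel]
    · refine Finset.sum_congr rfl fun σ _ => ?_
      congr 1
      simp only [nested_zero, add_zero]
      -- the term with `k = 0` vanishes
      rw [Finset.sum_range_eq_add_Ico _ (Nat.succ_pos i)]
      simp only [List.take_zero, GradedLieStructure.nestedDer, map_zero, nested_zero, smul_zero,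
        zero_add]
      rfl
  mixed_m i hi e m hm d a ha := by
    refine hdbStructure_cons g hP hi (e := e - 1) (x := (0, m, 0)) ⟨zero_mem _, ?_, zero_mem _⟩
      ha ?_
    · change m ∈ ℳ (e - 1 + 1); rwa [sub_add_cancel]
    · refine Finset.sum_congr rfl fun σ _ => ?_
      congr 1
      simp only [ZeroMemClass.coe_zero, nestedDer_zero, zero_add]
      rw [Finset.range_eq_Ico]
      rfl
  otherwise α β γ h D m a := hdbStructure_otherwise g hP α β γ h D m a

end HDBValues

theorem mainTheorem3 {K M : Type*} [Field K] [CharZero K] [AddCommGroup M] [Module K M]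
    {ℳ : ℤ → Submodule K M} (g : GradedLieStructure ℳ) (P : M →ₗ[K] M)
    (hP : IsLieProjection g P) :
    ∃ (Q : LInfinityOne (cocylGrading g P)) (R : LInfinityOne (hdbGrading g P)),
      IsCocylExtension g P Q ∧ IsHDBStructure g P R ∧
      IsHomotopyTransfer Q R (retrProj g P) (retrIncl hP) (retrHomotopy hP) :=
  ⟨cocylStructure g hP, hdbStructure g hP, isCocylExtension_cocylStructure g hP,
    isHDBStructure_hdbStructure g hP, isHomotopyTransfer g hP⟩
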